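/- Call a finite simple graph outer-planar if it can be drawn without crossings with all its vertices on the outer face; equivalently, it has a crossing-free drawing in a closed disc, with simple arcs as edges, in which all vertices lie on the boundary circle. An outer-planar graph is maximal if no edge can be added to it on the same vertex set without destroying outer-planarity. A cartogram of a graph $G=(V,E)$ with weight function $w:V\to\mathbb{R}^+$ assigns to every vertex $v$ a closed simple polygon $P(v)$ in the plane such that all $P(v)$ are rectilinear (every side is axis-parallel), their interiors are pairwise disjoint, for any two distinct vertices $u,v$ the boundaries of $P(u)$ and $P(v)$ share a non-degenerate line segment if and only if $uv\in E$, and the area of $P(v)$ equals $w(v)$ for every $v$. Theorem. Every maximal outer-planar graph $G$ with $n\ge 1$ vertices and positive real vertex weights $w$ has a cartogram in which every polygon has at most $6$ sides and the union of all polygons is an axis-parallel rectangle (there are no holes). Moreover, such a cartogram can be computed in linear time: there are a single program for the real RAM (exact real arithmetic $+,-,\times,/$ and comparison of real numbers at unit cost) and a constant $C$ such that, for every such $G$ and $w$, given $n$, a list of the edges of $G$ in arbitrary order, and the weights, the program halts after at most $Cn$ steps and outputs the corners of all polygons of such a cartogram. -/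

import Mathlib

/-! ## Maximal outer-planar graphs -/

/-- A crossing-free drawing of a graph in the closed unit disc of the plane with all vertices on the
boundary circle (so that all vertices lie on the outer face): vertices are distinct points of the
circle, every edge is a simple arc inside the disc joining its two ends, an arc passes through no
other vertex, and two arcs meet at most in common end vertices. -/
structure DiscDrawing {V : Type*} (G : SimpleGraph V) where
  pos : V → ℂ
  curve : Sym2 V → Set ℂ
  pos_injective : Function.Injective pos
  pos_mem_circle : ∀ v, pos v ∈ Metric.sphere (0 : ℂ) 1
  curve_isArc : ∀ u v, G.Adj u v →
    ∃ γ : Path (pos u) (pos v), Function.Injective γ ∧ Set.range γ = curve s(u, v)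
  curve_subset_disc : ∀ e ∈ G.edgeSet, curve e ⊆ Metric.closedBall (0 : ℂ) 1
  mem_of_pos_mem_curve : ∀ e ∈ G.edgeSet, ∀ x, pos x ∈ curve e → x ∈ e
  curve_inter_subset : ∀ e ∈ G.edgeSet, ∀ f ∈ G.edgeSet, e ≠ f →
    curve e ∩ curve f ⊆ pos '' {x | x ∈ e ∧ x ∈ f}

/-- Outer-planar graphs: drawable without crossings with all vertices on the outer face. -/
def IsOuterplanar {V : Type*} (G : SimpleGraph V) : Prop :=
  Nonempty (DiscDrawing G)

/-- No edge can be added (on the same vertex set) without violating outer-planarity. -/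
def IsMaximalOuterplanar {V : Type*} (G : SimpleGraph V) : Prop :=
  Maximal (fun H : SimpleGraph V => IsOuterplanar H) G

/-! ## Rectilinear polygons and cartograms -/

/-- The closed polygonal curve through the corners has sides of positive length and does not meet
itself: the sides, each without its final end point, are pairwise disjoint. -/
def IsSimplePolygon {k : ℕ} (P : Polygon (ℝ × ℝ) k) : Prop :=
  3 ≤ k ∧ P.HasNondegenerateEdges ∧
    ∀ i j : Fin k, i ≠ j →
      Disjoint (P.edgeSet ℝ i \ {P (finRotate k i)}) (P.edgeSet ℝ j \ {P (finRotate k j)})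

/-- Every side is axis-parallel and consecutive sides are perpendicular, one horizontal and one
vertical. Hence, for a simple polygon, `k` is the true number of sides (and of corners). -/
def IsRectilinearPolygon {k : ℕ} (P : Polygon (ℝ × ℝ) k) : Prop :=
  ∀ i : Fin k,
    ((P i).2 = (P (finRotate k i)).2 ∧
      (P (finRotate k i)).1 = (P (finRotate k (finRotate k i))).1) ∨
    ((P i).1 = (P (finRotate k i)).1 ∧
      (P (finRotate k i)).2 = (P (finRotate k (finRotate k i))).2)

/-- The closed region of a polygon: its boundary together with the bounded components of the
complement of its boundary. -/
def polygonRegion {k : ℕ} (P : Polygon (ℝ × ℝ) k) : Set (ℝ × ℝ) :=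
  P.boundary ℝ ∪
    {x | x ∉ P.boundary ℝ ∧ Bornology.IsBounded (connectedComponentIn (P.boundary ℝ)ᶜ x)}

/-- The polygons `P v` form a cartogram of the graph `G` with respect to the weights `w`. -/
structure IsCartogram {V : Type*} (G : SimpleGraph V) (w : V → ℝ)
    {k : V → ℕ} (P : ∀ v, Polygon (ℝ × ℝ) (k v)) : Prop where
  simple : ∀ v, IsSimplePolygon (P v)
  rectilinear : ∀ v, IsRectilinearPolygon (P v)
  interior_disjoint : ∀ u v, u ≠ v →
    Disjoint (interior (polygonRegion (P u))) (interior (polygonRegion (P v)))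
  contact_iff_adj : ∀ u v, u ≠ v →
    ((∃ a b : ℝ × ℝ, a ≠ b ∧ segment ℝ a b ⊆ (P u).boundary ℝ ∩ (P v).boundary ℝ) ↔ G.Adj u v)
  area : ∀ v, MeasureTheory.volume (polygonRegion (P v)) = ENNReal.ofReal (w v)

/-! ## The real RAM

A random access machine with registers and arrays that hold natural numbers, and registers and
arrays that hold real numbers. Arithmetic on the real numbers is exact. On natural numbers the
machine can only copy, compare, and count up and down by one, so no large integers can be built up
quickly. Every instruction and every test takes one time step. Arrays are numbered; the number of an
array is a fixed part of an instruction, and only the index within the array is read from a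
register. -/

namespace RealRAM

structure State where
  reg : ℕ → ℕ
  mem : ℕ → ℕ → ℕ
  rreg : ℕ → ℝ
  rmem : ℕ → ℕ → ℝ

inductive Instr where
  /-- `reg d := c` -/
  | const (d c : ℕ)
  /-- `reg d := reg a` -/
  | copy (d a : ℕ)
  /-- `reg d := reg d + 1` -/
  | succ (d : ℕ)
  /-- `reg d := reg d - 1`, where zero stays zero -/
  | pred (d : ℕ)
  /-- `reg d := mem m [reg i]` -/
  | load (d m i : ℕ)
  /-- `mem m [reg i] := reg a` -/
  | store (m i a : ℕ)
  /-- `rreg d := c` -/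
  | rconst (d c : ℕ)
  /-- `rreg d := rreg a` -/
  | rcopy (d a : ℕ)
  /-- `rreg d := rreg a + rreg b` -/
  | radd (d a b : ℕ)
  /-- `rreg d := rreg a - rreg b` -/
  | rsub (d a b : ℕ)
  /-- `rreg d := rreg a * rreg b` -/
  | rmul (d a b : ℕ)
  /-- `rreg d := rreg a / rreg b`, where division by zero gives zero -/
  | rdiv (d a b : ℕ)
  /-- `rreg d := rmem m [reg i]` -/
  | rload (d m i : ℕ)
  /-- `rmem m [reg i] := rreg a` -/
  | rstore (m i a : ℕ)

noncomputable def Instr.exec (s : State) : Instr → State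
  | const d c => { s with reg := Function.update s.reg d c }
  | copy d a => { s with reg := Function.update s.reg d (s.reg a) }
  | succ d => { s with reg := Function.update s.reg d (s.reg d + 1) }
  | pred d => { s with reg := Function.update s.reg d (s.reg d - 1) }
  | load d m i => { s with reg := Function.update s.reg d (s.mem m (s.reg i)) }
  | store m i a =>
      { s with mem := Function.update s.mem m (Function.update (s.mem m) (s.reg i) (s.reg a)) }
  | rconst d c => { s with rreg := Function.update s.rreg d (c : ℝ) }
  | rcopy d a => { s with rreg := Function.update s.rreg d (s.rreg a) }
  | radd d a b => { s with rreg := Function.update s.rreg d (s.rreg a + s.rreg b) }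
  | rsub d a b => { s with rreg := Function.update s.rreg d (s.rreg a - s.rreg b) }
  | rmul d a b => { s with rreg := Function.update s.rreg d (s.rreg a * s.rreg b) }
  | rdiv d a b => { s with rreg := Function.update s.rreg d (s.rreg a / s.rreg b) }
  | rload d m i => { s with rreg := Function.update s.rreg d (s.rmem m (s.reg i)) }
  | rstore m i a =>
      { s with rmem := Function.update s.rmem m (Function.update (s.rmem m) (s.reg i) (s.rreg a)) }

/-- Comparisons of two natural or of two real registers. -/
inductive Test where
  | lt (a b : ℕ)
  | eq (a b : ℕ)
  | rlt (a b : ℕ)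

def Test.Holds (s : State) : Test → Prop
  | lt a b => s.reg a < s.reg b
  | eq a b => s.reg a = s.reg b
  | rlt a b => s.rreg a < s.rreg b

inductive Program where
  | instr (o : Instr)
  | seq (p q : Program)
  | ite (c : Test) (p q : Program)
  | while (c : Test) (p : Program)

/-- `Runs p s s' t`: started in state `s`, the program `p` halts in state `s'` after exactly `t`
time steps. -/
inductive Runs : Program → State → State → ℕ → Prop where
  | instr (o : Instr) (s : State) : Runs (.instr o) s (o.exec s) 1
  | seq {p q : Program} {s s₁ s₂ : State} {t₁ t₂ : ℕ} :
      Runs p s s₁ t₁ → Runs q s₁ s₂ t₂ → Runs (.seq p q) s s₂ (t₁ + t₂)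
  | ite_true {c : Test} {p q : Program} {s s₁ : State} {t : ℕ} :
      c.Holds s → Runs p s s₁ t → Runs (.ite c p q) s s₁ (t + 1)
  | ite_false {c : Test} {p q : Program} {s s₁ : State} {t : ℕ} :
      ¬ c.Holds s → Runs q s s₁ t → Runs (.ite c p q) s s₁ (t + 1)
  | while_true {c : Test} {p : Program} {s s₁ s₂ : State} {t₁ t₂ : ℕ} :
      c.Holds s → Runs p s s₁ t₁ → Runs (.while c p) s₁ s₂ t₂ →
        Runs (.while c p) s s₂ (t₁ + t₂ + 1)
  | while_false {c : Test} {p : Program} {s : State} :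
      ¬ c.Holds s → Runs (.while c p) s s 1

/-- The list `E` contains each edge of `G` exactly once, in any order and with either orientation. -/
def IsEdgeList {n : ℕ} (G : SimpleGraph (Fin n)) (E : List (Fin n × Fin n)) : Prop :=
  (E.map fun e => s(e.1, e.2)).Nodup ∧ ∀ e, e ∈ E.map (fun e => s(e.1, e.2)) ↔ e ∈ G.edgeSet

/-- The initial state: registers `0` and `1` hold the numbers of vertices and of edges, arrays `0`
and `1` the two ends of each edge, the real array `0` the weights; everything else is zero. -/
noncomputable def input {n : ℕ} (E : List (Fin n × Fin n)) (w : Fin n → ℝ) : State where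
  reg i := if i = 0 then n else if i = 1 then E.length else 0
  mem m i := if h : i < E.length then
      (if m = 0 then (E[i].1 : ℕ) else if m = 1 then (E[i].2 : ℕ) else 0) else 0
  rreg _ := 0
  rmem m i := if h : i < n then (if m = 0 then w ⟨i, h⟩ else 0) else 0

/-- The polygon that a final state holds for vertex `v`: its number of corners is in array `2`, the
`x`- and `y`-coordinates of its corner `j` are in the real arrays `2 * j + 1` and `2 * j + 2`. -/
def output (s : State) (v : ℕ) : Polygon (ℝ × ℝ) (s.mem 2 v) :=
  ⟨fun j => (s.rmem (2 * (j : ℕ) + 1) v, s.rmem (2 * (j : ℕ) + 2) v)⟩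

end RealRAM

/-! The geometry is first reduced to a cyclic order. Two arcs in the disc whose ends interleave on
the circle must meet (`exists_eq_of_interleaved`), so the edges of an outer-planar graph, seen as
chords, are pairwise non-crossing. Conversely, non-crossing straight chords form a drawing. Hence
maximality says that two vertices separated by no edge are adjacent
(`IsMaximalOuterplanar.exists_separation`), and from then on only the separation relation matters.

A graph of this kind with at least three vertices has, besides any prescribed vertex, a vertex with
at most two neighbours (`exists_card_nbrs_le_two`), and deleting such a vertex keeps the structure
(`SaturatedOn.erase`). Read backwards, the graph grows from an edge `s r`: in a linear order from
`s` to `r`, each new vertex `d` goes between two consecutive present vertices `x` and `y`, and these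
are its only neighbours among those present.

The layout imitates this growth inside the strip between the lines `x = 0` and `x = 1`. For
consecutive `x`, `y` a rectangle reaching to the right side of the strip is kept free. It is
bordered by `x` on the left and above and by `y` below, and its area is the total weight of the
vertices still to come between `x` and `y`. The new vertex `d` enters at the bottom of this
rectangle as an L-shape over its full width, with a notch at the lower right corner. It touches `x`
on the left and `y` below. The notch is bordered by `d` and `y`, and the rest above the L-shape by
`x` and `d`, in exactly the same manner, so the invariant persists (`IsLayout.insert`). The area of
the notch can be prescribed (`notch_area`, `cell_area`), so all weights are met and nothing is left
over. Non-adjacent polygons do not even share a point. If the notch has area zero, the L-shape is a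
rectangle.

For linear time, a queue of vertices with at most two remaining neighbours yields the deletion
order, each removal being paid for by the adjacency list of the removed vertex. A reverse pass
decides which of the two neighbours comes first, a forward pass accumulates the areas of the free
rectangles, and a last reverse pass writes the corners. The number of edges is at most twice the
number of vertices (`sum_card_nbrs_le`). -/

/-! ### Arcs in the disc with interleaved ends -/

open Complex in
-- Half-angle formulas give `1 - exp (φ i) = 2 sin (φ / 2) exp ((φ - π) i / 2)`, where the sine is
-- positive.
theorem arg_one_sub_exp_mul_I {φ : ℝ} (h0 : 0 < φ) (h1 : φ < 2 * Real.pi) :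
    (1 - exp (φ * I)).arg = (φ - Real.pi) / 2 := by
  have hs : 0 < Real.sin (φ / 2) := Real.sin_pos_of_pos_of_lt_pi (by linarith) (by linarith)
  have key : 1 - exp (φ * I) = ((2 * Real.sin (φ / 2) : ℝ) : ℂ) *
      (Complex.cos (((φ - Real.pi) / 2 : ℝ) : ℂ) + Complex.sin (((φ - Real.pi) / 2 : ℝ) : ℂ) * I) := by
    have e1 : (φ - Real.pi) / 2 = φ / 2 - Real.pi / 2 := by ring
    have e2 : φ = 2 * (φ / 2) := by ring
    rw [← Complex.ofReal_cos, ← Complex.ofReal_sin, e1, Real.cos_sub_pi_div_two,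
      Real.sin_sub_pi_div_two, Complex.exp_mul_I, ← Complex.ofReal_cos, ← Complex.ofReal_sin]
    have c1 : Real.cos φ = 1 - 2 * Real.sin (φ / 2) ^ 2 := by
      conv_lhs => rw [e2]
      rw [Real.cos_two_mul, Real.cos_sq']; ring
    have c2 : Real.sin φ = 2 * Real.sin (φ / 2) * Real.cos (φ / 2) := by
      conv_lhs => rw [e2]
      rw [Real.sin_two_mul]
    rw [c1, c2]
    generalize Real.sin (φ / 2) = x
    generalize Real.cos (φ / 2) = y
    push_cast
    ring
  rw [key, Complex.arg_mul_cos_add_sin_mul_I (by linarith)]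
  constructor <;> linarith [Real.pi_pos]

/-- A continuous logarithm along a path in the disc, seen from a point `c` of the circle. -/
theorem log_variation_of_mem_closedBall {c k : ℂ} (hc : ‖c‖ = 1) (z ℓ : ℝ → ℂ) (hz : Continuous z)
    (hb : ∀ t, ‖z t‖ ≤ 1) (hne : ∀ t, z t ≠ c) (hℓ : Continuous ℓ)
    (hexp : ∀ t, Complex.exp (ℓ t) = k * (c - z t)) (t₀ t₁ : ℝ) :
    (ℓ t₁).im - (ℓ t₀).im = (1 - z t₁ / c).arg - (1 - z t₀ / c).arg := by
  have hc0 : c ≠ 0 := by rintro rfl; simp at hc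
  -- The point `z t / c` lies in the unit disc and is not `1`, so `1 - z t / c` stays in the open
  -- right half-plane, where the principal logarithm is continuous.
  have hre : ∀ t, 0 < (1 - z t / c).re := by
    intro t
    have h1 : ‖z t / c‖ ≤ 1 := by rw [norm_div, hc, div_one]; exact hb t
    have h2 : (z t / c).re ≤ 1 := (Complex.re_le_norm _).trans h1
    rcases h2.lt_or_eq with h | h
    · simpa using h
    · exfalso
      have him : (z t / c).im = 0 := by
        have := Complex.sq_norm (z t / c)
        rw [Complex.normSq_apply, h] at this
        nlinarith [norm_nonneg (z t / c), mul_self_nonneg (z t / c).im]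
      have : z t / c = 1 := Complex.ext (by simpa using h) (by simpa using him)
      exact hne t ((div_eq_one_iff_eq hc0).1 this)
  have hcont : Continuous fun t => ℓ t - Complex.log (1 - z t / c) := by
    refine hℓ.sub (Continuous.clog (by fun_prop) fun t => Or.inl (hre t))
  have hconst : ∀ t, Complex.exp (ℓ t - Complex.log (1 - z t / c)) = k * c := by
    intro t
    have h0 : 1 - z t / c ≠ 0 := fun h => by have := hre t; rw [h] at this; simp at this
    rw [Complex.exp_sub, Complex.exp_log h0, hexp, div_eq_iff h0]
    field_simp
  -- The difference of the two logarithms is a continuous lift of a constant through the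
  -- exponential, hence constant.
  have := Complex.isCoveringMap_exp.eq_of_comp_eq hcont
    (continuous_const (y := ℓ t₀ - Complex.log (1 - z t₀ / c)))
    (by ext t; simp [hconst]) t₀ rfl
  have h2 := congrArg Complex.im (congrFun this t₁)
  simp only [Complex.sub_im, Complex.log_im] at h2
  linarith

open Complex in
/-- Two arcs in the closed disc whose ends interleave on the circle meet. -/
theorem exists_eq_of_interleaved {α β γ δ : ℝ} (h₁ : α < β) (h₂ : β < γ) (h₃ : γ < δ)
    (h₄ : δ < α + 2 * Real.pi) (f : Path (exp (α * I)) (exp (γ * I)))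
    (g : Path (exp (β * I)) (exp (δ * I))) (hf : ∀ t, ‖f t‖ ≤ 1) (hg : ∀ t, ‖g t‖ ≤ 1) :
    ∃ s t, f s = g t := by
  by_contra! hne
  have hf' : ∀ t, ‖f.extend t‖ ≤ 1 := fun t => hf _
  have hg' : ∀ t, ‖g.extend t‖ ≤ 1 := fun t => hg _
  have hne' : ∀ s t, f.extend s ≠ g.extend t := fun s t => hne _ _
  -- If the arcs do not meet, `f s - g t` has no zero on the simply connected plane of pairs `(s,
  -- t)` and so has a continuous logarithm. Its change around the parameter square must vanish, but
  -- on each side one arc rests at a point of the circle and the change is known.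
  obtain ⟨L, hL, hexp⟩ := Complex.exists_continuousOn_eqOn_exp_comp (X := ℝ × ℝ) (U := Set.univ)
    (g := fun p => f.extend p.1 - g.extend p.2)
    (by
      have : ContractibleSpace (Set.univ : Set (ℝ × ℝ)) :=
        (convex_univ (𝕜 := ℝ) (E := ℝ × ℝ)).contractibleSpace Set.univ_nonempty
      exact (inferInstance : SimplyConnectedSpace (Set.univ : Set (ℝ × ℝ))))
    isOpen_univ (by fun_prop)
    (by rintro ⟨p, -, hp⟩; exact hne' _ _ (sub_eq_zero.1 hp))
  have hL : Continuous L := continuousOn_univ.1 hL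
  have hexp : ∀ s t, exp (L (s, t)) = f.extend s - g.extend t := fun s t => hexp (Set.mem_univ (s, t))
  have nrm : ∀ x : ℝ, ‖exp (x * I)‖ = 1 := Complex.norm_exp_ofReal_mul_I
  have f0 : f.extend 0 = exp (α * I) := by simp
  have f1 : f.extend 1 = exp (γ * I) := by simp
  have g0 : g.extend 0 = exp (β * I) := by simp
  have g1 : g.extend 1 = exp (δ * I) := by simp
  have eA := log_variation_of_mem_closedBall (k := 1) (nrm α) g.extend (fun t => L (0, t)) (by fun_prop) hg'
    (fun t => f0 ▸ (hne' 0 t).symm) (by fun_prop) (fun t => by rw [hexp, f0, one_mul]) 0 1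
  have eC := log_variation_of_mem_closedBall (k := 1) (nrm γ) g.extend (fun t => L (1, t)) (by fun_prop) hg'
    (fun t => f1 ▸ (hne' 1 t).symm) (by fun_prop) (fun t => by rw [hexp, f1, one_mul]) 0 1
  have eB := log_variation_of_mem_closedBall (k := -1) (nrm β) f.extend (fun s => L (s, 0)) (by fun_prop) hf'
    (fun t => g0 ▸ (hne' t 0)) (by fun_prop) (fun t => by rw [hexp, g0]; ring) 0 1
  have eD := log_variation_of_mem_closedBall (k := -1) (nrm δ) f.extend (fun s => L (s, 1)) (by fun_prop) hf'
    (fun t => g1 ▸ (hne' t 1)) (by fun_prop) (fun t => by rw [hexp, g1]; ring) 0 1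
  have q : ∀ x y : ℝ, exp (x * I) / exp (y * I) = exp (((x - y : ℝ) : ℂ) * I) := by
    intro x y; rw [← Complex.exp_sub]; congr 1; push_cast; ring
  -- For negative differences of angles; the shift brings them into `(0, 2π)`, where the formula for
  -- the argument applies.
  have q' : ∀ x y : ℝ, exp (x * I) / exp (y * I) = exp (((x - y + 2 * Real.pi : ℝ) : ℂ) * I) := by
    intro x y
    rw [q]
    push_cast
    rw [add_mul, Complex.exp_add, Complex.exp_two_pi_mul_I, mul_one]
  rw [g0, g1, q, q, arg_one_sub_exp_mul_I (by linarith) (by linarith),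
    arg_one_sub_exp_mul_I (by linarith) (by linarith)] at eA
  rw [g0, g1, q' β γ, q δ γ, arg_one_sub_exp_mul_I (by linarith) (by linarith),
    arg_one_sub_exp_mul_I (by linarith) (by linarith)] at eC
  rw [f0, f1, q γ β, q' α β, arg_one_sub_exp_mul_I (by linarith) (by linarith),
    arg_one_sub_exp_mul_I (by linarith) (by linarith)] at eB
  rw [f0, f1, q' γ δ, q' α δ, arg_one_sub_exp_mul_I (by linarith) (by linarith),
    arg_one_sub_exp_mul_I (by linarith) (by linarith)] at eD
  -- The two ways from `(0, 0)` to `(1, 1)` along the sides of the square give imaginary parts that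
  -- differ by `2π`.
  linarith [Real.pi_pos]

/-! ### From drawings to the cyclic order of the vertices -/

/-- Twice the signed area of the triangle `p q r`. -/
def orient (p q r : ℂ) : ℝ := (q - p).re * (r - p).im - (q - p).im * (r - p).re

/-- The area is a sum of sines of differences, and `sin 2a + sin 2b - sin 2(a + b) = 4 sin a sin b
sin (a + b)`. The factored form makes the sign visible. -/
theorem orient_exp {c : ℂ} (hc : ‖c‖ = 1) (x y z : ℝ) :
    orient (c * Complex.exp (x * Complex.I)) (c * Complex.exp (y * Complex.I))
      (c * Complex.exp (z * Complex.I)) =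
    4 * Real.sin ((y - x) / 2) * Real.sin ((z - y) / 2) * Real.sin ((z - x) / 2) := by
  have hc2 : c.re * c.re + c.im * c.im = 1 := by
    rw [← Complex.normSq_apply, ← Complex.sq_norm, hc, one_pow]
  have h1 : orient (c * Complex.exp (x * Complex.I)) (c * Complex.exp (y * Complex.I))
      (c * Complex.exp (z * Complex.I)) = Real.sin (y - x) + Real.sin (z - y) - Real.sin (z - x) := by
    simp only [orient, Complex.exp_mul_I, ← Complex.ofReal_cos, ← Complex.ofReal_sin]
    simp only [Complex.sub_re, Complex.sub_im, Complex.mul_re, Complex.mul_im, Complex.add_re,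
      Complex.add_im, Complex.ofReal_re, Complex.ofReal_im, Complex.I_re, Complex.I_im,
      Real.sin_sub]
    linear_combination (Real.sin y * Real.cos x - Real.cos y * Real.sin x
      + (Real.sin z * Real.cos y - Real.cos z * Real.sin y)
      - (Real.sin z * Real.cos x - Real.cos z * Real.sin x)) * hc2
  rw [h1]
  have e1 : y - x = 2 * ((y - x) / 2) := by ring
  have e2 : z - y = 2 * ((z - y) / 2) := by ring
  have e3 : z - x = 2 * ((y - x) / 2 + (z - y) / 2) := by ring
  have e4 : (z - x) / 2 = (y - x) / 2 + (z - y) / 2 := by ring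
  rw [e4, e3]
  conv_lhs => rw [e1, e2]
  generalize (y - x) / 2 = a
  generalize (z - y) / 2 = b
  have ha := Real.sin_sq_add_cos_sq a
  have hb := Real.sin_sq_add_cos_sq b
  simp only [Real.sin_two_mul, Real.sin_add, Real.cos_add]
  have hm : 2 * (2 * a / 2) = 2 * a := by ring
  have hn : 2 * (2 * b / 2) = 2 * b := by ring
  simp only [mul_div_cancel_left₀ a (two_ne_zero (α := ℝ)), mul_div_cancel_left₀ b (two_ne_zero (α := ℝ))]
  linear_combination (-2 * Real.sin b * Real.cos b) * ha + (-2 * Real.sin a * Real.cos a) * hb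

/-- Sign agreement is stated with a positive factor so that signs of products of such sines can be
read off by algebra. -/
theorem exists_sin_half_eq_mul {x : ℝ} (h0 : -(2 * Real.pi) < x) (h1 : x < 2 * Real.pi) :
    ∃ k > 0, Real.sin (x / 2) = k * x := by
  rcases lt_trichotomy x 0 with h | h | h
  · refine ⟨Real.sin (x / 2) / x, ?_, (div_mul_cancel₀ _ h.ne).symm⟩
    exact div_pos_of_neg_of_neg (Real.sin_neg_of_neg_of_neg_pi_lt (by linarith) (by linarith)) h
  · exact ⟨1, one_pos, by simp [h]⟩
  · refine ⟨Real.sin (x / 2) / x, ?_, by field_simp⟩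
    exact div_pos (Real.sin_pos_of_pos_of_lt_pi (by linarith) (by linarith)) h

/-- In the linear order given by `θ`, the pairs `u v` and `a b` interleave. -/
def Crosses {V : Type*} (θ : V → ℝ) (u v a b : V) : Prop :=
  (θ u - θ a) * (θ u - θ b) * ((θ v - θ a) * (θ v - θ b)) < 0

/-- The points of the circle labelled `a` and `b` lie on different sides of the chord `u v`. -/
def Separates {V : Type*} (pos : V → ℂ) (u v a b : V) : Prop :=
  orient (pos u) (pos v) (pos a) * orient (pos u) (pos v) (pos b) < 0

section Circle

variable {V : Type*} {pos : V → ℂ}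

/-- This cuts the circle open at `r`: the angle is measured from `r` and reduced modulo `2π`. -/
theorem exists_angle (hinj : Function.Injective pos) (hpos : ∀ v, ‖pos v‖ = 1) (r : V) :
    ∃ θ : V → ℝ, Function.Injective θ ∧ θ r = 0 ∧ (∀ v, 0 ≤ θ v ∧ θ v < 2 * Real.pi) ∧
      (∀ v, pos v = pos r * Complex.exp (θ v * Complex.I)) := by
  have hr : pos r ≠ 0 := by intro h; simpa [h] using hpos r
  have key : ∀ v, pos v = pos r *
      Complex.exp ((toIcoMod Real.two_pi_pos 0 (pos v / pos r).arg : ℝ) * Complex.I) := by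
    intro v
    have h1 : ‖pos v / pos r‖ = 1 := by rw [norm_div, hpos, hpos, div_one]
    have h2 := Complex.norm_mul_exp_arg_mul_I (pos v / pos r)
    rw [h1, Complex.ofReal_one, one_mul] at h2
    have h3 : Complex.exp ((toIcoMod Real.two_pi_pos 0 (pos v / pos r).arg : ℝ) * Complex.I)
        = Complex.exp ((pos v / pos r).arg * Complex.I) := by
      rw [Complex.exp_eq_exp_iff_exists_int]
      refine ⟨-toIcoDiv Real.two_pi_pos 0 (pos v / pos r).arg, ?_⟩
      rw [toIcoMod]
      simp only [zsmul_eq_mul]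
      push_cast
      ring
    rw [h3, h2, mul_div_cancel₀ _ hr]
  refine ⟨fun v => toIcoMod Real.two_pi_pos 0 (pos v / pos r).arg, ?_, by simp [div_self hr], ?_, key⟩
  · intro u v huv
    apply hinj
    rw [key u, key v]
    simp only at huv
    rw [huv]
  · intro v
    have := toIcoMod_mem_Ico Real.two_pi_pos 0 (pos v / pos r).arg
    simpa using this

theorem orient_eq_mul {r : V} {θ : V → ℝ} (hpos : ∀ v, ‖pos v‖ = 1)
    (hθ : ∀ v, 0 ≤ θ v ∧ θ v < 2 * Real.pi)
    (hexp : ∀ v, pos v = pos r * Complex.exp (θ v * Complex.I)) (u v a : V) :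
    ∃ k > 0, orient (pos u) (pos v) (pos a) =
      k * ((θ v - θ u) * ((θ a - θ v) * (θ a - θ u))) := by
  have aux : ∀ u v, -(2 * Real.pi) < θ u - θ v ∧ θ u - θ v < 2 * Real.pi := fun u v =>
    ⟨by linarith [(hθ u).1, (hθ v).2], by linarith [(hθ u).2, (hθ v).1]⟩
  obtain ⟨k1, h1, e1⟩ := exists_sin_half_eq_mul (aux v u).1 (aux v u).2
  obtain ⟨k2, h2, e2⟩ := exists_sin_half_eq_mul (aux a v).1 (aux a v).2
  obtain ⟨k3, h3, e3⟩ := exists_sin_half_eq_mul (aux a u).1 (aux a u).2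
  refine ⟨4 * k1 * k2 * k3, by positivity, ?_⟩
  rw [hexp u, hexp v, hexp a, orient_exp (hpos r), e1, e2, e3]
  ring

/-- In the product of the two orientations the factor `θ v - θ u` occurs squared and drops out.
Since separation does not mention the cut, crossing is the same in every linear order obtained by
cutting the circle open. -/
theorem separates_iff_crosses {r : V} {θ : V → ℝ} (hinj : Function.Injective θ)
    (hpos : ∀ v, ‖pos v‖ = 1) (hθ : ∀ v, 0 ≤ θ v ∧ θ v < 2 * Real.pi)
    (hexp : ∀ v, pos v = pos r * Complex.exp (θ v * Complex.I)) (u v a b : V) :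
    Separates pos u v a b ↔ Crosses θ u v a b := by
  obtain ⟨k, hk, ek⟩ := orient_eq_mul hpos hθ hexp u v a
  obtain ⟨l, hl, el⟩ := orient_eq_mul hpos hθ hexp u v b
  unfold Separates Crosses
  rw [ek, el]
  by_cases huv : u = v
  · subst huv
    refine iff_of_false (by simp) (not_lt.2 (mul_self_nonneg _))
  · have h0 : 0 < (θ v - θ u) ^ 2 := by
      have : θ v - θ u ≠ 0 := sub_ne_zero.2 fun h => huv (hinj h).symm
      positivity
    have : k * ((θ v - θ u) * ((θ a - θ v) * (θ a - θ u))) *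
        (l * ((θ v - θ u) * ((θ b - θ v) * (θ b - θ u)))) =
        (k * l * (θ v - θ u) ^ 2) *
          ((θ u - θ a) * (θ u - θ b) * ((θ v - θ a) * (θ v - θ b))) := by ring
    rw [this]
    have hp : 0 < k * l * (θ v - θ u) ^ 2 := by positivity
    constructor
    · intro h; by_contra h'; exact absurd h (not_lt.2 (mul_nonneg hp.le (not_lt.1 h')))
    · intro h; exact mul_neg_of_pos_of_neg hp h

theorem orient_eq_zero_iff (hinj : Function.Injective pos) (hpos : ∀ v, ‖pos v‖ = 1) {u v a : V}
    (huv : u ≠ v) : orient (pos u) (pos v) (pos a) = 0 ↔ a = u ∨ a = v := by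
  obtain ⟨θ, hθi, -, hθ, hexp⟩ := exists_angle hinj hpos u
  obtain ⟨k, hk, ek⟩ := orient_eq_mul hpos hθ hexp u v a
  have h1 : θ v - θ u ≠ 0 := sub_ne_zero.2 fun h => huv (hθi h).symm
  rw [ek]
  simp [hk.ne', h1, sub_eq_zero, hθi.eq_iff, or_comm]

theorem Crosses.comm {θ : V → ℝ} {u v a b : V} (h : Crosses θ u v a b) : Crosses θ a b u v := by
  unfold Crosses at *
  convert h using 1
  ring

theorem orient_lineMap (p q x y : ℂ) (t : ℝ) :
    orient p q (AffineMap.lineMap x y t) = (1 - t) * orient p q x + t * orient p q y := by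
  simp only [orient, AffineMap.lineMap_apply, vsub_eq_sub, vadd_eq_add, Complex.sub_re,
    Complex.sub_im, Complex.add_re, Complex.add_im, Complex.real_smul, Complex.mul_re,
    Complex.mul_im, Complex.ofReal_re, Complex.ofReal_im]
  ring

theorem orient_eq_zero_of_mem_segment {p q x : ℂ} (h : x ∈ segment ℝ p q) : orient p q x = 0 := by
  rw [segment_eq_image_lineMap] at h
  obtain ⟨t, -, rfl⟩ := h
  rw [orient_lineMap]
  simp only [orient, sub_self, Complex.zero_re, Complex.zero_im]
  ring

/-- The orientation relative to the line `u v` is affine along the chord `a b`. If its values at `a`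
and `b` do not have opposite signs, it can vanish only at an end where it is zero, and no three
points of a circle are collinear. -/
theorem segment_inter_segment_subset (hinj : Function.Injective pos) (hpos : ∀ v, ‖pos v‖ = 1)
    {u v a b : V} (huv : u ≠ v) (hab : a ≠ b) (hne : s(u, v) ≠ s(a, b))
    (hsep : ¬ Separates pos u v a b) :
    segment ℝ (pos u) (pos v) ∩ segment ℝ (pos a) (pos b) ⊆
      pos '' {x | x ∈ s(u, v) ∧ x ∈ s(a, b)} := by
  rintro x ⟨hx1, hx2⟩
  have h0 := orient_eq_zero_of_mem_segment hx1
  rw [segment_eq_image_lineMap] at hx2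
  obtain ⟨t, ⟨ht0, ht1⟩, rfl⟩ := hx2
  rw [orient_lineMap] at h0
  have hza := orient_eq_zero_iff hinj hpos (a := a) huv
  have hzb := orient_eq_zero_iff hinj hpos (a := b) huv
  unfold Separates at hsep
  set A := orient (pos u) (pos v) (pos a)
  set B := orient (pos u) (pos v) (pos b)
  by_cases hA : A = 0
  · by_cases hB : B = 0
    · exfalso
      rcases hza.1 hA with rfl | rfl <;> rcases hzb.1 hB with rfl | rfl
      · exact hab rfl
      · exact hne rfl
      · exact hne Sym2.eq_swap
      · exact hab rfl
    · have : t = 0 := by simpa [hA, hB] using h0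
      subst this
      exact ⟨a, ⟨by simpa using hza.1 hA, by simp⟩, by simp⟩
  · by_cases hB : B = 0
    · have : t = 1 := by
        have h : (1 - t) * A = 0 := by simpa [hB] using h0
        rcases mul_eq_zero.1 h with h | h
        · linarith
        · exact absurd h hA
      subst this
      exact ⟨b, ⟨by simpa using hzb.1 hB, by simp⟩, by simp⟩
    · exfalso
      have hAB : 0 < A * B := lt_of_le_of_ne (not_lt.1 hsep) (mul_ne_zero hA hB).symm
      have h1 : (1 - t) * A ^ 2 + t * (A * B) = 0 := by linear_combination A * h0
      have hA2 : 0 < A ^ 2 := by positivity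
      rcases ht0.lt_or_eq with h | h
      · nlinarith [mul_pos h hAB, mul_nonneg (sub_nonneg.2 ht1) hA2.le]
      · subst h; linarith

theorem isOuterplanar_of_not_separates {G : SimpleGraph V} (hinj : Function.Injective pos)
    (hpos : ∀ v, ‖pos v‖ = 1)
    (h : ∀ u v a b, G.Adj u v → G.Adj a b → ¬ Separates pos u v a b) : IsOuterplanar G := by
  refine ⟨⟨pos, Sym2.lift ⟨fun u v => segment ℝ (pos u) (pos v), fun u v => segment_symm ℝ _ _⟩,
    hinj, fun v => by simpa using hpos v, ?_, ?_, ?_, ?_⟩⟩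
  · intro u v huv
    refine ⟨⟨⟨fun t => AffineMap.lineMap (pos u) (pos v) (t : ℝ), by fun_prop⟩, by simp, by simp⟩,
      ?_, ?_⟩
    · intro s t hst
      exact Subtype.ext (AffineMap.lineMap_injective ℝ (hinj.ne huv.ne) hst)
    · simp only [Sym2.lift_mk, segment_eq_image_lineMap, Path.coe_mk_mk]
      ext x
      simp
  · intro e
    induction e with | _ u v
    intro _
    simp only [Sym2.lift_mk]
    refine (convex_closedBall (0 : ℂ) 1).segment_subset ?_ ?_ <;> simp [hpos]
  · intro e
    induction e with | _ u v
    intro huv x hx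
    have := (orient_eq_zero_iff hinj hpos (SimpleGraph.mem_edgeSet _ |>.1 huv).ne).1
      (orient_eq_zero_of_mem_segment hx)
    simpa using this
  · intro e
    induction e with | _ u v
    intro huv f
    induction f with | _ a b
    intro hab hne
    exact segment_inter_segment_subset hinj hpos (SimpleGraph.mem_edgeSet _ |>.1 huv).ne
      (SimpleGraph.mem_edgeSet _ |>.1 hab).ne hne (h u v a b huv hab)

theorem not_separates_of_drawing {G : SimpleGraph V} (D : DiscDrawing G) {u v a b : V}
    (huv : G.Adj u v) (hab : G.Adj a b) : ¬ Separates D.pos u v a b := by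
  have hpos : ∀ v, ‖D.pos v‖ = 1 := fun v => by simpa using D.pos_mem_circle v
  intro hsep
  -- After swapping `a` and `b` if necessary, the circle cut open at `u` carries the ends in the
  -- order `u`, `a`, `v`, `b`. The two arcs then meet, and since they have no common end this
  -- contradicts the drawing.
  wlog hlt : orient (D.pos u) (D.pos v) (D.pos a) < 0 generalizing a b
  · refine this hab.symm (by unfold Separates at *; linarith) ?_
    unfold Separates at hsep
    by_contra h'
    nlinarith [mul_nonneg (not_lt.1 hlt) (not_lt.1 h')]
  have hlt' : 0 < orient (D.pos u) (D.pos v) (D.pos b) := by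
    unfold Separates at hsep
    by_contra h'
    nlinarith [mul_nonneg_of_nonpos_of_nonpos hlt.le (not_lt.1 h')]
  obtain ⟨θ, hθi, hθu, hθ, hexp⟩ := exists_angle D.pos_injective hpos u
  have hpos_of_ne : ∀ x, x ≠ u → 0 < θ x := fun x hx =>
    lt_of_le_of_ne (hθ x).1 fun h => hx (hθi (by rw [hθu, ← h]))
  have hau : a ≠ u := by
    rintro rfl; exact hlt.ne ((orient_eq_zero_iff D.pos_injective hpos huv.ne).2 (Or.inl rfl))
  have hbu : b ≠ u := by
    rintro rfl; exact hlt'.ne' ((orient_eq_zero_iff D.pos_injective hpos huv.ne).2 (Or.inl rfl))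
  have hv := hpos_of_ne v huv.ne'
  have ha := hpos_of_ne a hau
  have hb := hpos_of_ne b hbu
  obtain ⟨k, hk, ek⟩ := orient_eq_mul hpos hθ hexp u v a
  obtain ⟨l, hl, el⟩ := orient_eq_mul hpos hθ hexp u v b
  rw [ek, hθu, sub_zero, sub_zero] at hlt
  rw [el, hθu, sub_zero, sub_zero] at hlt'
  have hav : θ a < θ v := by
    by_contra h
    exact absurd hlt (not_lt.2 (mul_nonneg hk.le (mul_nonneg hv.le
      (mul_nonneg (sub_nonneg.2 (not_lt.1 h)) ha.le))))
  have hvb : θ v < θ b := by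
    by_contra h
    exact absurd hlt' (not_lt.2 (mul_nonpos_of_nonneg_of_nonpos hl.le
      (mul_nonpos_of_nonneg_of_nonpos hv.le
      (mul_nonpos_of_nonpos_of_nonneg (sub_nonpos.2 (not_lt.1 h)) hb.le))))
  obtain ⟨f, -, hf⟩ := D.curve_isArc u v huv
  obtain ⟨g, -, hg⟩ := D.curve_isArc a b hab
  set φ := (D.pos u).arg
  have hang : ∀ x, D.pos x = Complex.exp (((φ + θ x : ℝ) : ℂ) * Complex.I) := by
    intro x
    have h2 := Complex.norm_mul_exp_arg_mul_I (D.pos u)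
    rw [hpos, Complex.ofReal_one, one_mul] at h2
    rw [hexp x, Complex.ofReal_add, add_mul, Complex.exp_add, h2]
  have hmem : ∀ x y (h : G.Adj x y) z, z ∈ D.curve s(x, y) → ‖z‖ ≤ 1 := fun x y h z hz => by
    simpa using D.curve_subset_disc s(x, y) h hz
  obtain ⟨s, t, hst⟩ := exists_eq_of_interleaved (α := φ + θ u) (β := φ + θ a) (γ := φ + θ v)
    (δ := φ + θ b) (by linarith) (by linarith) (by linarith) (by linarith [(hθ b).2])
    (f.cast (hang u).symm (hang v).symm) (g.cast (hang a).symm (hang b).symm)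
    (fun t => hmem u v huv _ (hf ▸ ⟨t, rfl⟩)) (fun t => hmem a b hab _ (hg ▸ ⟨t, rfl⟩))
  have hne : s(u, v) ≠ s(a, b) := by
    intro h
    have : u ∈ s(a, b) := h ▸ Sym2.mem_mk_left u v
    rcases Sym2.mem_iff.1 this with h | h
    · exact hau h.symm
    · exact hbu h.symm
  have hmem1 : f s ∈ D.curve s(u, v) := hf ▸ ⟨s, rfl⟩
  have hmem2 : g t ∈ D.curve s(a, b) := hg ▸ ⟨t, rfl⟩
  obtain ⟨x, ⟨hx1, hx2⟩, -⟩ := D.curve_inter_subset s(u, v) huv s(a, b) hab hne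
    ⟨hmem1, (show f s = g t from hst) ▸ hmem2⟩
  rcases Sym2.mem_iff.1 hx1 with rfl | rfl <;> rcases Sym2.mem_iff.1 hx2 with rfl | rfl
  · exact hau rfl
  · exact hbu rfl
  · exact hav.ne rfl
  · exact hvb.ne rfl

/-- In a maximal outer-planar graph the vertices have a cyclic order (here given by the separation
relation and the linear orders obtained by cutting it open) such that the edges are exactly the
pairs that no edge separates. -/
theorem IsMaximalOuterplanar.exists_separation {G : SimpleGraph V} (hG : IsMaximalOuterplanar G) :
    ∃ sep : V → V → V → V → Prop,
      (∀ r, ∃ θ : V → ℝ, Function.Injective θ ∧ (∀ v, θ r ≤ θ v) ∧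
        ∀ u v a b, sep u v a b ↔ Crosses θ u v a b) ∧
      (∀ u v a b, G.Adj u v → G.Adj a b → ¬ sep u v a b) ∧
      (∀ u v, u ≠ v → (∀ a b, G.Adj a b → ¬ sep u v a b) → G.Adj u v) := by
  obtain ⟨⟨D⟩, hmax⟩ := hG
  have hpos : ∀ v, ‖D.pos v‖ = 1 := fun v => by simpa using D.pos_mem_circle v
  have hex : ∀ r, ∃ θ : V → ℝ, Function.Injective θ ∧ (∀ v, θ r ≤ θ v) ∧
        ∀ u v a b, Separates D.pos u v a b ↔ Crosses θ u v a b := by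
    intro r
    obtain ⟨θ, hθi, hθr, hθ, hexp⟩ := exists_angle D.pos_injective hpos r
    exact ⟨θ, hθi, fun v => hθr ▸ (hθ v).1, separates_iff_crosses hθi hpos hθ hexp⟩
  refine ⟨Separates D.pos, hex, fun u v a b => not_separates_of_drawing D, ?_⟩
  intro u v huv h
  -- Keep the vertices in place and replace all arcs by chords: the old edges still do not cross
  -- each other, and by assumption they do not cross `u v`. Maximality then puts `u v` into the
  -- graph.
  have hout : IsOuterplanar (G ⊔ SimpleGraph.edge u v) := by
    refine isOuterplanar_of_not_separates D.pos_injective hpos ?_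
    obtain ⟨θ, -, -, hθ⟩ := hex u
    intro x y a b hxy hab
    simp only [SimpleGraph.sup_adj, SimpleGraph.edge_adj] at hxy hab
    have symm1 : ∀ x y a b, Crosses θ x y a b → Crosses θ y x a b := by
      intro x y a b h; unfold Crosses at *; linarith
    have symm2 : ∀ x y a b, Crosses θ x y a b → Crosses θ x y b a := by
      intro x y a b h; unfold Crosses at *; linarith
    simp only [hθ] at h ⊢
    have h' : ∀ a b, G.Adj a b → ¬ Crosses θ v u a b := fun a b hab hc => h a b hab (symm1 _ _ _ _ hc)
    have hs : ∀ x y, ¬ Crosses θ x y x y := fun x y hc => by unfold Crosses at hc; simp at hc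
    have hs' : ∀ x y, ¬ Crosses θ x y y x := fun x y hc => by unfold Crosses at hc; simp at hc
    rcases hxy with hxy | ⟨⟨rfl, rfl⟩ | ⟨rfl, rfl⟩, -⟩ <;>
      rcases hab with hab | ⟨⟨rfl, rfl⟩ | ⟨rfl, rfl⟩, -⟩
    · exact fun hc => not_separates_of_drawing D hxy hab ((hθ _ _ _ _).2 hc)
    · exact fun hc => h _ _ hxy hc.comm
    · exact fun hc => h' _ _ hxy hc.comm
    · exact h _ _ hab
    · exact hs _ _
    · exact hs' _ _
    · exact h' _ _ hab
    · exact hs' _ _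
    · exact hs _ _
  exact hmax hout le_sup_left (Or.inr (by simp [SimpleGraph.edge_adj, huv]))

end Circle

/-! ## Elimination of vertices of degree two -/

/-- The combinatorial content of a maximal outer-planar graph: a cyclic order of the vertices,
given by its separation relation, such that no two edges cross and every pair that no edge
separates is an edge. -/
structure IsOuterTriangulation {V : Type*} (G : SimpleGraph V) (sep : V → V → V → V → Prop) :
    Prop where
  cut : ∀ r, ∃ θ : V → ℝ, Function.Injective θ ∧ (∀ v, θ r ≤ θ v) ∧
    ∀ u v a b, sep u v a b ↔ Crosses θ u v a b
  noncrossing : ∀ u v a b, G.Adj u v → G.Adj a b → ¬ sep u v a b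
  saturated : ∀ u v, u ≠ v → (∀ a b, G.Adj a b → ¬ sep u v a b) → G.Adj u v

/-- Any two vertices of `A` that no edge inside `A` separates are adjacent. -/
def SaturatedOn {V : Type*} (G : SimpleGraph V) (sep : V → V → V → V → Prop) (A : Finset V) :
    Prop :=
  ∀ u ∈ A, ∀ v ∈ A, u ≠ v → (∀ a ∈ A, ∀ b ∈ A, G.Adj a b → ¬ sep u v a b) → G.Adj u v

open Classical in
/-- The neighbours of `v` inside `A`. -/
noncomputable def nbrs {V : Type*} (G : SimpleGraph V) (A : Finset V) (v : V) : Finset V :=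
  A.filter (G.Adj v)

section Elimination

variable {V : Type*} {G : SimpleGraph V} {sep : V → V → V → V → Prop} {A : Finset V}

@[simp] theorem mem_nbrs {u v : V} : u ∈ nbrs G A v ↔ u ∈ A ∧ G.Adj v u := by simp [nbrs]

theorem IsOuterTriangulation.saturatedOn_univ [Fintype V] (hG : IsOuterTriangulation G sep) :
    SaturatedOn G sep Finset.univ :=
  fun u _ v _ huv h => hG.saturated u v huv fun a b => h a (Finset.mem_univ _) b (Finset.mem_univ _)

open Classical in
/-- The cyclic neighbours of `d` in `A` are adjacent to `d`. -/
theorem exists_cyclic_neighbors (hG : IsOuterTriangulation G sep) (hA : SaturatedOn G sep A)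
    (hc : 3 ≤ A.card) {d : V} (hd : d ∈ A) :
    ∃ (θ : V → ℝ) (x y : V), Function.Injective θ ∧ (∀ v, θ d ≤ θ v) ∧
      (∀ u v a b, sep u v a b ↔ Crosses θ u v a b) ∧ x ∈ A ∧ y ∈ A ∧ x ≠ d ∧ y ≠ d ∧ θ x < θ y ∧
      (∀ z ∈ A, z ≠ d → θ x ≤ θ z ∧ θ z ≤ θ y) ∧ G.Adj d x ∧ G.Adj d y := by
  obtain ⟨θ, hθi, hθd, hθ⟩ := hG.cut d
  have hc' : 1 < (A.erase d).card := by rw [Finset.card_erase_of_mem hd]; omega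
  have hne : (A.erase d).Nonempty := Finset.card_pos.1 (by omega)
  obtain ⟨x, hx, hxmin⟩ := Finset.exists_min_image _ θ hne
  obtain ⟨y, hy, hymax⟩ := Finset.exists_max_image _ θ hne
  simp only [Finset.mem_erase] at hx hy hxmin hymax
  have hxy : θ x < θ y := by
    obtain ⟨a, ha, b, hb, hab⟩ := Finset.one_lt_card.1 hc'
    simp only [Finset.mem_erase] at ha hb
    rcases lt_or_gt_of_ne (hθi.ne hab) with h | h
    · exact (hxmin a ha).trans_lt (h.trans_le (hymax b hb))
    · exact (hxmin b hb).trans_lt (h.trans_le (hymax a ha))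
  refine ⟨θ, x, y, hθi, hθd, hθ, hx.2, hy.2, hx.1, hy.1, hxy,
    fun z hz hzd => ⟨hxmin z ⟨hzd, hz⟩, hymax z ⟨hzd, hz⟩⟩, ?_, ?_⟩
  · refine hA d hd x hx.2 hx.1.symm fun a ha b hb _ => ?_
    rw [hθ]
    refine not_lt.2 ?_
    have h1 := hθd a
    have h2 := hθd b
    by_cases had : a = d
    · simp [had]
    by_cases hbd : b = d
    · simp [hbd]
    have h3 := hxmin a ⟨had, ha⟩
    have h4 := hxmin b ⟨hbd, hb⟩
    exact mul_nonneg (mul_nonneg_of_nonpos_of_nonpos (by linarith) (by linarith))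
      (mul_nonneg_of_nonpos_of_nonpos (by linarith) (by linarith))
  · refine hA d hd y hy.2 hy.1.symm fun a ha b hb _ => ?_
    rw [hθ]
    refine not_lt.2 ?_
    have h1 := hθd a
    have h2 := hθd b
    by_cases had : a = d
    · simp [had]
    by_cases hbd : b = d
    · simp [hbd]
    have h3 := hymax a ⟨had, ha⟩
    have h4 := hymax b ⟨hbd, hb⟩
    exact mul_nonneg (mul_nonneg_of_nonpos_of_nonpos (by linarith) (by linarith))
      (mul_nonneg (by linarith) (by linarith))

theorem two_le_card_nbrs (hG : IsOuterTriangulation G sep) (hA : SaturatedOn G sep A)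
    (hc : 3 ≤ A.card) {d : V} (hd : d ∈ A) : 2 ≤ (nbrs G A d).card := by
  obtain ⟨θ, x, y, -, -, -, hx, hy, -, -, hxy, -, hdx, hdy⟩ := exists_cyclic_neighbors hG hA hc hd
  refine Finset.one_lt_card.2 ⟨x, by simp [hx, hdx], y, by simp [hy, hdy], ?_⟩
  rintro rfl
  exact lt_irrefl _ hxy

open Classical in
-- The at most two neighbours of `d` are its cyclic neighbours `x` and `y`. Cut open at `d`, all
-- other vertices of `A` lie between `x` and `y` inclusive, so the edges at `d` separate no pair of
-- them and their loss creates no new unseparated pair.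
theorem SaturatedOn.erase (hG : IsOuterTriangulation G sep) (hA : SaturatedOn G sep A)
    (hc : 3 ≤ A.card) {d : V} (hd : d ∈ A) (h2 : (nbrs G A d).card ≤ 2) :
    SaturatedOn G sep (A.erase d) := by
  obtain ⟨θ, x, y, hθi, hθd, hθ, hx, hy, hxd, hyd, hxy, hext, hdx, hdy⟩ :=
    exists_cyclic_neighbors hG hA hc hd
  have hne : x ≠ y := by rintro rfl; exact lt_irrefl _ hxy
  have hN : ∀ z ∈ A, G.Adj d z → z = x ∨ z = y := by
    intro z hz hdz
    have hsub : ({x, y} : Finset V) ⊆ nbrs G A d := by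
      intro w hw
      rcases Finset.mem_insert.1 hw with rfl | hw
      · simp [hx, hdx]
      · rw [Finset.mem_singleton.1 hw]; simp [hy, hdy]
    have := Finset.eq_of_subset_of_card_le hsub (by rw [Finset.card_pair hne]; exact h2)
    have hz' : z ∈ ({x, y} : Finset V) := this ▸ (by simp [hz, hdz])
    simpa using hz'
  intro u hu v hv huv h
  rw [Finset.mem_erase] at hu hv
  have hd_sep : ∀ z ∈ A, G.Adj d z → ¬ Crosses θ u v d z := by
    intro z hz hdz
    have h1 := hext u hu.2 hu.1
    have h2 := hext v hv.2 hv.1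
    have h3 := hθd u
    have h4 := hθd v
    refine not_lt.2 ?_
    rcases hN z hz hdz with rfl | rfl
    · exact mul_nonneg (mul_nonneg (by linarith) (by linarith))
        (mul_nonneg (by linarith) (by linarith))
    · exact mul_nonneg_of_nonpos_of_nonpos
        (mul_nonpos_of_nonneg_of_nonpos (by linarith) (by linarith))
        (mul_nonpos_of_nonneg_of_nonpos (by linarith) (by linarith))
  refine hA u hu.2 v hv.2 huv fun a ha b hb hab => ?_
  by_cases had : a = d
  · subst had
    rw [hθ]; exact hd_sep b hb hab
  by_cases hbd : b = d
  · subst hbd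
    rw [hθ]
    intro hcr
    refine hd_sep a ha hab.symm ?_
    unfold Crosses at *
    linarith
  · exact h a (Finset.mem_erase.2 ⟨had, ha⟩) b (Finset.mem_erase.2 ⟨hbd, hb⟩) hab

open Classical in
/-- A triangulation with at least three vertices has a vertex of degree two other than `r`. -/
theorem exists_card_nbrs_le_two (hG : IsOuterTriangulation G sep) (hA : SaturatedOn G sep A)
    (hc : 3 ≤ A.card) {r : V} (hr : r ∈ A) : ∃ k ∈ A, k ≠ r ∧ (nbrs G A k).card ≤ 2 := by
  obtain ⟨θ, x, y, hθi, hθr, hθ, hx, hy, hxr, hyr, hxy, hext, hrx, hry⟩ :=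
    exists_cyclic_neighbors hG hA hc hr
  have hlt : ∀ z, z ≠ r → θ r < θ z := fun z hz => lt_of_le_of_ne (hθr z) (hθi.ne hz.symm)
  -- Among the edges that span some vertex of `A` take a shortest one, `i j`, and let `k` be a
  -- vertex under it. Non-crossing confines the neighbours of `k` to the range from `i` to `j`. Two
  -- of them on the same side of `k` would give a shorter spanning edge, so there is at most one on
  -- each side.
  let S : Finset (V × V) := (A ×ˢ A).filter fun e =>
    G.Adj e.1 e.2 ∧ ∃ k ∈ A, θ e.1 < θ k ∧ θ k < θ e.2
  have hS : S.Nonempty := ⟨(r, y), by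
    simp only [S, Finset.mem_filter, Finset.mem_product]
    exact ⟨⟨hr, hy⟩, hry, x, hx, hlt x hxr, hxy⟩⟩
  obtain ⟨⟨i, j⟩, hij, hmin⟩ := Finset.exists_min_image S (fun e => θ e.2 - θ e.1) hS
  simp only [S, Finset.mem_filter, Finset.mem_product] at hij hmin
  obtain ⟨⟨hi, hj⟩, hadj, k, hk, hik, hkj⟩ := hij
  refine ⟨k, hk, ?_, ?_⟩
  · rintro rfl; exact absurd hik (not_lt.2 (hθr i))
  have hrange : ∀ l ∈ A, G.Adj k l → θ i ≤ θ l ∧ θ l ≤ θ j := by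
    intro l hl hkl
    by_contra hcon
    refine hG.noncrossing i j k l hadj hkl ((hθ _ _ _ _).2 ?_)
    unfold Crosses
    rcases not_and_or.1 hcon with h | h
    · exact mul_neg_of_neg_of_pos (mul_neg_of_neg_of_pos (by linarith) (by linarith))
        (mul_pos (by linarith) (by linarith))
    · exact mul_neg_of_pos_of_neg (mul_pos_of_neg_of_neg (by linarith) (by linarith))
        (mul_neg_of_pos_of_neg (by linarith) (by linarith))
  have hup : ((nbrs G A k).filter fun l => θ k < θ l).card ≤ 1 := by
    have : ∀ l l', l ∈ A → l' ∈ A → G.Adj k l → G.Adj k l' → θ k < θ l → ¬ θ l < θ l' := by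
      intro l l' hl hl' hkl hkl' h1 h2
      have := hmin (k, l') ⟨⟨hk, hl'⟩, hkl', l, hl, h1, h2⟩
      have := hrange l' hl' hkl'
      simp only at *
      linarith
    refine Finset.card_le_one.2 fun a ha b hb => ?_
    simp only [Finset.mem_filter, mem_nbrs] at ha hb
    refine hθi (le_antisymm (not_lt.1 ?_) (not_lt.1 ?_))
    · exact this b a hb.1.1 ha.1.1 hb.1.2 ha.1.2 hb.2
    · exact this a b ha.1.1 hb.1.1 ha.1.2 hb.1.2 ha.2
  have hdn : ((nbrs G A k).filter fun l => ¬ θ k < θ l).card ≤ 1 := by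
    have : ∀ l l', l ∈ A → l' ∈ A → G.Adj k l → G.Adj k l' → θ l < θ k → ¬ θ l' < θ l := by
      intro l l' hl hl' hkl hkl' h1 h2
      have := hmin (l', k) ⟨⟨hl', hk⟩, hkl'.symm, l, hl, h2, h1⟩
      have := hrange l' hl' hkl'
      simp only at *
      linarith
    refine Finset.card_le_one.2 fun a ha b hb => ?_
    simp only [Finset.mem_filter, mem_nbrs] at ha hb
    have ha' : θ a < θ k := lt_of_le_of_ne (not_lt.1 ha.2) (hθi.ne ha.1.2.ne')
    have hb' : θ b < θ k := lt_of_le_of_ne (not_lt.1 hb.2) (hθi.ne hb.1.2.ne')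
    refine hθi (le_antisymm (not_lt.1 ?_) (not_lt.1 ?_))
    · exact this a b ha.1.1 hb.1.1 ha.1.2 hb.1.2 ha'
    · exact this b a hb.1.1 ha.1.1 hb.1.2 ha.1.2 hb'
  rw [← Finset.card_filter_add_card_filter_not (fun l => θ k < θ l)]
  omega

open Classical in
theorem nbrs_erase (d v : V) : nbrs G (A.erase d) v = (nbrs G A v).erase d := by
  ext u; simp [and_assoc]

open Classical in
theorem card_nbrs_erase {d v : V} (hd : d ∈ A) :
    (nbrs G (A.erase d) v).card = (nbrs G A v).card - if G.Adj v d then 1 else 0 := by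
  rw [nbrs_erase]
  split_ifs with h
  · rw [Finset.card_erase_of_mem (by simp [hd, h])]
  · rw [Finset.erase_eq_of_notMem (by simp [h]), Nat.sub_zero]

open Classical in
-- Deleting a vertex with at most two neighbours lowers the degree sum by at most four. The bound is
-- crude, but it makes the number of edges linear in the number of vertices.
theorem sum_card_nbrs_le (hG : IsOuterTriangulation G sep) (A : Finset V)
    (hA : SaturatedOn G sep A) : ∑ v ∈ A, (nbrs G A v).card ≤ 4 * A.card := by
  induction hn : A.card generalizing A with
  | zero => simp [Finset.card_eq_zero.1 hn]
  | succ m ih =>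
    by_cases hc : 3 ≤ A.card
    · obtain ⟨r, hr⟩ : A.Nonempty := Finset.card_pos.1 (by omega)
      obtain ⟨k, hk, -, hk2⟩ := exists_card_nbrs_le_two hG hA hc hr
      have := ih (A.erase k) (hA.erase hG hc hk hk2) (by rw [Finset.card_erase_of_mem hk]; omega)
      have h1 : ∑ v ∈ A.erase k, (nbrs G A v).card ≤
          ∑ v ∈ A.erase k, ((nbrs G (A.erase k) v).card + if G.Adj k v then 1 else 0) := by
        refine Finset.sum_le_sum fun v _ => ?_
        rw [card_nbrs_erase hk, G.adj_comm k v]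
        omega
      have h2 : (∑ v ∈ A.erase k, if G.Adj k v then 1 else 0) ≤ (nbrs G A k).card := by
        rw [← Finset.card_filter, nbrs]
        exact Finset.card_le_card (Finset.filter_subset_filter _ (Finset.erase_subset _ _))
      rw [Finset.sum_add_distrib] at h1
      rw [← Finset.add_sum_erase _ _ hk]
      omega
    · calc ∑ v ∈ A, (nbrs G A v).card ≤ ∑ v ∈ A, A.card :=
            Finset.sum_le_sum fun v _ => Finset.card_le_card (Finset.filter_subset _ _)
        _ ≤ 4 * (m + 1) := by simp; rw [hn]; nlinarith

/-- A linear order compatible with the cyclic one that starts in `s` and ends in its cyclic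
neighbour `r`. -/
theorem exists_order_between [Fintype V] (hG : IsOuterTriangulation G sep)
    (hc : 3 ≤ Fintype.card V) {r s : V} (hrs : G.Adj r s)
    (h2 : (nbrs G Finset.univ r).card ≤ 2) :
    ∃ θ : V → ℝ, Function.Injective θ ∧ (∀ v, θ s ≤ θ v ∧ θ v ≤ θ r) ∧
      ∀ u v a b, sep u v a b ↔ Crosses θ u v a b := by
  classical
  obtain ⟨θ, x, y, hθi, hθr, hθ, -, -, hxr, hyr, hxy, hext, hrx, hry⟩ :=
    exists_cyclic_neighbors hG hG.saturatedOn_univ (by simpa using hc) (Finset.mem_univ r)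
  have hne : x ≠ y := by rintro rfl; exact lt_irrefl _ hxy
  have hs : s = x ∨ s = y := by
    have hsub : ({x, y} : Finset V) ⊆ nbrs G Finset.univ r := by
      intro w hw
      rcases Finset.mem_insert.1 hw with rfl | hw
      · simp [hrx]
      · rw [Finset.mem_singleton.1 hw]; simp [hry]
    have := Finset.eq_of_subset_of_card_le hsub (by rw [Finset.card_pair hne]; exact h2)
    have hz' : s ∈ ({x, y} : Finset V) := this ▸ (by simp [hrs])
    simpa using hz'
  have hext' : ∀ z, z ≠ r → θ x ≤ θ z ∧ θ z ≤ θ y := fun z => hext z (Finset.mem_univ z)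
  rcases hs with rfl | rfl
  -- If `s` directly follows `r`, the first element `r` is moved to the end of the order; in the
  -- other case below, the order is reversed.
  · let θ' := Function.update θ r (θ y + 1)
    have hr' : θ' r = θ y + 1 := by simp [θ']
    have ho : ∀ z, z ≠ r → θ' z = θ z := fun z hz => by simp [θ', hz]
    have hsub : ∀ z, z ≠ r → θ z < θ y + 1 := fun z hz => by linarith [(hext' z hz).2]
    refine ⟨θ', ?_, ?_, ?_⟩
    · intro u v huv
      by_cases hu : u = r <;> by_cases hv : v = r
      · rw [hu, hv]
      · subst hu; rw [hr', ho v hv] at huv; linarith [hsub v hv]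
      · subst hv; rw [hr', ho u hu] at huv; linarith [hsub u hu]
      · rw [ho u hu, ho v hv] at huv; exact hθi huv
    · intro v
      rw [hr', ho s hxr]
      by_cases hv : v = r
      · subst hv; rw [hr']; constructor <;> linarith
      · rw [ho v hv]; constructor <;> linarith [(hext' v hv).1, (hext' v hv).2]
    -- Moving `r` flips the sign of exactly the differences involving `r`. Each of `u`, `v`, `a`,
    -- `b` occurs in two factors of the crossing product, so all these signs cancel.
    · let ε : V → ℝ := fun z => if z = r then -1 else 1
      have hε : ∀ z, ε z * ε z = 1 := fun z => by simp only [ε]; split_ifs <;> norm_num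
      have key : ∀ z w, ∃ k > 0, θ z - θ w = k * (ε z * ε w) * (θ' z - θ' w) := by
        intro z w
        by_cases hz : z = r <;> by_cases hw : w = r
        · exact ⟨1, one_pos, by simp [hz, hw]⟩
        · subst hz
          have h1 : 0 < θ' z - θ' w := by rw [hr', ho w hw]; linarith [hsub w hw]
          have h2 : θ z < θ w := lt_of_le_of_ne (hθr w) fun h => hw (hθi h).symm
          refine ⟨(θ w - θ z) / (θ' z - θ' w), div_pos (by linarith) h1, ?_⟩
          simp only [ε, hw, if_true, if_false]
          field_simp
          ring
        · subst hw
          have h1 : 0 < θ' w - θ' z := by rw [hr', ho z hz]; linarith [hsub z hz]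
          have h2 : θ w < θ z := lt_of_le_of_ne (hθr z) fun h => hz (hθi h).symm
          refine ⟨(θ z - θ w) / (θ' w - θ' z), div_pos (by linarith) h1, ?_⟩
          simp only [ε, hz, if_true, if_false]
          field_simp
          ring
        · exact ⟨1, one_pos, by simp [ε, hz, hw, ho]⟩
      intro u v a b
      rw [hθ]
      obtain ⟨k1, h1, e1⟩ := key u a
      obtain ⟨k2, h2, e2⟩ := key u b
      obtain ⟨k3, h3, e3⟩ := key v a
      obtain ⟨k4, h4, e4⟩ := key v b
      unfold Crosses
      rw [e1, e2, e3, e4]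
      have : k1 * (ε u * ε a) * (θ' u - θ' a) * (k2 * (ε u * ε b) * (θ' u - θ' b)) *
          (k3 * (ε v * ε a) * (θ' v - θ' a) * (k4 * (ε v * ε b) * (θ' v - θ' b))) =
          (k1 * k2 * k3 * k4 * ((ε u * ε u) * (ε a * ε a) * (ε v * ε v) * (ε b * ε b))) *
          ((θ' u - θ' a) * (θ' u - θ' b) * ((θ' v - θ' a) * (θ' v - θ' b))) := by ring
      rw [this, hε, hε, hε, hε]
      have hp : 0 < k1 * k2 * k3 * k4 * (1 * 1 * 1 * 1) := by positivity
      exact ⟨fun h => by_contra fun h' => absurd h (not_lt.2 (mul_nonneg hp.le (not_lt.1 h'))),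
        mul_neg_of_pos_of_neg hp⟩
  · refine ⟨fun v => - θ v, neg_injective.comp hθi, ?_, ?_⟩
    · intro v
      constructor
      · by_cases hv : v = r
        · subst hv; linarith [hθr s]
        · linarith [(hext' v hv).2]
      · linarith [hθr v]
    · intro u v a b
      rw [hθ]
      unfold Crosses
      ring_nf

/-- `v` is the successor of `u` in `A` with respect to the order given by `θ`. -/
def IsNext (θ : V → ℝ) (A : Finset V) (u v : V) : Prop :=
  u ∈ A ∧ v ∈ A ∧ θ u < θ v ∧ ∀ z ∈ A, θ z ≤ θ u ∨ θ v ≤ θ z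

open Classical in
/-- A vertex with at most two neighbours in `A` that is not extreme in the order lies between
its neighbours, and these are consecutive. -/
theorem exists_isNext [Fintype V] {θ : V → ℝ} (hθi : Function.Injective θ)
    (hθ : ∀ u v a b, sep u v a b ↔ Crosses θ u v a b) {A : Finset V} {d r s : V}
    (hd : d ∉ A) (hr : r ∈ A) (hs : s ∈ A) (hext : ∀ v, θ s ≤ θ v ∧ θ v ≤ θ r)
    (hA : SaturatedOn G sep (insert d A)) {p q : V}
    (hpq : ∀ u ∈ A, G.Adj d u → u = p ∨ u = q) :
    ∃ x y, IsNext θ A x y ∧ θ x < θ d ∧ θ d < θ y ∧ (∀ u ∈ A, G.Adj d u ↔ u = x ∨ u = y) ∧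
      ((x = p ∧ y = q) ∨ (x = q ∧ y = p)) := by
  have hds : d ≠ s := by rintro rfl; exact hd hs
  have hdr : d ≠ r := by rintro rfl; exact hd hr
  -- The vertices of `A` nearest to `d` from below and from above. No vertex lies between them and
  -- `d`, so by saturation both are neighbours of `d`, and hence they are `p` and `q` in some order.
  obtain ⟨x, hx, hxmax⟩ := Finset.exists_max_image (A.filter fun z => θ z < θ d) θ
    ⟨s, by simpa [hs] using lt_of_le_of_ne (hext d).1 (hθi.ne hds.symm)⟩
  obtain ⟨y, hy, hymin⟩ := Finset.exists_min_image (A.filter fun z => θ d < θ z) θ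
    ⟨r, by simpa [hr] using lt_of_le_of_ne (hext d).2 (hθi.ne hdr)⟩
  simp only [Finset.mem_filter] at hx hxmax hy hymin
  have hdich : ∀ z ∈ A, θ z ≤ θ x ∨ θ y ≤ θ z := by
    intro z hz
    rcases lt_trichotomy (θ z) (θ d) with h | h | h
    · exact Or.inl (hxmax z ⟨hz, h⟩)
    · exact absurd (hθi h ▸ hz) hd
    · exact Or.inr (hymin z ⟨hz, h⟩)
  have hdich' : ∀ z ∈ insert d A, θ z ≤ θ x ∨ θ z = θ d ∨ θ y ≤ θ z := by
    intro z hz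
    rcases Finset.mem_insert.1 hz with rfl | hz
    · exact Or.inr (Or.inl rfl)
    · rcases hdich z hz with h | h
      · exact Or.inl h
      · exact Or.inr (Or.inr h)
  have hadj : ∀ z ∈ A, z = x ∨ z = y → G.Adj d z := by
    intro z hz hzxy
    refine hA d (Finset.mem_insert_self _ _) z (Finset.mem_insert_of_mem hz)
      (by rintro rfl; exact hd hz) fun a ha b hb _ => ?_
    rw [hθ]
    have hab : ∀ a ∈ insert d A, 0 ≤ (θ d - θ a) * (θ z - θ a) := by
      intro a ha
      rcases hzxy with rfl | rfl
      · rcases hdich' a ha with h | h | h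
        · exact mul_nonneg (by linarith) (by linarith)
        · simp [h]
        · exact mul_nonneg_of_nonpos_of_nonpos (by linarith) (by linarith)
      · rcases hdich' a ha with h | h | h
        · exact mul_nonneg (by linarith) (by linarith)
        · simp [h]
        · exact mul_nonneg_of_nonpos_of_nonpos (by linarith) (by linarith)
    refine not_lt.2 ?_
    calc 0 ≤ ((θ d - θ a) * (θ z - θ a)) * ((θ d - θ b) * (θ z - θ b)) :=
          mul_nonneg (hab a ha) (hab b hb)
      _ = _ := by ring
  have hne : x ≠ y := by rintro rfl; linarith [hx.2, hy.2]
  have hxy : (x = p ∧ y = q) ∨ (x = q ∧ y = p) := by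
    rcases hpq x hx.1 (hadj x hx.1 (Or.inl rfl)) with h1 | h1 <;>
      rcases hpq y hy.1 (hadj y hy.1 (Or.inr rfl)) with h2 | h2
    · exact absurd (h1.trans h2.symm) hne
    · exact Or.inl ⟨h1, h2⟩
    · exact Or.inr ⟨h1, h2⟩
    · exact absurd (h1.trans h2.symm) hne
  refine ⟨x, y, ⟨hx.1, hy.1, hx.2.trans hy.2, hdich⟩, hx.2, hy.2, fun u hu => ⟨fun h => ?_,
    hadj u hu⟩, hxy⟩
  rcases hxy with ⟨rfl, rfl⟩ | ⟨rfl, rfl⟩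
  · exact hpq u hu h
  · exact (hpq u hu h).symm

end Elimination

/-! ## Regions of rectangles and of L-shaped hexagons -/

theorem mem_affineSegment_horizontal {x y c : ℝ} (h : x ≤ y) (p : ℝ × ℝ) :
    p ∈ affineSegment ℝ (x, c) (y, c) ↔ p.2 = c ∧ x ≤ p.1 ∧ p.1 ≤ y := by
  rw [affineSegment_eq_segment, ← Prod.image_mk_segment_left, segment_eq_Icc h]
  constructor
  · rintro ⟨z, hz, rfl⟩; exact ⟨rfl, hz⟩
  · rintro ⟨rfl, hz⟩; exact ⟨p.1, hz, rfl⟩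

theorem mem_affineSegment_vertical {x y c : ℝ} (h : x ≤ y) (p : ℝ × ℝ) :
    p ∈ affineSegment ℝ (c, x) (c, y) ↔ p.1 = c ∧ x ≤ p.2 ∧ p.2 ≤ y := by
  rw [affineSegment_eq_segment, ← Prod.image_mk_segment_right, segment_eq_Icc h]
  constructor
  · rintro ⟨z, hz, rfl⟩; exact ⟨rfl, hz⟩
  · rintro ⟨rfl, hz⟩; exact ⟨p.2, hz, rfl⟩

/-- If the boundary of a polygon is `K \ I` with `I` open, and every point outside `K` is the
start of a ray that avoids `K`, then `K` is the closed region of the polygon. -/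
theorem polygonRegion_eq_of_boundary_eq {k : ℕ} {P : Polygon (ℝ × ℝ) k} {K I : Set (ℝ × ℝ)}
    (hP : P.boundary ℝ = K \ I) (hIK : I ⊆ K) (hI : IsOpen I) (hK : IsClosed K)
    (hb : Bornology.IsBounded K)
    (hray : ∀ x ∉ K, ∃ v : ℝ × ℝ, v ≠ 0 ∧ ∀ t : ℝ, 0 ≤ t → x + t • v ∉ K) :
    polygonRegion P = K := by
  have hcompl : (P.boundary ℝ)ᶜ = I ∪ Kᶜ := by
    rw [hP]; ext x; simp only [Set.mem_compl_iff, Set.mem_sdiff, Set.mem_union]; tauto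
  ext x
  unfold polygonRegion
  rw [hcompl, hP]
  simp only [Set.mem_union, Set.mem_sdiff, Set.mem_ofPred_eq]
  constructor
  · rintro (h | ⟨hx, hbd⟩)
    · exact h.1
    · by_contra hxK
      obtain ⟨v, hv, hr⟩ := hray x hxK
      -- The whole ray lies in the component of `x`, which is therefore unbounded.
      have hconn : IsPreconnected ((fun t : ℝ => x + t • v) '' Set.Ici 0) :=
        isPreconnected_Ici.image _ (by fun_prop)
      have hsub := hconn.subset_connectedComponentIn (x := x) (F := I ∪ Kᶜ) ⟨0, by simp, by simp⟩
        (by rintro _ ⟨t, ht, rfl⟩; exact Or.inr (hr t ht))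
      obtain ⟨C, hC⟩ := (hbd.subset hsub).exists_norm_le
      have hv' : 0 < ‖v‖ := norm_pos_iff.2 hv
      have hx0 : 0 ≤ C := (norm_nonneg x).trans (hC x ⟨0, by simp, by simp⟩)
      have hnn : 0 ≤ (C + ‖x‖ + 1) / ‖v‖ := by positivity
      have h1 := hC _ ⟨(C + ‖x‖ + 1) / ‖v‖, hnn, rfl⟩
      have h2 : ‖((C + ‖x‖ + 1) / ‖v‖) • v‖ = C + ‖x‖ + 1 := by
        rw [norm_smul, Real.norm_of_nonneg hnn, div_mul_cancel₀ _ hv'.ne']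
      have h3 : ‖((C + ‖x‖ + 1) / ‖v‖) • v‖ ≤ ‖x + ((C + ‖x‖ + 1) / ‖v‖) • v‖ + ‖x‖ := by
        calc _ = ‖(x + ((C + ‖x‖ + 1) / ‖v‖) • v) - x‖ := by congr 1; abel
          _ ≤ _ := norm_sub_le _ _
      simp only at h1
      linarith
  · intro hx
    by_cases hxI : x ∈ I
    · refine Or.inr ⟨fun h => h.2 hxI, ?_⟩
      refine (hb.subset hIK).subset ?_
      -- The open sets `I` and `Kᶜ` are disjoint and cover the complement of the boundary, so the
      -- component of a point of `I` stays inside `I` and is bounded.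
      refine IsPreconnected.subset_left_of_subset_union hI hK.isOpen_compl ?_
        (connectedComponentIn_subset _ _) ?_ isPreconnected_connectedComponentIn
      · exact Set.disjoint_left.2 fun y hy hy' => hy' (hIK hy)
      · exact ⟨x, mem_connectedComponentIn (Or.inl hxI), hxI⟩
    · exact Or.inl ⟨hx, hxI⟩

/-- `P` is a simple rectilinear polygon with at most six sides and with closed region `K`. -/
structure IsPolygonOf {k : ℕ} (P : Polygon (ℝ × ℝ) k) (K : Set (ℝ × ℝ)) : Prop where
  sides : k ≤ 6
  simple : IsSimplePolygon P
  rectilinear : IsRectilinearPolygon P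
  region : polygonRegion P = K
  frontier_subset : frontier K ⊆ P.boundary ℝ

/-- The L-shape `[l, 1] × [b, t]` without its lower right corner `(m, 1] × [b, h)`. -/
def lShape (l m b h t : ℝ) : Set (ℝ × ℝ) :=
  {p | l ≤ p.1 ∧ p.1 ≤ 1 ∧ b ≤ p.2 ∧ p.2 ≤ t ∧ (p.1 ≤ m ∨ h ≤ p.2)}

/-- The interior of `lShape l m b h t`. -/
def openLShape (l m b h t : ℝ) : Set (ℝ × ℝ) :=
  {p | l < p.1 ∧ p.1 < 1 ∧ b < p.2 ∧ p.2 < t ∧ (p.1 < m ∨ h < p.2)}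

section LShape

variable {l m b h t : ℝ}

theorem isClosed_lShape : IsClosed (lShape l m b h t) := by
  have e : lShape l m b h t = ({p | l ≤ p.1} ∩ {p | p.1 ≤ 1} ∩ {p | b ≤ p.2} ∩ {p | p.2 ≤ t}) ∩
      ({p | p.1 ≤ m} ∪ {p | h ≤ p.2}) := by
    ext p; simp [lShape, and_assoc]
  rw [e]
  refine IsClosed.inter (IsClosed.inter (IsClosed.inter (IsClosed.inter ?_ ?_) ?_) ?_)
    (IsClosed.union ?_ ?_) <;> exact isClosed_le (by fun_prop) (by fun_prop)

theorem isOpen_openLShape : IsOpen (openLShape l m b h t) := by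
  have e : openLShape l m b h t =
      ({p | l < p.1} ∩ {p | p.1 < 1} ∩ {p | b < p.2} ∩ {p | p.2 < t}) ∩
      ({p | p.1 < m} ∪ {p | h < p.2}) := by
    ext p; simp [openLShape, and_assoc]
  rw [e]
  refine IsOpen.inter (IsOpen.inter (IsOpen.inter (IsOpen.inter ?_ ?_) ?_) ?_)
    (IsOpen.union ?_ ?_) <;> exact isOpen_lt (by fun_prop) (by fun_prop)

theorem openLShape_subset : openLShape l m b h t ⊆ lShape l m b h t := by
  rintro p ⟨h1, h2, h3, h4, h5⟩
  exact ⟨h1.le, h2.le, h3.le, h4.le, h5.imp le_of_lt le_of_lt⟩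

theorem lShape_subset_Icc : lShape l m b h t ⊆ Set.Icc (l, b) (1, t) :=
  fun _ hp => ⟨⟨hp.1, hp.2.2.1⟩, ⟨hp.2.1, hp.2.2.2.1⟩⟩

theorem exists_ray_avoiding_lShape (x : ℝ × ℝ) (hx : x ∉ lShape l m b h t) :
    ∃ v : ℝ × ℝ, v ≠ 0 ∧ ∀ s : ℝ, 0 ≤ s → x + s • v ∉ lShape l m b h t := by
  by_cases h1 : l ≤ x.1
  · by_cases h2 : b ≤ x.2
    · by_cases h3 : x.2 ≤ t
      · refine ⟨(1, 0), by simp, fun s hs hmem => hx ⟨h1, ?_, h2, h3, ?_⟩⟩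
        · have := hmem.2.1; simp at this; linarith
        · have := hmem.2.2.2.2; simp at this
          exact this.imp (fun h => by linarith) id
      · refine ⟨(0, 1), by simp, fun s hs hmem => ?_⟩
        have := hmem.2.2.2.1; simp at this; linarith
    · refine ⟨(0, -1), by simp, fun s hs hmem => ?_⟩
      have := hmem.2.2.1; simp at this; linarith
  · refine ⟨(-1, 0), by simp, fun s hs hmem => ?_⟩
    have := hmem.1; simp at this; linarith

theorem volume_lShape (hl : l ≤ m) (hm : m ≤ 1) (hb : b ≤ h) (ht : h ≤ t) :
    MeasureTheory.volume (lShape l m b h t) =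
      ENNReal.ofReal ((m - l) * (t - b) + (1 - m) * (t - h)) := by
  have e : lShape l m b h t = Set.Icc l m ×ˢ Set.Icc b t ∪ Set.Ioc m 1 ×ˢ Set.Icc h t := by
    ext p
    simp only [lShape, Set.mem_ofPred_eq, Set.mem_union, Set.mem_prod, Set.mem_Icc, Set.mem_Ioc]
    constructor
    · rintro ⟨h1, h2, h3, h4, h5⟩
      by_cases h6 : p.1 ≤ m
      · exact Or.inl ⟨⟨h1, h6⟩, h3, h4⟩
      · exact Or.inr ⟨⟨not_le.1 h6, h2⟩, h5.resolve_left h6, h4⟩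
    · rintro (⟨⟨h1, h2⟩, h3, h4⟩ | ⟨⟨h1, h2⟩, h3, h4⟩)
      · exact ⟨h1, h2.trans hm, h3, h4, Or.inl h2⟩
      · exact ⟨hl.trans h1.le, h2, hb.trans h3, h4, Or.inr h3⟩
  have hd : Disjoint (Set.Icc l m ×ˢ Set.Icc b t) (Set.Ioc m 1 ×ˢ Set.Icc h t) :=
    Set.disjoint_left.2 fun p h1 h2 => absurd h1.1.2 (not_le.2 h2.1.1)
  rw [e, MeasureTheory.measure_union hd (measurableSet_Ioc.prod measurableSet_Icc),
    MeasureTheory.Measure.volume_eq_prod, MeasureTheory.Measure.prod_prod,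
    MeasureTheory.Measure.prod_prod, Real.volume_Icc, Real.volume_Icc, Real.volume_Ioc,
    Real.volume_Icc, ← ENNReal.ofReal_mul (by linarith), ← ENNReal.ofReal_mul (by linarith),
    ← ENNReal.ofReal_add (mul_nonneg (by linarith) (by linarith))
      (mul_nonneg (by linarith) (by linarith))]

theorem isPolygonOf_lShape_of_boundary {k : ℕ} {P : Polygon (ℝ × ℝ) k} (hk : k ≤ 6)
    (hs : IsSimplePolygon P) (hr : IsRectilinearPolygon P)
    (hP : P.boundary ℝ = lShape l m b h t \ openLShape l m b h t) :
    IsPolygonOf P (lShape l m b h t) where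
  sides := hk
  simple := hs
  rectilinear := hr
  region := polygonRegion_eq_of_boundary_eq hP openLShape_subset isOpen_openLShape isClosed_lShape
    (Metric.isBounded_Icc _ _ |>.subset lShape_subset_Icc) exists_ray_avoiding_lShape
  frontier_subset := by
    rw [isClosed_lShape.frontier_eq, hP]
    exact Set.sdiff_subset_sdiff_right
      (interior_maximal openLShape_subset isOpen_openLShape)

theorem isPolygonOf_hexagon (hl : l < m) (hm : m < 1) (hb : b < h) (ht : h < t)
    (P : Polygon (ℝ × ℝ) 6) (h0 : P 0 = (l, b)) (h1 : P 1 = (m, b)) (h2 : P 2 = (m, h))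
    (h3 : P 3 = (1, h)) (h4 : P 4 = (1, t)) (h5 : P 5 = (l, t)) :
    IsPolygonOf P (lShape l m b h t) := by
  have r0 : finRotate 6 0 = 1 := rfl
  have r1 : finRotate 6 1 = 2 := rfl
  have r2 : finRotate 6 2 = 3 := rfl
  have r3 : finRotate 6 3 = 4 := rfl
  have r4 : finRotate 6 4 = 5 := rfl
  have r5 : finRotate 6 5 = 0 := rfl
  have e0 : ∀ p, p ∈ P.edgeSet ℝ 0 ↔ p.2 = b ∧ l ≤ p.1 ∧ p.1 ≤ m := fun p => by
    rw [Polygon.edgeSet, r0, h0, h1, mem_affineSegment_horizontal hl.le]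
  have e1 : ∀ p, p ∈ P.edgeSet ℝ 1 ↔ p.1 = m ∧ b ≤ p.2 ∧ p.2 ≤ h := fun p => by
    rw [Polygon.edgeSet, r1, h1, h2, mem_affineSegment_vertical hb.le]
  have e2 : ∀ p, p ∈ P.edgeSet ℝ 2 ↔ p.2 = h ∧ m ≤ p.1 ∧ p.1 ≤ 1 := fun p => by
    rw [Polygon.edgeSet, r2, h2, h3, mem_affineSegment_horizontal hm.le]
  have e3 : ∀ p, p ∈ P.edgeSet ℝ 3 ↔ p.1 = 1 ∧ h ≤ p.2 ∧ p.2 ≤ t := fun p => by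
    rw [Polygon.edgeSet, r3, h3, h4, mem_affineSegment_vertical ht.le]
  have e4 : ∀ p, p ∈ P.edgeSet ℝ 4 ↔ p.2 = t ∧ l ≤ p.1 ∧ p.1 ≤ 1 := fun p => by
    rw [Polygon.edgeSet, r4, h4, h5, affineSegment_comm, mem_affineSegment_horizontal (by linarith)]
  have e5 : ∀ p, p ∈ P.edgeSet ℝ 5 ↔ p.1 = l ∧ b ≤ p.2 ∧ p.2 ≤ t := fun p => by
    rw [Polygon.edgeSet, r5, h5, h0, affineSegment_comm, mem_affineSegment_vertical (by linarith)]
  refine isPolygonOf_lShape_of_boundary le_rfl ⟨by norm_num, ?_, ?_⟩ ?_ ?_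
  · intro i
    fin_cases i <;>
      simp [r0, r1, r2, r3, r4, r5, h0, h1, h2, h3, h4, h5, Prod.ext_iff, hl.ne, hm.ne, hb.ne,
        ht.ne, (hb.trans ht).ne', (hl.trans hm).ne']
  · intro i j hij
    wlog hlt : i < j generalizing i j
    · exact (this j i hij.symm (lt_of_le_of_ne (not_lt.1 hlt) hij.symm)).symm
    rw [Set.disjoint_left]
    rintro ⟨x, y⟩ hi hj
    fin_cases i <;> fin_cases j <;>
      first
      | exact absurd hlt (by decide)
      | (simp [r0, r1, r2, r3, r4, r5, h0, h1, h2, h3, h4, h5, e0, e1, e2, e3, e4, e5] at hi hj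
         grind)
  · intro i
    fin_cases i <;> simp [r0, r1, r2, r3, r4, r5, h0, h1, h2, h3, h4, h5]
  · ext ⟨x, y⟩
    have hB : (x, y) ∈ P.boundary ℝ ↔ (x, y) ∈ P.edgeSet ℝ 0 ∨ (x, y) ∈ P.edgeSet ℝ 1 ∨
        (x, y) ∈ P.edgeSet ℝ 2 ∨ (x, y) ∈ P.edgeSet ℝ 3 ∨ (x, y) ∈ P.edgeSet ℝ 4 ∨
        (x, y) ∈ P.edgeSet ℝ 5 := by
      simp [Polygon.boundary, Fin.exists_fin_succ]
    rw [hB, e0, e1, e2, e3, e4, e5]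
    simp only [lShape, openLShape, Set.mem_sdiff, Set.mem_ofPred_eq]
    clear * - hl hm hb ht
    constructor
    · rintro (⟨rfl, h1, h2⟩ | ⟨rfl, h1, h2⟩ | ⟨rfl, h1, h2⟩ | ⟨rfl, h1, h2⟩ | ⟨rfl, h1, h2⟩ |
        ⟨rfl, h1, h2⟩) <;> grind
    · rintro ⟨⟨h1, h2, h3, h4, h5⟩, h6⟩
      grind (splits := 20)

/-- For `m = 1` the condition that cuts out the corner is vacuous, so `h` is arbitrary. The case is
separate because the hexagon would have sides of length zero. -/
theorem isPolygonOf_rectangle (hl : l < 1) (ht : b < t)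
    (P : Polygon (ℝ × ℝ) 4) (h0 : P 0 = (l, b)) (h1 : P 1 = (1, b)) (h2 : P 2 = (1, t))
    (h3 : P 3 = (l, t)) : IsPolygonOf P (lShape l 1 b h t) := by
  have r0 : finRotate 4 0 = 1 := rfl
  have r1 : finRotate 4 1 = 2 := rfl
  have r2 : finRotate 4 2 = 3 := rfl
  have r3 : finRotate 4 3 = 0 := rfl
  have e0 : ∀ p, p ∈ P.edgeSet ℝ 0 ↔ p.2 = b ∧ l ≤ p.1 ∧ p.1 ≤ 1 := fun p => by
    rw [Polygon.edgeSet, r0, h0, h1, mem_affineSegment_horizontal hl.le]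
  have e1 : ∀ p, p ∈ P.edgeSet ℝ 1 ↔ p.1 = 1 ∧ b ≤ p.2 ∧ p.2 ≤ t := fun p => by
    rw [Polygon.edgeSet, r1, h1, h2, mem_affineSegment_vertical ht.le]
  have e2 : ∀ p, p ∈ P.edgeSet ℝ 2 ↔ p.2 = t ∧ l ≤ p.1 ∧ p.1 ≤ 1 := fun p => by
    rw [Polygon.edgeSet, r2, h2, h3, affineSegment_comm, mem_affineSegment_horizontal hl.le]
  have e3 : ∀ p, p ∈ P.edgeSet ℝ 3 ↔ p.1 = l ∧ b ≤ p.2 ∧ p.2 ≤ t := fun p => by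
    rw [Polygon.edgeSet, r3, h3, h0, affineSegment_comm, mem_affineSegment_vertical ht.le]
  refine isPolygonOf_lShape_of_boundary (by norm_num) ⟨by norm_num, ?_, ?_⟩ ?_ ?_
  · intro i
    fin_cases i <;>
      simp [r0, r1, r2, r3, h0, h1, h2, h3, Prod.ext_iff, hl.ne, hl.ne', ht.ne, ht.ne']
  · intro i j hij
    wlog hlt : i < j generalizing i j
    · exact (this j i hij.symm (lt_of_le_of_ne (not_lt.1 hlt) hij.symm)).symm
    rw [Set.disjoint_left]
    rintro ⟨x, y⟩ hi hj
    fin_cases i <;> fin_cases j <;>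
      first
      | exact absurd hlt (by decide)
      | (simp [r0, r1, r2, r3, h0, h1, h2, h3, e0, e1, e2, e3] at hi hj
         grind)
  · intro i
    fin_cases i <;> simp [r0, r1, r2, r3, h0, h1, h2, h3]
  · ext ⟨x, y⟩
    have hB : (x, y) ∈ P.boundary ℝ ↔ (x, y) ∈ P.edgeSet ℝ 0 ∨ (x, y) ∈ P.edgeSet ℝ 1 ∨
        (x, y) ∈ P.edgeSet ℝ 2 ∨ (x, y) ∈ P.edgeSet ℝ 3 := by
      simp [Polygon.boundary, Fin.exists_fin_succ]
    rw [hB, e0, e1, e2, e3]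
    simp only [lShape, openLShape, Set.mem_sdiff, Set.mem_ofPred_eq]
    grind

end LShape

/-! ## Layouts -/

/-- The rectangle of area `S` with right side on the line `x = 1` and lower left corner `(l, b)`;
it is empty if there is nothing to place in it. -/
def region (l b S : ℝ) : Set (ℝ × ℝ) :=
  {p | 0 < S ∧ l ≤ p.1 ∧ p.1 ≤ 1 ∧ b ≤ p.2 ∧ p.2 ≤ b + S / (1 - l)}

/-- The height of the top side of an L-shape of area `w` with lower left corner `(l, b)` whose
notch has area `S`. -/
noncomputable def cellTop (l b w S : ℝ) : ℝ := b + (w + S) / (1 - l)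

/-- The height of the notch of this L-shape. -/
noncomputable def notchTop (l b w S : ℝ) : ℝ := b + (S + w / 2) / (1 - l)

/-- The left end of the notch of this L-shape. -/
noncomputable def notchLeft (l w S : ℝ) : ℝ := 1 - (1 - l) * S / (S + w / 2)

/-- The L-shape of area `w` with lower left corner `(l, b)` whose notch has area `S`. -/
noncomputable def cell (l b w S : ℝ) : Set (ℝ × ℝ) :=
  lShape l (notchLeft l w S) b (notchTop l b w S) (cellTop l b w S)

section Cell

variable {l b w S W : ℝ}

theorem lt_notchLeft (hl : l < 1) (hw : 0 < w) (hS : 0 ≤ S) : l < notchLeft l w S := by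
  have h1 : S / (S + w / 2) < 1 := (div_lt_one (by positivity)).2 (by linarith)
  unfold notchLeft
  rw [mul_div_assoc]
  nlinarith

theorem notchLeft_le (hl : l < 1) (hw : 0 < w) (hS : 0 ≤ S) : notchLeft l w S ≤ 1 := by
  have h1 : 0 ≤ (1 - l) * S / (S + w / 2) :=
    div_nonneg (mul_nonneg (by linarith) hS) (by positivity)
  unfold notchLeft
  linarith

theorem notchLeft_lt (hl : l < 1) (hw : 0 < w) (hS : 0 < S) : notchLeft l w S < 1 := by
  have h1 : 0 < (1 - l) * S / (S + w / 2) :=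
    div_pos (mul_pos (by linarith) hS) (by positivity)
  unfold notchLeft
  linarith

@[simp] theorem notchLeft_zero : notchLeft l w 0 = 1 := by simp [notchLeft]

theorem lt_notchTop (hl : l < 1) (hw : 0 < w) (hS : 0 ≤ S) : b < notchTop l b w S := by
  have h1 : 0 < (S + w / 2) / (1 - l) := div_pos (by positivity) (by linarith)
  unfold notchTop
  linarith

theorem notchTop_lt (hl : l < 1) (hw : 0 < w) : notchTop l b w S < cellTop l b w S := by
  unfold notchTop cellTop
  have := div_lt_div_of_pos_right (show S + w / 2 < w + S by linarith) (sub_pos.2 hl)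
  linarith

/-- The notch has width `(1 - l) S / (S + w / 2)` and height `(S + w / 2) / (1 - l)`, with product
`S`. Thus the notch, viewed as a region of area `S`, ends at the height of the horizontal side of
the L-shape. -/
theorem notch_area (hl : l < 1) (hw : 0 < w) (hS : 0 < S) :
    b + S / (1 - notchLeft l w S) = notchTop l b w S := by
  have : 1 - l ≠ 0 := by linarith
  have : S + w / 2 ≠ 0 := by positivity
  unfold notchLeft notchTop
  rw [sub_sub_cancel]
  field_simp

/-- The weight is shared equally: area `w / 2` lies in the strip of full width above the level of
the notch, and `w / 2` in the column to the left of it. Both parts therefore have positive thickness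
for every `S`. -/
theorem cell_area (hl : l < 1) (hw : 0 < w) (hS : 0 ≤ S) :
    (notchLeft l w S - l) * (cellTop l b w S - b) +
      (1 - notchLeft l w S) * (cellTop l b w S - notchTop l b w S) = w := by
  have : 1 - l ≠ 0 := by linarith
  have : S + w / 2 ≠ 0 := by positivity
  unfold notchLeft notchTop cellTop
  field_simp
  ring

theorem volume_cell (hl : l < 1) (hw : 0 < w) (hS : 0 ≤ S) :
    MeasureTheory.volume (cell l b w S) = ENNReal.ofReal w := by
  rw [cell, volume_lShape (lt_notchLeft hl hw hS).le (notchLeft_le hl hw hS)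
    (lt_notchTop hl hw hS).le (notchTop_lt hl hw).le, cell_area hl hw hS]

/-- A region is cut into a cell, the region in the notch of the cell and the region above it. -/
theorem region_eq_union (hl : l < 1) (hw : 0 < w) (hS : 0 ≤ S) (hW : w + S ≤ W) :
    region l b W = cell l b w S ∪ region (notchLeft l w S) b S ∪
      region l (cellTop l b w S) (W - (w + S)) := by
  have hW0 : 0 < W := by linarith
  have e1 : b + W / (1 - l) = cellTop l b w S + (W - (w + S)) / (1 - l) := by
    unfold cellTop; ring
  have h1 := lt_notchLeft hl hw hS
  have h2 := notchLeft_le hl hw hS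
  have h3 := lt_notchTop (b := b) hl hw hS
  have h4 := notchTop_lt (b := b) (S := S) hl hw
  have h5 : 0 ≤ (W - (w + S)) / (1 - l) := div_nonneg (by linarith) (by linarith)
  ext p
  simp only [region, cell, lShape, Set.mem_union, Set.mem_ofPred_eq, e1]
  constructor
  · rintro ⟨-, a1, a2, a3, a4⟩
    by_cases c1 : p.2 ≤ cellTop l b w S
    · by_cases c2 : p.1 ≤ notchLeft l w S ∨ notchTop l b w S ≤ p.2
      · exact Or.inl (Or.inl ⟨a1, a2, a3, c1, c2⟩)
      · push Not at c2
        have hS' : 0 < S := by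
          rcases hS.lt_or_eq with h | h
          · exact h
          · rw [← h, notchLeft_zero] at c2; linarith [c2.1]
        rw [notch_area hl hw hS']
        exact Or.inl (Or.inr ⟨hS', c2.1.le, a2, a3, c2.2.le⟩)
    · push Not at c1
      have : 0 < W - (w + S) := by
        rcases (sub_nonneg.2 hW).lt_or_eq with h | h
        · exact h
        · rw [← h] at a4; simp at a4; linarith
      exact Or.inr ⟨this, a1, a2, c1.le, a4⟩
  · rintro ((⟨a1, a2, a3, a4, a5⟩ | ⟨hS', a1, a2, a3, a4⟩) | ⟨hW', a1, a2, a3, a4⟩)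
    · exact ⟨hW0, a1, a2, a3, by linarith⟩
    · rw [notch_area hl hw hS'] at a4
      exact ⟨hW0, by linarith, a2, a3, by linarith⟩
    · exact ⟨hW0, a1, a2, by linarith, a4⟩

/-- The new cell borders its notch on the left and above, as a vertex must border its own slot. -/
theorem mem_cell_iff_of_mem_notch (hl : l < 1) (hw : 0 < w) {p : ℝ × ℝ}
    (hp : p ∈ region (notchLeft l w S) b S) :
    p ∈ cell l b w S ↔ p.1 = notchLeft l w S ∨ p.2 = b + S / (1 - notchLeft l w S) := by
  obtain ⟨hS, a1, a2, a3, a4⟩ := hp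
  rw [notch_area hl hw hS] at *
  have h1 := lt_notchLeft hl hw hS.le
  have h4 := notchTop_lt (b := b) (S := S) hl hw
  constructor
  · rintro ⟨-, -, -, -, h⟩
    exact h.imp (fun h => le_antisymm h a1) (fun h => le_antisymm a4 h)
  · intro h
    exact ⟨by linarith, a2, a3, by linarith, h.imp (fun h => h.le) (fun h => h.ge)⟩

/-- The new cell borders the remaining slot of its parent from below, as a successor must. -/
theorem mem_cell_iff_of_mem_above (hl : l < 1) (hw : 0 < w) {S' : ℝ} {p : ℝ × ℝ}
    (hS : 0 ≤ S) (hp : p ∈ region l (cellTop l b w S) S') :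
    p ∈ cell l b w S ↔ p.2 = cellTop l b w S := by
  obtain ⟨-, a1, a2, a3, a4⟩ := hp
  have h3 := lt_notchTop (b := b) hl hw hS
  have h4 := notchTop_lt (b := b) (S := S) hl hw
  constructor
  · rintro ⟨-, -, -, h, -⟩; exact le_antisymm h a3
  · intro h; exact ⟨a1, a2, by linarith, h.le, Or.inr (by linarith)⟩

theorem interior_cell_subset : interior (cell l b w S) ⊆
    {p | l < p.1 ∧ p.1 < 1 ∧ b < p.2 ∧ p.2 < cellTop l b w S} := by
  have h : cell l b w S ⊆ Set.Icc l 1 ×ˢ Set.Icc b (cellTop l b w S) := by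
    rintro p ⟨h1, h2, h3, h4, -⟩
    exact ⟨⟨h1, h2⟩, h3, h4⟩
  refine (interior_mono h).trans ?_
  rw [interior_prod_eq, interior_Icc, interior_Icc]
  rintro p ⟨⟨h1, h2⟩, h3, h4⟩
  exact ⟨h1, h2, h3, h4⟩

end Cell

/-! ### Contacts between neighbouring sets -/

/-- Used to show that a contact point is not interior: a small step from it into the free region
would remain in `K`. -/
theorem exists_smul_mem_of_mem_interior {K : Set (ℝ × ℝ)} {p : ℝ × ℝ} (hp : p ∈ interior K)
    (v : ℝ × ℝ) {δ : ℝ} (hδ : 0 < δ) : ∃ ε > 0, ε < δ ∧ p + ε • v ∈ K := by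
  have hc : Filter.Tendsto (fun ε : ℝ => p + ε • v) (nhdsWithin 0 (Set.Ioi 0)) (nhds p) := by
    have : Filter.Tendsto (fun ε : ℝ => p + ε • v) (nhds 0) (nhds (p + (0 : ℝ) • v)) :=
      Continuous.tendsto (by fun_prop) 0
    simp only [zero_smul, add_zero] at this
    exact this.mono_left nhdsWithin_le_nhds
  have h1 := hc.eventually (mem_interior_iff_mem_nhds.1 hp)
  have h2 : ∀ᶠ ε : ℝ in nhdsWithin 0 (Set.Ioi 0), ε ∈ Set.Ioo 0 δ := Ioo_mem_nhdsGT hδ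
  obtain ⟨ε, h3, h4⟩ := (h1.and h2).exists
  exact ⟨ε, h4.1, h4.2, h3⟩

/-- The sets `K` and `K'` have disjoint interiors and touch along a segment. -/
def Touch (K K' : Set (ℝ × ℝ)) : Prop :=
  Disjoint (interior K) (interior K') ∧
    ∃ a b : ℝ × ℝ, a ≠ b ∧ segment ℝ a b ⊆ frontier K ∩ frontier K'

theorem Touch.symm {K K' : Set (ℝ × ℝ)} (h : Touch K K') : Touch K' K := by
  obtain ⟨h1, a, b, h2, h3⟩ := h
  exact ⟨h1.symm, a, b, h2, by rwa [Set.inter_comm]⟩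

section Contact

variable {l b w S W : ℝ} {K : Set (ℝ × ℝ)}

theorem mem_frontier_of_mem_of_notMem {p : ℝ × ℝ} (h1 : p ∈ K) (h2 : p ∉ interior K) :
    p ∈ frontier K := ⟨subset_closure h1, h2⟩

theorem cell_subset_region (hl : l < 1) (hw : 0 < w) (hS : 0 ≤ S) (hW : w + S ≤ W) :
    cell l b w S ⊆ region l b W := by
  rw [region_eq_union hl hw hS hW]
  exact fun p hp => Or.inl (Or.inl hp)

/-- A cell touches the set bordering its region on the left and above. -/
theorem touch_left (hl : l < 1) (hw : 0 < w) (hS : 0 ≤ S) (hW : w + S ≤ W)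
    (hK : ∀ p ∈ region l b W, p ∈ K ↔ p.1 = l ∨ p.2 = b + W / (1 - l)) :
    Touch (cell l b w S) K := by
  have h1 := lt_notchLeft hl hw hS
  have h3 := lt_notchTop (b := b) hl hw hS
  have h4 := notchTop_lt (b := b) (S := S) hl hw
  have h5 : cellTop l b w S ≤ b + W / (1 - l) := by
    unfold cellTop
    have := div_le_div_of_nonneg_right hW (sub_pos.2 hl).le
    linarith
  constructor
  · refine Set.disjoint_left.2 fun p hp hp' => ?_
    have hi := interior_cell_subset hp
    rcases (hK p (cell_subset_region hl hw hS hW (interior_subset hp))).1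
      (interior_subset hp') with h | h
    · exact hi.1.ne' h
    · linarith [hi.2.2.2]
  -- The segment stops at the height of the notch, strictly below the top of the region. A small
  -- step to the right then leaves both the left and the upper border.
  · refine ⟨(l, b), (l, notchTop l b w S), by simp [Prod.ext_iff, h3.ne], ?_⟩
    rw [← affineSegment_eq_segment]
    intro p hp
    rw [mem_affineSegment_vertical h3.le] at hp
    obtain ⟨hp1, hp2, hp3⟩ := hp
    have hc : p ∈ cell l b w S := ⟨hp1.ge, by linarith, hp2, by linarith, Or.inl (by linarith)⟩
    have hr := cell_subset_region hl hw hS hW hc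
    refine ⟨mem_frontier_of_mem_of_notMem hc fun hi => ?_,
      mem_frontier_of_mem_of_notMem ((hK p hr).2 (Or.inl hp1)) fun hi => ?_⟩
    · exact (interior_cell_subset hi).1.ne' hp1
    · obtain ⟨ε, hε, hε', hm⟩ := exists_smul_mem_of_mem_interior hi (1, 0) (sub_pos.2 hl)
      have hr' : p + ε • ((1 : ℝ), (0 : ℝ)) ∈ region l b W := by
        refine ⟨hr.1, ?_, ?_, ?_, ?_⟩ <;> simp <;> linarith
      rcases (hK _ hr').1 hm with h | h <;> simp at h <;> linarith

/-- A cell touches the set bordering its region from below. -/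
theorem touch_below (hl : l < 1) (hw : 0 < w) (hS : 0 ≤ S) (hW : w + S ≤ W)
    (hK : ∀ p ∈ region l b W, p ∈ K ↔ p.2 = b) : Touch (cell l b w S) K := by
  have h1 := lt_notchLeft hl hw hS
  have h2 := notchLeft_le hl hw hS
  have h3 := lt_notchTop (b := b) hl hw hS
  have h4 := notchTop_lt (b := b) (S := S) hl hw
  have h5 : cellTop l b w S ≤ b + W / (1 - l) := by
    unfold cellTop
    have := div_le_div_of_nonneg_right hW (sub_pos.2 hl).le
    linarith
  constructor
  · refine Set.disjoint_left.2 fun p hp hp' => ?_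
    have hi := interior_cell_subset hp
    exact hi.2.2.1.ne' ((hK p (cell_subset_region hl hw hS hW (interior_subset hp))).1
      (interior_subset hp'))
  · refine ⟨(l, b), (notchLeft l w S, b), by simp [Prod.ext_iff, h1.ne], ?_⟩
    rw [← affineSegment_eq_segment]
    intro p hp
    rw [mem_affineSegment_horizontal h1.le] at hp
    obtain ⟨hp1, hp2, hp3⟩ := hp
    have hc : p ∈ cell l b w S := ⟨hp2, by linarith, hp1.ge, by linarith, Or.inl (by linarith)⟩
    have hr := cell_subset_region hl hw hS hW hc
    refine ⟨mem_frontier_of_mem_of_notMem hc fun hi => ?_,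
      mem_frontier_of_mem_of_notMem ((hK p hr).2 hp1) fun hi => ?_⟩
    · exact (interior_cell_subset hi).2.2.1.ne' hp1
    · obtain ⟨ε, hε, hε', hm⟩ := exists_smul_mem_of_mem_interior hi (0, 1) (sub_pos.2 (h3.trans h4))
      have hr' : p + ε • ((0 : ℝ), (1 : ℝ)) ∈ region l b W := by
        refine ⟨hr.1, ?_, ?_, ?_, ?_⟩ <;> simp <;> linarith
      have h := (hK _ hr').1 hm
      simp at h
      linarith

end Contact

/-- A partial layout: the vertices of `A` have been placed as the sets `P v`, and the remaining
ones go into the regions, one for every vertex of `A` and its successor. A region is bordered by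
its vertex on the left and above, by the successor from below, and by no other placed vertex. -/
structure IsLayout {V : Type*} (G : SimpleGraph V) (θ : V → ℝ) (A : Finset V)
    (P : V → Set (ℝ × ℝ)) (L B S : V → ℝ) (T : ℝ) : Prop where
  left_lt : ∀ x ∈ A, 0 < S x → L x < 1
  region_disjoint : ∀ x ∈ A, ∀ v ∈ A, v ≠ x → ¬ IsNext θ A x v →
    Disjoint (region (L x) (B x) (S x)) (P v)
  regions_disjoint : ∀ x ∈ A, ∀ y ∈ A, x ≠ y →
    Disjoint (region (L x) (B x) (S x)) (region (L y) (B y) (S y))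
  mem_self : ∀ x ∈ A, ∀ p ∈ region (L x) (B x) (S x),
    p ∈ P x ↔ p.1 = L x ∨ p.2 = B x + S x / (1 - L x)
  mem_next : ∀ x y, IsNext θ A x y → ∀ p ∈ region (L x) (B x) (S x), p ∈ P y ↔ p.2 = B x
  touch : ∀ u ∈ A, ∀ v ∈ A, G.Adj u v → Touch (P u) (P v)
  apart : ∀ u ∈ A, ∀ v ∈ A, u ≠ v → ¬ G.Adj u v → Disjoint (P u) (P v)
  union : (⋃ v ∈ A, P v) ∪ (⋃ v ∈ A, region (L v) (B v) (S v)) = Set.Icc (0, 0) (1, T)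

section Layout

variable {V : Type*} {G : SimpleGraph V} {θ : V → ℝ} {A : Finset V}

theorem IsNext.unique (hθ : Function.Injective θ) {x y z : V} (h1 : IsNext θ A x y)
    (h2 : IsNext θ A x z) : y = z := by
  refine hθ (le_antisymm ?_ ?_)
  · exact (h1.2.2.2 z h2.2.1).resolve_left (not_le.2 h2.2.2.1)
  · exact (h2.2.2.2 y h1.2.1).resolve_left (not_le.2 h1.2.2.1)

theorem region_zero (l b : ℝ) : region l b 0 = ∅ := by
  ext p; simp [region]

theorem cell_zero {w : ℝ} : cell 0 0 w 0 = Set.Icc (0, 0) (1, w) := by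
  ext p
  simp only [cell, lShape, notchLeft_zero, cellTop, Set.mem_ofPred_eq, Set.mem_Icc, Prod.le_def]
  constructor
  · rintro ⟨h1, h2, h3, h4, -⟩
    exact ⟨⟨h1, h3⟩, h2, by simpa using h4⟩
  · rintro ⟨⟨h1, h3⟩, h2, h4⟩
    exact ⟨h1, h2, h3, by simpa using h4, Or.inl h2⟩

/-- The complete layout of a graph with one vertex; larger graphs start from a pair. -/
theorem isLayout_singleton {r : V} {wr : ℝ} {P : V → Set (ℝ × ℝ)} {L B S : V → ℝ}
    (hP : P r = cell 0 0 wr 0) (hS : S r = 0) : IsLayout G θ {r} P L B S wr where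
  left_lt := by simp [hS]
  region_disjoint := by simp
  regions_disjoint := by simp
  mem_self := by simp [hS, region_zero]
  mem_next := by
    rintro x y ⟨hx, hy, hlt, -⟩
    rw [Finset.mem_singleton] at hx hy
    subst hx; subst hy
    exact absurd hlt (lt_irrefl _)
  touch := by simp
  apart := by simp
  union := by simp [hS, hP, region_zero, cell_zero]

/-- A complete layout, with every set realized by a polygon, is a cartogram. -/
theorem IsLayout.isCartogram [Fintype V] {P : V → Set (ℝ × ℝ)} {L B S w : V → ℝ} {T : ℝ}
    (hl : IsLayout G θ Finset.univ P L B S T) (hS : ∀ v, S v = 0) {k : V → ℕ}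
    {poly : ∀ v, Polygon (ℝ × ℝ) (k v)} (hpoly : ∀ v, IsPolygonOf (poly v) (P v))
    (hvol : ∀ v, MeasureTheory.volume (P v) = ENNReal.ofReal (w v)) :
    IsCartogram G w poly ∧ (∀ v, k v ≤ 6) ∧
      ∃ p q : ℝ × ℝ, (⋃ v, polygonRegion (poly v)) = Set.Icc p q := by
  have hreg : ∀ v, polygonRegion (poly v) = P v := fun v => (hpoly v).region
  have hsub : ∀ v, (poly v).boundary ℝ ⊆ P v := fun v => by
    rw [← hreg v]; exact Set.subset_union_left
  refine ⟨⟨fun v => (hpoly v).simple, fun v => (hpoly v).rectilinear, ?_, ?_, ?_⟩,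
    fun v => (hpoly v).sides, (0, 0), (1, T), ?_⟩
  · intro u v huv
    rw [hreg, hreg]
    by_cases h : G.Adj u v
    · exact (hl.touch u (Finset.mem_univ _) v (Finset.mem_univ _) h).1
    · exact (hl.apart u (Finset.mem_univ _) v (Finset.mem_univ _) huv h).mono
        interior_subset interior_subset
  · intro u v huv
    constructor
    · rintro ⟨a, b, -, hab⟩
      by_contra h
      have ha := hab (left_mem_segment ℝ a b)
      exact Set.disjoint_left.1 (hl.apart u (Finset.mem_univ _) v (Finset.mem_univ _) huv h)
        (hsub u ha.1) (hsub v ha.2)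
    · intro h
      obtain ⟨-, a, b, hne, hab⟩ := hl.touch u (Finset.mem_univ _) v (Finset.mem_univ _) h
      exact ⟨a, b, hne, hab.trans (Set.inter_subset_inter (hpoly u).frontier_subset
        (hpoly v).frontier_subset)⟩
  · intro v
    rw [hreg, hvol]
  · rw [← hl.union]
    simp [hreg, hS, region_zero]

variable [DecidableEq V]

/-- A new vertex splits exactly one consecutive pair into two; every other consecutive pair was
consecutive before. -/
theorem IsNext.of_insert (hθ : Function.Injective θ) {x y d u v : V} (hd : d ∉ A)
    (h : IsNext θ A x y) (h1 : θ x < θ d) (h2 : θ d < θ y) (huv : IsNext θ (insert d A) u v) :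
    (u = x ∧ v = d) ∨ (u = d ∧ v = y) ∨ (u ∈ A ∧ v ∈ A ∧ u ≠ x ∧ IsNext θ A u v) := by
  obtain ⟨hx, hy, -, hxy⟩ := h
  obtain ⟨hu0, hv0, hlt, hz⟩ := huv
  have hzx := hz x (Finset.mem_insert_of_mem hx)
  have hzy := hz y (Finset.mem_insert_of_mem hy)
  have hzd := hz d (Finset.mem_insert_self _ _)
  rcases Finset.mem_insert.1 hu0 with rfl | hu
  · rcases Finset.mem_insert.1 hv0 with rfl | hv
    · exact absurd hlt (lt_irrefl _)
    · refine Or.inr (Or.inl ⟨rfl, hθ ?_⟩)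
      rcases hxy v hv with h | h
      · linarith
      · exact le_antisymm (hzy.resolve_left (not_le.2 h2)) h
  · rcases Finset.mem_insert.1 hv0 with rfl | hv
    · refine Or.inl ⟨hθ ?_, rfl⟩
      rcases hxy u hu with h | h
      · exact le_antisymm h (hzx.resolve_right (not_le.2 h1))
      · linarith
    · refine Or.inr (Or.inr ⟨hu, hv, ?_, hu, hv, hlt, fun z hz' => hz z (Finset.mem_insert_of_mem hz')⟩)
      rintro rfl
      rcases hzd with h | h
      · linarith
      · rcases hxy v hv with h' | h' <;> linarith

theorem IsNext.insert_of_ne (hθ : Function.Injective θ) {x y d u v : V}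
    (h : IsNext θ A x y) (h1 : θ x < θ d) (h2 : θ d < θ y) (huv : IsNext θ A u v) (hux : u ≠ x) :
    IsNext θ (insert d A) u v := by
  obtain ⟨hx, hy, -, hxy⟩ := h
  obtain ⟨hu, hv, hlt, hz⟩ := huv
  refine ⟨Finset.mem_insert_of_mem hu, Finset.mem_insert_of_mem hv, hlt, fun z hz' => ?_⟩
  rcases Finset.mem_insert.1 hz' with rfl | hz'
  · rcases hxy u hu with h | h
    · have : θ v ≤ θ x := (hz x hx).resolve_left (not_le.2 (lt_of_le_of_ne h (hθ.ne hux)))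
      exact Or.inr (by linarith)
    · exact Or.inl (by linarith)
  · exact hz z hz'

theorem IsNext.insert_left {x y d : V} (h : IsNext θ A x y) (h1 : θ x < θ d) (h2 : θ d < θ y) :
    IsNext θ (insert d A) x d := by
  refine ⟨Finset.mem_insert_of_mem h.1, Finset.mem_insert_self _ _, h1, fun z hz => ?_⟩
  rcases Finset.mem_insert.1 hz with rfl | hz
  · exact Or.inr le_rfl
  · exact (h.2.2.2 z hz).imp id fun h => by linarith

theorem IsNext.insert_right {x y d : V} (h : IsNext θ A x y) (h1 : θ x < θ d) (h2 : θ d < θ y) :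
    IsNext θ (insert d A) d y := by
  refine ⟨Finset.mem_insert_self _ _, Finset.mem_insert_of_mem h.2.1, h2, fun z hz => ?_⟩
  rcases Finset.mem_insert.1 hz with rfl | hz
  · exact Or.inl le_rfl
  · exact (h.2.2.2 z hz).imp (fun h => by linarith) id

/-- Placing a further vertex `d` between `x` and its successor `y`. -/
theorem IsLayout.insert (hθ : Function.Injective θ) {P : V → Set (ℝ × ℝ)} {L B S : V → ℝ} {T w : ℝ}
    (hl : IsLayout G θ A P L B S T) {x y d : V} (hd : d ∉ A) (hxy : IsNext θ A x y)
    (h1 : θ x < θ d) (h2 : θ d < θ y) (hadj : ∀ u ∈ A, G.Adj d u ↔ u = x ∨ u = y) (hw : 0 < w)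
    (hS : 0 ≤ S d) (hW : w + S d ≤ S x) :
    IsLayout G θ (insert d A) (Function.update P d (cell (L x) (B x) w (S d)))
      (Function.update L d (notchLeft (L x) w (S d)))
      (Function.update (Function.update B x (cellTop (L x) (B x) w (S d))) d (B x))
      (Function.update S x (S x - (w + S d))) T := by
  have hx := hxy.1
  have hy := hxy.2.1
  have hxd : x ≠ d := by rintro rfl; exact hd hx
  have hyd : y ≠ d := by rintro rfl; exact hd hy
  have hyx : y ≠ x := by rintro rfl; exact lt_irrefl _ hxy.2.2.1
  have hlt : L x < 1 := hl.left_lt x hx (by linarith)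
  have g1 := lt_notchLeft hlt hw hS
  have g3 := lt_notchTop (b := B x) hlt hw hS
  have g4 := notchTop_lt (b := B x) (S := S d) hlt hw
  have eU := region_eq_union (b := B x) hlt hw hS hW
  set K := cell (L x) (B x) w (S d) with hK
  set P' := Function.update P d K with hP'
  set L' := Function.update L d (notchLeft (L x) w (S d)) with hL'
  set B' := Function.update (Function.update B x (cellTop (L x) (B x) w (S d))) d (B x) with hB'
  set S' := Function.update S x (S x - (w + S d)) with hS'
  have hne : ∀ v ∈ A, v ≠ d := fun v hv h => hd (h ▸ hv)
  have ePd : P' d = K := by simp [hP']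
  have eP : ∀ v ∈ A, P' v = P v := fun v hv => by simp [hP', hne v hv]
  have eQd : region (L' d) (B' d) (S' d) = region (notchLeft (L x) w (S d)) (B x) (S d) := by
    simp [hL', hB', hS', hxd.symm]
  have eQx : region (L' x) (B' x) (S' x) =
      region (L x) (cellTop (L x) (B x) w (S d)) (S x - (w + S d)) := by
    simp [hL', hB', hS', hxd]
  have eQ : ∀ v ∈ A, v ≠ x → region (L' v) (B' v) (S' v) = region (L v) (B v) (S v) := by
    intro v hv hvx
    simp [hL', hB', hS', hne v hv, hvx]
  have subK : K ⊆ region (L x) (B x) (S x) := by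
    rw [eU]; exact fun p hp => Or.inl (Or.inl hp)
  have subd : region (L' d) (B' d) (S' d) ⊆ region (L x) (B x) (S x) := by
    rw [eU, eQd]; exact fun p hp => Or.inl (Or.inr hp)
  have subx : region (L' x) (B' x) (S' x) ⊆ region (L x) (B x) (S x) := by
    rw [eU, eQx]; exact fun p hp => Or.inr hp
  -- These strict inequalities keep the notch away from `x` and from the remaining slot of `x`,
  -- although all the sets are closed.
  have topd : ∀ p ∈ region (L' d) (B' d) (S' d), L x < p.1 ∧ p.2 < cellTop (L x) (B x) w (S d) := by
    rw [eQd]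
    rintro p ⟨hS0, a1, a2, a3, a4⟩
    rw [notch_area hlt hw hS0] at a4
    exact ⟨by linarith, by linarith⟩
  have hWtop : cellTop (L x) (B x) w (S d) ≤ B x + S x / (1 - L x) := by
    unfold cellTop
    have := div_le_div_of_nonneg_right hW (sub_pos.2 hlt).le
    linarith
  constructor
  · intro v hv0 hpos
    rcases Finset.mem_insert.1 hv0 with rfl | hv
    · simp only [hL', Function.update_self]
      rw [hS', Function.update_of_ne hxd.symm] at hpos
      exact notchLeft_lt hlt hw hpos
    · simp only [hL', Function.update_of_ne (hne v hv)]
      by_cases hvx : v = x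
      · rw [hvx]; exact hlt
      · rw [hS', Function.update_of_ne hvx] at hpos
        exact hl.left_lt v hv hpos
  · intro u hu0 v hv0 hvu hnext
    rcases Finset.mem_insert.1 hu0 with rfl | hu
    · have hvA : v ∈ A := (Finset.mem_insert.1 hv0).resolve_left hvu
      have hvy : v ≠ y := by rintro rfl; exact hnext (hxy.insert_right h1 h2)
      rw [eP v hvA]
      by_cases hvx : v = x
      · subst hvx
        refine Set.disjoint_left.2 fun p hp hp' => ?_
        have ht := topd p hp
        rcases (hl.mem_self v hx p (subd hp)).1 hp' with h | h <;> linarith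
      · exact (hl.region_disjoint x hx v hvA hvx fun h => hvy (h.unique hθ hxy)).mono_left subd
    · by_cases hux : u = x
      · subst hux
        have hvd : v ≠ d := by rintro rfl; exact hnext (hxy.insert_left h1 h2)
        have hvA : v ∈ A := (Finset.mem_insert.1 hv0).resolve_left hvd
        rw [eP v hvA]
        by_cases hvy : v = y
        · subst hvy
          refine Set.disjoint_left.2 fun p hp hp' => ?_
          have := (hl.mem_next u v hxy p (subx hp)).1 hp'
          rw [eQx] at hp
          linarith [hp.2.2.2.1]
        · exact (hl.region_disjoint u hx v hvA hvu fun h => hvy (h.unique hθ hxy)).mono_left subx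
      · rw [eQ u hu hux]
        rcases Finset.mem_insert.1 hv0 with rfl | hv
        · rw [ePd]
          exact (hl.regions_disjoint u hu x hx hux).mono_right subK
        · rw [eP v hv]
          exact hl.region_disjoint u hu v hv hvu fun h =>
            hnext (hxy.insert_of_ne hθ h1 h2 h hux)
  · have key : ∀ u ∈ A, Disjoint (region (L' d) (B' d) (S' d)) (region (L' u) (B' u) (S' u)) := by
      intro u hu
      by_cases hux : u = x
      · subst hux
        refine Set.disjoint_left.2 fun p hp hp' => ?_
        have ht := topd p hp
        rw [eQx] at hp'
        linarith [hp'.2.2.2.1]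
      · rw [eQ u hu hux]
        exact (hl.regions_disjoint x hx u hu (Ne.symm hux)).mono_left subd
    intro u hu0 v hv0 huv
    rcases Finset.mem_insert.1 hu0 with rfl | hu
    · exact key v ((Finset.mem_insert.1 hv0).resolve_left huv.symm)
    · rcases Finset.mem_insert.1 hv0 with rfl | hv
      · exact (key u hu).symm
      · by_cases hux : u = x
        · subst hux
          rw [eQ v hv huv.symm]
          exact (hl.regions_disjoint u hu v hv huv).mono_left subx
        · rw [eQ u hu hux]
          by_cases hvx : v = x
          · subst hvx
            exact (hl.regions_disjoint u hu v hv huv).mono_right subx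
          · rw [eQ v hv hvx]
            exact hl.regions_disjoint u hu v hv huv
  · intro u hu0 p hp
    rcases Finset.mem_insert.1 hu0 with rfl | hu
    · rw [ePd]
      rw [eQd] at hp
      simpa [hL', hB', hS', hxd.symm] using mem_cell_iff_of_mem_notch hlt hw hp
    · rw [eP u hu]
      by_cases hux : u = x
      · subst hux
        rw [hl.mem_self u hu p (subx hp)]
        -- The slot of the parent loses area at its bottom only; its upper side, along which the
        -- parent borders it, stays where it was.
        have e1 : B u + S u / (1 - L u) =
            cellTop (L u) (B u) w (S d) + (S u - (w + S d)) / (1 - L u) := by unfold cellTop; ring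
        simp [hL', hB', hS', hxd, e1]
      · rw [eQ u hu hux] at hp
        rw [hl.mem_self u hu p hp]
        simp [hL', hB', hS', hne u hu, hux]
  · intro u v huv p hp
    rcases IsNext.of_insert hθ hd hxy h1 h2 huv with ⟨rfl, rfl⟩ | ⟨rfl, rfl⟩ | ⟨hu, hv, hux, huv⟩
    · rw [ePd]
      rw [eQx] at hp
      rw [mem_cell_iff_of_mem_above hlt hw hS hp]
      simp [hB', hxd]
    · rw [eP v hy, hl.mem_next x v hxy p (subd hp)]
      simp [hB']
    · rw [eP v hv]
      rw [eQ u hu hux] at hp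
      rw [hl.mem_next u v huv p hp]
      simp [hB', hne u hu, hux]
  · have key : ∀ u ∈ A, G.Adj d u → Touch (P' d) (P' u) := by
      intro u hu hdu
      rw [ePd, eP u hu]
      rcases (hadj u hu).1 hdu with rfl | rfl
      · exact touch_left hlt hw hS hW (hl.mem_self u hu)
      · exact touch_below hlt hw hS hW (hl.mem_next x u hxy)
    intro u hu0 v hv0 huv
    rcases Finset.mem_insert.1 hu0 with rfl | hu
    · exact key v ((Finset.mem_insert.1 hv0).resolve_left huv.ne') huv
    · rcases Finset.mem_insert.1 hv0 with rfl | hv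
      · exact (key u hu huv.symm).symm
      · rw [eP u hu, eP v hv]; exact hl.touch u hu v hv huv
  · have key : ∀ u ∈ A, ¬ G.Adj d u → Disjoint (P' d) (P' u) := by
      intro u hu hdu
      rw [ePd, eP u hu]
      rw [hadj u hu, not_or] at hdu
      exact (hl.region_disjoint x hx u hu hdu.1 fun h => hdu.2 (h.unique hθ hxy)).mono_left subK
    intro u hu0 v hv0 huv hnadj
    rcases Finset.mem_insert.1 hu0 with rfl | hu
    · exact key v ((Finset.mem_insert.1 hv0).resolve_left huv.symm) hnadj
    · rcases Finset.mem_insert.1 hv0 with rfl | hv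
      · exact (key u hu fun h => hnadj h.symm).symm
      · rw [eP u hu, eP v hv]; exact hl.apart u hu v hv huv hnadj
  · rw [← hl.union]
    ext p
    have hQx : p ∈ region (L x) (B x) (S x) ↔ (p ∈ K ∨ p ∈ region (L' d) (B' d) (S' d)) ∨
        p ∈ region (L' x) (B' x) (S' x) := by
      rw [eU, eQd, eQx]; rfl
    simp only [Set.mem_union, Set.mem_iUnion, exists_prop]
    constructor
    · rintro (⟨v, hv0, hp⟩ | ⟨v, hv0, hp⟩)
      · rcases Finset.mem_insert.1 hv0 with rfl | hv
        · rw [ePd] at hp; exact Or.inr ⟨x, hx, subK hp⟩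
        · rw [eP v hv] at hp; exact Or.inl ⟨v, hv, hp⟩
      · rcases Finset.mem_insert.1 hv0 with rfl | hv
        · exact Or.inr ⟨x, hx, subd hp⟩
        · by_cases hvx : v = x
          · subst hvx; exact Or.inr ⟨v, hx, subx hp⟩
          · rw [eQ v hv hvx] at hp; exact Or.inr ⟨v, hv, hp⟩
    · rintro (⟨v, hv, hp⟩ | ⟨v, hv, hp⟩)
      · exact Or.inl ⟨v, Finset.mem_insert_of_mem hv, by rwa [eP v hv]⟩
      · by_cases hvx : v = x
        · subst hvx
          rcases hQx.1 hp with (h | h) | h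
          · exact Or.inl ⟨d, Finset.mem_insert_self _ _, by rwa [ePd]⟩
          · exact Or.inr ⟨d, Finset.mem_insert_self _ _, h⟩
          · exact Or.inr ⟨v, Finset.mem_insert_of_mem hv, h⟩
        · exact Or.inr ⟨v, Finset.mem_insert_of_mem hv, by rwa [eQ v hv hvx]⟩

/-- The rectangle of `r` is the bottom of the strip. On it stands the L-shape of `s`, filling with
its notch a full-width rectangle of area `ws + S s`. The notch is the only slot, as `r` has no
successor. Because the strip has width one, heights equal areas. -/
theorem isLayout_pair {r s : V} {wr ws : ℝ} (hwr : 0 < wr) (hws : 0 < ws) (hθ : θ s < θ r)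
    (hrs : G.Adj s r) {P : V → Set (ℝ × ℝ)} {L B S : V → ℝ} (hPr : P r = cell 0 0 wr 0)
    (hPs : P s = cell 0 wr ws (S s)) (hLs : L s = notchLeft 0 ws (S s)) (hBs : B s = wr)
    (hSr : S r = 0) (hSs : 0 ≤ S s) :
    IsLayout G θ (insert s {r}) P L B S (wr + (ws + S s)) := by
  have hnext : IsNext θ (insert s {r}) s r := by
    refine ⟨by simp, by simp, hθ, ?_⟩
    simp
  have hnext' : ∀ u v, IsNext θ (insert s {r}) u v → u = s ∧ v = r := by
    rintro u v ⟨hu, hv, hlt, -⟩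
    simp only [Finset.mem_insert, Finset.mem_singleton] at hu hv
    rcases hu with rfl | rfl <;> rcases hv with rfl | rfl
    · exact absurd hlt (lt_irrefl _)
    · exact ⟨rfl, rfl⟩
    · linarith
    · exact absurd hlt (lt_irrefl _)
  have hQr : region (L r) (B r) (S r) = ∅ := by rw [hSr, region_zero]
  have hQs : region (L s) (B s) (S s) = region (notchLeft 0 ws (S s)) wr (S s) := by rw [hLs, hBs]
  have eU := region_eq_union (b := wr) zero_lt_one hws hSs (le_refl (ws + S s))
  rw [sub_self, region_zero, Set.union_empty] at eU
  have hbelow : ∀ p ∈ region 0 wr (ws + S s), p ∈ P r ↔ p.2 = wr := by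
    rintro p ⟨-, h1, h2, h3, -⟩
    rw [hPr, cell_zero]
    constructor
    · rintro ⟨-, -, h⟩; exact le_antisymm h h3
    · intro h; exact ⟨⟨h1, by linarith⟩, h2, h.le⟩
  have hT : Touch (P s) (P r) := by
    rw [hPs]
    exact touch_below zero_lt_one hws hSs le_rfl hbelow
  constructor
  · intro x hx hpos
    simp only [Finset.mem_insert, Finset.mem_singleton] at hx
    rcases hx with rfl | rfl
    · rw [hLs]; exact notchLeft_lt zero_lt_one hws hpos
    · exact absurd hpos (by simp [hSr])
  · intro x hx v hv hvx hn
    simp only [Finset.mem_insert, Finset.mem_singleton] at hx hv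
    rcases hx with rfl | rfl
    · rcases hv with rfl | rfl
      · exact absurd rfl hvx
      · exact absurd hnext hn
    · rw [hQr]; exact Set.empty_disjoint _
  · intro x hx y hy hxy
    simp only [Finset.mem_insert, Finset.mem_singleton] at hx hy
    rcases hx with rfl | rfl
    · rcases hy with rfl | rfl
      · exact absurd rfl hxy
      · rw [hQr]; exact Set.disjoint_empty _
    · rw [hQr]; exact Set.empty_disjoint _
  · intro x hx p hp
    simp only [Finset.mem_insert, Finset.mem_singleton] at hx
    rcases hx with rfl | rfl
    · rw [hQs] at hp
      rw [hPs, hLs, hBs]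
      exact mem_cell_iff_of_mem_notch zero_lt_one hws hp
    · rw [hQr] at hp; exact absurd hp (Set.notMem_empty _)
  · intro x y hxy p hp
    obtain ⟨rfl, rfl⟩ := hnext' x y hxy
    rw [hBs]
    rw [hQs] at hp
    exact hbelow p (eU ▸ Or.inr hp)
  · intro u hu v hv huv
    simp only [Finset.mem_insert, Finset.mem_singleton] at hu hv
    rcases hu with rfl | rfl <;> rcases hv with rfl | rfl
    · exact absurd rfl huv.ne
    · exact hT
    · exact hT.symm
    · exact absurd rfl huv.ne
  · intro u hu v hv huv hn
    simp only [Finset.mem_insert, Finset.mem_singleton] at hu hv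
    rcases hu with rfl | rfl <;> rcases hv with rfl | rfl
    · exact absurd rfl huv
    · exact absurd hrs hn
    · exact absurd hrs.symm hn
    · exact absurd rfl huv
  · simp only [Finset.mem_insert, Finset.mem_singleton, Set.iUnion_iUnion_eq_or_left,
      Set.iUnion_iUnion_eq_left, hQr, hQs, Set.union_empty]
    have : P s ∪ P r ∪ region (notchLeft 0 ws (S s)) wr (S s) =
        region 0 wr (ws + S s) ∪ Set.Icc (0, 0) (1, wr) := by
      rw [eU, hPs, hPr, cell_zero]
      ext p; simp only [Set.mem_union]; tauto
    rw [this]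
    have h0 : 0 < ws + S s := by linarith
    ext p
    simp only [region, Set.mem_union, Set.mem_ofPred_eq, Set.mem_Icc, Prod.le_def, sub_zero, div_one]
    constructor
    · rintro (⟨-, h1, h2, h3, h4⟩ | ⟨⟨h1, h2⟩, h3, h4⟩)
      · exact ⟨⟨h1, by linarith⟩, h2, h4⟩
      · exact ⟨⟨h1, h2⟩, h3, by linarith⟩
    · rintro ⟨⟨h1, h2⟩, h3, h4⟩
      rcases le_total wr p.2 with h | h
      · exact Or.inl ⟨h0, h1, h3, h, h4⟩
      · exact Or.inr ⟨⟨h1, h2⟩, h3, h⟩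

end Layout

/-! ## Running programs -/

namespace RealRAM

/-- Started in `s`, the program `p` halts after at most `T` steps in a state satisfying `Q`. -/
def Reaches (p : Program) (s : State) (T : ℕ) (Q : State → Prop) : Prop :=
  ∃ s' t, Runs p s s' t ∧ t ≤ T ∧ Q s'

theorem Reaches.seq {p q : Program} {s : State} {T₁ T₂ : ℕ} {Q R : State → Prop}
    (hp : Reaches p s T₁ Q) (hq : ∀ s', Q s' → Reaches q s' T₂ R) :
    Reaches (.seq p q) s (T₁ + T₂) R := by
  obtain ⟨s₁, t₁, h₁, ht₁, hQ⟩ := hp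
  obtain ⟨s₂, t₂, h₂, ht₂, hR⟩ := hq s₁ hQ
  exact ⟨s₂, t₁ + t₂, .seq h₁ h₂, add_le_add ht₁ ht₂, hR⟩

theorem Reaches.mono {p : Program} {s : State} {T T' : ℕ} {Q R : State → Prop}
    (hp : Reaches p s T Q) (hT : T ≤ T') (h : ∀ s', Q s' → R s') : Reaches p s T' R := by
  obtain ⟨s₁, t₁, h₁, ht₁, hQ⟩ := hp
  exact ⟨s₁, t₁, h₁, ht₁.trans hT, h _ hQ⟩

/-- The rule for loops, with an invariant `I` and a potential `Φ` that pays for the running time;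
both depend on some data `a` that the program does not see. -/
theorem Reaches.loop {α : Type*} {c : Test} {p : Program} (I : α → State → Prop) (Φ : α → ℕ)
    (step : ∀ a s, I a s → c.Holds s → ∃ T, Reaches p s T fun s' => ∃ a', I a' s' ∧ T + 1 + Φ a' ≤ Φ a)
    {a : α} {s : State} (h : I a s) :
    Reaches (.while c p) s (Φ a + 1) fun s' => ∃ a', I a' s' ∧ ¬ c.Holds s' := by
  induction hN : Φ a using Nat.strong_induction_on generalizing a s with
  | _ N ih =>
    subst hN
    by_cases hc : c.Holds s
    · obtain ⟨T, s₁, t₁, h₁, ht₁, a', hI, hΦ⟩ := step a s h hc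
      obtain ⟨s₂, t₂, h₂, ht₂, hQ⟩ := ih (Φ a') (by omega) hI rfl
      exact ⟨s₂, _, .while_true hc h₁ h₂, by omega, hQ⟩
    · exact ⟨s, 1, .while_false hc, by omega, a, h, hc⟩

/-- The sequential composition of a list of programs. -/
def Program.ofList : List Program → Program
  | [] => .instr (.copy 0 0)
  | p :: ps => .seq p (Program.ofList ps)

/-- Programs without loops. -/
def Program.LoopFree : Program → Prop
  | .instr _ => True
  | .seq p q => p.LoopFree ∧ q.LoopFree
  | .ite _ p q => p.LoopFree ∧ q.LoopFree
  | .while _ _ => False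

/-- A bound for the running time of a program without loops. -/
def Program.cost : Program → ℕ
  | .instr _ => 1
  | .seq p q => p.cost + q.cost
  | .ite _ p q => p.cost + q.cost + 1
  | .while _ _ => 0

open Classical in
/-- The final state of a program without loops. -/
noncomputable def Program.run : Program → State → State
  | .instr o, s => o.exec s
  | .seq p q, s => q.run (p.run s)
  | .ite c p q, s => if c.Holds s then p.run s else q.run s
  | .while _ _, s => s

/-- Loop-free programs can be evaluated as functions, so their effect is computed by simplification.
The values of `run` and `cost` at loops are placeholders, excluded by the hypothesis. Charging both
branches of a conditional bounds the cost independently of the state. -/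
theorem Program.LoopFree.exists_runs {p : Program} (hp : p.LoopFree) (s : State) :
    ∃ t ≤ p.cost, Runs p s (p.run s) t := by
  induction p generalizing s with
  | instr o => exact ⟨1, le_rfl, .instr o s⟩
  | seq p q ihp ihq =>
    obtain ⟨t₁, h₁, r₁⟩ := ihp hp.1 s
    obtain ⟨t₂, h₂, r₂⟩ := ihq hp.2 (p.run s)
    exact ⟨t₁ + t₂, add_le_add h₁ h₂, .seq r₁ r₂⟩
  | ite c p q ihp ihq =>
    by_cases hc : c.Holds s
    · obtain ⟨t, h, r⟩ := ihp hp.1 s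
      refine ⟨t + 1, by simp only [cost]; omega, ?_⟩
      rw [run, if_pos hc]
      exact .ite_true hc r
    · obtain ⟨t, h, r⟩ := ihq hp.2 s
      refine ⟨t + 1, by simp only [cost]; omega, ?_⟩
      rw [run, if_neg hc]
      exact .ite_false hc r
  | _ => exact absurd hp id

@[simp] theorem Program.ofList_nil_run (s : State) : (Program.ofList []).run s = s := by
  simp [Program.ofList, Program.run, Instr.exec]

@[simp] theorem Program.ofList_cons_run (p : Program) (ps : List Program) (s : State) :
    (Program.ofList (p :: ps)).run s = (Program.ofList ps).run (p.run s) := rfl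

open Classical in
theorem Program.ite_run (c : Test) (p q : Program) (s : State) :
    (Program.ite c p q).run s = if c.Holds s then p.run s else q.run s := rfl

theorem Program.LoopFree.reaches {p : Program} (hp : p.LoopFree) {s : State} {Q : State → Prop}
    (h : Q (p.run s)) : Reaches p s p.cost Q := by
  obtain ⟨t, ht, hr⟩ := hp.exists_runs s
  exact ⟨_, t, hr, ht, h⟩

/-- A straight-line program. -/
def block (l : List Instr) : Program := Program.ofList (l.map Program.instr)

/-- The effect of a straight-line program. -/
noncomputable def execs : List Instr → State → State
  | [], s => s
  | o :: os, s => execs os (o.exec s)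

@[simp] theorem block_run (l : List Instr) (s : State) : (block l).run s = execs l s := by
  induction l generalizing s with
  | nil => simp [block, Program.ofList, Program.run, Instr.exec, execs]
  | cons o os ih =>
    simp only [block, List.map_cons, Program.ofList, Program.run, execs]
    exact ih _

@[simp] theorem block_loopFree (l : List Instr) : (block l).LoopFree := by
  induction l with
  | nil => trivial
  | cons o os ih => exact ⟨trivial, ih⟩

@[simp] theorem block_cost (l : List Instr) : (block l).cost = l.length + 1 := by
  induction l with
  | nil => rfl
  | cons o os ih =>
    simp only [block, List.map_cons, Program.ofList, Program.cost, List.length_cons] at *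
    omega

@[simp] theorem execs_nil (s : State) : execs [] s = s := rfl

@[simp] theorem execs_cons (o : Instr) (os : List Instr) (s : State) :
    execs (o :: os) s = execs os (o.exec s) := rfl

/-- The empty composition is a dummy copy, which explains the one extra step in every list of
programs. -/
theorem reaches_nil (s : State) : Reaches (Program.ofList []) s 1 fun s' => s' = s := by
  refine ⟨_, _, .instr _ _, le_rfl, ?_⟩
  simp [Instr.exec]

theorem reaches_block_cons {l : List Instr} {ps : List Program} {s : State} {T : ℕ}
    {Q : State → Prop} (h : Reaches (Program.ofList ps) (execs l s) T Q) :
    Reaches (Program.ofList (block l :: ps)) s (l.length + 1 + T) Q := by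
  refine (((block_loopFree l).reaches (Q := fun s' => s' = execs l s) (block_run l s)).seq
    (T₂ := T) ?_).mono (by simp) fun _ h => h
  rintro _ rfl
  exact h

theorem reaches_singleton {p : Program} {s : State} {T : ℕ} {Q : State → Prop}
    (h : Reaches p s T Q) : Reaches (Program.ofList [p]) s (T + 1) Q :=
  h.seq fun s' hs' => (reaches_nil s').mono le_rfl fun _ h => h ▸ hs'

end RealRAM

/-! ## Arrays and linked lists -/

/-- The array `f` holds the list `Q` at its beginning. -/
def HoldsList {n : ℕ} (f : ℕ → ℕ) (Q : List (Fin n)) : Prop :=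
  ∀ i (h : i < Q.length), f i = Q[i]

theorem HoldsList.push {n : ℕ} {f : ℕ → ℕ} {Q : List (Fin n)} (h : HoldsList f Q) (v : Fin n) :
    HoldsList (Function.update f Q.length v) (Q ++ [v]) := by
  intro i hi
  rw [List.length_append, List.length_singleton] at hi
  rcases (Nat.lt_succ_iff.1 hi).lt_or_eq with h' | rfl
  · rw [Function.update_of_ne h'.ne, h i h', List.getElem_append_left h']
  · simp

/-- The linked list with first node `h` (and `0` for the end of the list) holds the entries `l`;
all nodes are at most `K`. -/
def IsLinkedList {n : ℕ} (dst nxt : ℕ → ℕ) (K : ℕ) : ℕ → List (Fin n) → Prop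
  | h, [] => h = 0
  | h, u :: l => 0 < h ∧ h ≤ K ∧ dst h = u ∧ IsLinkedList dst nxt K (nxt h) l

/-- The node `K + 1` is fresh, so writing to it disturbs no existing list. -/
theorem IsLinkedList.update {n : ℕ} {dst nxt : ℕ → ℕ} {K : ℕ} (a b : ℕ) {h : ℕ} {l : List (Fin n)}
    (hl : IsLinkedList dst nxt K h l) :
    IsLinkedList (Function.update dst (K + 1) a) (Function.update nxt (K + 1) b) (K + 1) h l := by
  induction l generalizing h with
  | nil => exact hl
  | cons u l ih =>
    obtain ⟨h1, h2, h3, h4⟩ := hl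
    have hne : h ≠ K + 1 := by omega
    refine ⟨h1, by omega, by rwa [Function.update_of_ne hne], ?_⟩
    rw [Function.update_of_ne hne]
    exact ih h4

/-- The linked lists with heads `head` hold the lists `l`, and `deg` holds their lengths. -/
def HoldsLists {n : ℕ} (K : ℕ) (dst nxt head deg : ℕ → ℕ) (l : Fin n → List (Fin n)) : Prop :=
  ∀ v : Fin n, IsLinkedList dst nxt K (head v) (l v) ∧ deg v = (l v).length

theorem HoldsLists.push {n : ℕ} {K : ℕ} {dst nxt head deg : ℕ → ℕ} {l : Fin n → List (Fin n)}
    (h : HoldsLists K dst nxt head deg l) (u v : Fin n) :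
    HoldsLists (K + 1) (Function.update dst (K + 1) v) (Function.update nxt (K + 1) (head u))
      (Function.update head u (K + 1)) (Function.update deg u (deg u + 1))
      (Function.update l u (v :: l u)) := by
  intro x
  by_cases hx : x = u
  · subst hx
    simp only [Function.update_self]
    exact ⟨⟨by omega, le_rfl, by simp, by simpa using (h x).1.update _ _⟩, by simp [(h x).2]⟩
  · have hx' : (x : ℕ) ≠ u := fun h => hx (Fin.ext h)
    rw [Function.update_of_ne hx, Function.update_of_ne hx', Function.update_of_ne hx']
    exact ⟨(h x).1.update _ _, (h x).2⟩

/-! ### Adjacency lists of an edge list -/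

/-- The entries that an edge contributes to the adjacency list of `v`. -/
def incident {V : Type*} [DecidableEq V] (e : V × V) (v : V) : List V :=
  (if e.2 = v then [e.1] else []) ++ (if e.1 = v then [e.2] else [])

/-- The adjacency lists, with the latest edges first. -/
def adjList {V : Type*} [DecidableEq V] (E : List (V × V)) (v : V) : List V :=
  E.foldl (fun l e => incident e v ++ l) []

section AdjList

variable {V : Type*} [DecidableEq V]

theorem adjList_append (E : List (V × V)) (e : V × V) (v : V) :
    adjList (E ++ [e]) v = incident e v ++ adjList E v := by
  simp [adjList]

/-- This is the form produced by the machine: two successive pushes, the second one reading the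
result of the first. -/
theorem adjList_append_eq_update (E : List (V × V)) (e : V × V) :
    adjList (E ++ [e]) =
      Function.update (Function.update (adjList E) e.1 (e.2 :: adjList E e.1)) e.2
        (e.1 :: Function.update (adjList E) e.1 (e.2 :: adjList E e.1) e.2) := by
  funext v
  rw [adjList_append, incident]
  by_cases h1 : e.1 = v <;> by_cases h2 : e.2 = v
  · subst h2; simp [h1]
  · subst h1; simp [h2, Function.update_of_ne (Ne.symm h2)]
  · subst h2; simp [h1, Function.update_of_ne (Ne.symm h1)]
  · simp [h1, h2, Function.update_of_ne (Ne.symm h1), Function.update_of_ne (Ne.symm h2)]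

theorem mem_adjList {E : List (V × V)} {u v : V} :
    u ∈ adjList E v ↔ (v, u) ∈ E ∨ (u, v) ∈ E := by
  induction E using List.reverseRecOn with
  | nil => simp [adjList]
  | append_singleton E e ih =>
    rw [adjList_append, List.mem_append, ih]
    obtain ⟨a, b⟩ := e
    simp only [incident, List.mem_append, List.mem_singleton, Prod.mk.injEq]
    by_cases h1 : a = v <;> by_cases h2 : b = v <;> simp [h1, h2] <;> tauto

/-- A repeated entry would come from an unordered pair listed twice, or from a loop. Each neighbour
must occur once for the degree counters to be right. -/
theorem nodup_adjList {E : List (V × V)} (hE : (E.map fun e => s(e.1, e.2)).Nodup)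
    (hne : ∀ e ∈ E, e.1 ≠ e.2) (v : V) : (adjList E v).Nodup := by
  induction E using List.reverseRecOn with
  | nil => simp [adjList]
  | append_singleton E e ih =>
    rw [List.map_append, List.nodup_append'] at hE
    have ih' := ih hE.1 fun e he => hne e (List.mem_append_left _ he)
    rw [adjList_append, List.nodup_append']
    have hee := hne e (by simp)
    have hnot : s(e.1, e.2) ∉ E.map fun e => s(e.1, e.2) := fun h => hE.2.2 h (by simp)
    refine ⟨?_, ih', ?_⟩
    · unfold incident
      split_ifs with h1 h2 h2
      · exact absurd (h2.trans h1.symm) hee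
      all_goals simp
    · intro x hx hx'
      apply hnot
      rw [mem_adjList] at hx'
      unfold incident at hx
      have hx2 : s(x, v) ∈ E.map fun e => s(e.1, e.2) := by
        rcases hx' with h | h
        · exact List.mem_map.2 ⟨_, h, Sym2.eq_swap⟩
        · exact List.mem_map.2 ⟨_, h, rfl⟩
      split_ifs at hx with h1 h2 h2
      · exact absurd (h2.trans h1.symm) hee
      · rw [List.append_nil, List.mem_singleton] at hx
        rw [h1, ← hx]; exact hx2
      · rw [List.nil_append, List.mem_singleton] at hx
        rw [h2, ← hx, Sym2.eq_swap]; exact hx2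
      · simp at hx

end AdjList

section EdgeList

variable {n : ℕ} {G : SimpleGraph (Fin n)} {E : List (Fin n × Fin n)}

theorem RealRAM.IsEdgeList.mem_adjList_iff (hE : IsEdgeList G E) {u v : Fin n} :
    u ∈ adjList E v ↔ G.Adj v u := by
  rw [mem_adjList, ← SimpleGraph.mem_edgeSet, ← hE.2, List.mem_map]
  constructor
  · rintro (h | h)
    · exact ⟨_, h, rfl⟩
    · exact ⟨_, h, Sym2.eq_swap⟩
  · rintro ⟨⟨a, b⟩, h, he⟩
    rcases Sym2.eq_iff.1 he with ⟨rfl, rfl⟩ | ⟨rfl, rfl⟩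
    · exact Or.inl h
    · exact Or.inr h

theorem RealRAM.IsEdgeList.nodup_adjList (hE : IsEdgeList G E) (v : Fin n) :
    (adjList E v).Nodup := by
  refine _root_.nodup_adjList hE.1 (fun e he => ?_) v
  have : s(e.1, e.2) ∈ G.edgeSet := (hE.2 _).1 (List.mem_map.2 ⟨e, he, rfl⟩)
  exact (G.mem_edgeSet.1 this).ne

theorem RealRAM.IsEdgeList.toFinset_adjList (hE : IsEdgeList G E) (v : Fin n) :
    (adjList E v).toFinset = nbrs G Finset.univ v := by
  ext u; simp [hE.mem_adjList_iff]

theorem RealRAM.IsEdgeList.length_adjList (hE : IsEdgeList G E) (v : Fin n) :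
    (adjList E v).length = (nbrs G Finset.univ v).card := by
  rw [← hE.toFinset_adjList, List.toFinset_card_of_nodup (hE.nodup_adjList v)]

/-- The handshake identity; it bounds the total cost of scanning every adjacency list once. -/
theorem sum_length_adjList (E : List (Fin n × Fin n)) :
    ∑ v, (adjList E v).length = 2 * E.length := by
  induction E using List.reverseRecOn with
  | nil => simp [adjList]
  | append_singleton E e ih =>
    have h : ∀ a b : Fin n, (if a = b then [e.1] else []).length = if a = b then 1 else 0 := by
      intro a b; split_ifs <;> rfl
    simp only [adjList_append, List.length_append, Finset.sum_add_distrib, ih, incident,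
      apply_ite List.length, List.length_singleton, List.length_nil, Finset.sum_ite_eq,
      Finset.mem_univ, if_true]
    ring

end EdgeList

/-! ## The program -/

namespace RealRAM

open Instr Test

/-- Registers `4` and `5` hold the ends of the current edge; append both half-edges. -/
def adjacencyBody : Program := block
  [load 4 0 2, load 5 1 2,
   succ 3, store 5 3 5, load 6 3 4, store 4 3 6, store 3 4 3, load 6 6 4, succ 6, store 6 4 6,
   succ 3, store 5 3 4, load 6 3 5, store 4 3 6, store 3 5 3, load 6 6 5, succ 6, store 6 5 6,
   succ 2]

def adjacencyLoop : Program := .while (lt 2 1) adjacencyBody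

/-- The parts of the state that the combinatorial phases do not change. -/
def Preserved (n : ℕ) (R : ℕ → ℕ → ℝ) (s : State) : Prop :=
  s.reg 0 = n ∧ s.reg 20 = 0 ∧ s.rmem = R ∧ s.rreg = fun _ => 0

/-- Register `2` counts the processed edges and register `3` the list nodes in use. Array `8`, the
marks of deleted vertices, and registers `7` and `8`, the queue length and the vertex counter of the
next phase, are still zero. Register `20` is never written and serves as the constant zero
throughout. -/
def AdjacencyInv {n : ℕ} (E : List (Fin n × Fin n)) (R : ℕ → ℕ → ℝ) (s : State) (e : ℕ) : Prop :=
  Preserved n R s ∧ s.reg 1 = E.length ∧ s.reg 2 = e ∧ e ≤ E.length ∧ s.reg 7 = 0 ∧ s.reg 8 = 0 ∧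
  s.mem 8 = (fun _ => 0) ∧
  (∀ i (h : i < E.length), s.mem 0 i = E[i].1 ∧ s.mem 1 i = E[i].2) ∧
  HoldsLists (s.reg 3) (s.mem 5) (s.mem 4) (s.mem 3) (s.mem 6) (adjList (E.take e))

theorem adjacencyInv_step {n : ℕ} {E : List (Fin n × Fin n)} {R : ℕ → ℕ → ℝ} {s : State} {e : ℕ}
    (h : AdjacencyInv E R s e) (he : e < E.length) :
    AdjacencyInv E R (adjacencyBody.run s) (e + 1) := by
  obtain ⟨⟨h0, h20, hR, hRR⟩, h1, h2, -, h7, h8, hm8, hE, hL⟩ := h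
  obtain ⟨hE0, hE1⟩ := hE e he
  have hL' := (hL.push E[e].1 E[e].2).push E[e].2 E[e].1
  rw [← adjList_append_eq_update, ← List.take_succ_eq_append_getElem he] at hL'
  refine ⟨⟨?_, ?_, ?_, ?_⟩, ?_, ?_, he, ?_, ?_, ?_, ?_, ?_⟩
  case refine_10 => simpa [adjacencyBody, Instr.exec, Function.update_apply] using hE
  case refine_11 =>
    simpa [adjacencyBody, Instr.exec, Function.update_apply, h2, hE0, hE1] using hL'
  all_goals simp [adjacencyBody, Instr.exec, Function.update_apply, *]

theorem adjacencyLoop_reaches {n : ℕ} (E : List (Fin n × Fin n)) (w : Fin n → ℝ) :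
    Reaches adjacencyLoop (input E w) (30 * E.length + 1) fun s =>
      AdjacencyInv E (input E w).rmem s E.length := by
  have h := Reaches.loop (c := lt 2 1) (p := adjacencyBody)
    (fun e s => AdjacencyInv E (input E w).rmem s e) (fun e => 30 * (E.length - e)) ?_ (a := 0)
    (s := input E w) ?_
  · refine h.mono le_rfl ?_
    rintro s ⟨e, hI, hc⟩
    have : e = E.length := by
      have h1 : ¬ s.reg 2 < s.reg 1 := hc
      rw [hI.2.1, hI.2.2.1] at h1
      have := hI.2.2.2.1
      omega
    rwa [this] at hI
  · intro e s hI hc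
    have he : e < E.length := by
      have h1 : s.reg 2 < s.reg 1 := hc
      rwa [hI.2.1, hI.2.2.1] at h1
    refine ⟨_, (block_loopFree _).reaches ⟨e + 1, adjacencyInv_step hI he, ?_⟩⟩
    simp
    omega
  · refine ⟨⟨by simp [input], by simp [input], rfl, rfl⟩, by simp [input], by simp [input],
      Nat.zero_le _, by simp [input], by simp [input], ?_, ?_, ?_⟩
    · funext i; simp [input]
    · intro i hi; simp [input, hi]
    · intro v; simp [input, adjList, IsLinkedList]

/-! ### The initial queue -/

/-- Put the vertices of degree at most two into the queue. -/
def queueBody : Program := Program.ofList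
  [block [load 6 6 8], .ite (lt 6 9) (block [store 7 7 8, succ 7]) (block []), block [succ 8]]

def queueLoop : Program := Program.ofList [block [const 9 3], .while (lt 8 0) queueBody]

/-- The arrays `3`, `4`, `5` hold the adjacency lists and the array `6` the degrees. -/
def HoldsGraph {n : ℕ} (s : State) (L : Fin n → List (Fin n)) : Prop :=
  HoldsLists (s.reg 3) (s.mem 5) (s.mem 4) (s.mem 3) (s.mem 6) L

/-- Array `7` holds the queue, register `7` its length. -/
def HoldsQueue {n : ℕ} (s : State) (Q : List (Fin n)) : Prop :=
  s.reg 7 = Q.length ∧ HoldsList (s.mem 7) Q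

def QueueInv {n : ℕ} (L : Fin n → List (Fin n)) (R : ℕ → ℕ → ℝ) (s : State) (c : ℕ) : Prop :=
  Preserved n R s ∧ HoldsGraph s L ∧ s.mem 8 = (fun _ => 0) ∧ s.reg 9 = 3 ∧ s.reg 8 = c ∧ c ≤ n ∧
  ∃ Q : List (Fin n), HoldsQueue s Q ∧ Q.Nodup ∧ ∀ v, v ∈ Q ↔ (v : ℕ) < c ∧ (L v).length ≤ 2

theorem queueInv_step {n : ℕ} {L : Fin n → List (Fin n)} {R : ℕ → ℕ → ℝ} {s : State} {c : ℕ}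
    (h : QueueInv L R s c) (hc : c < n) : QueueInv L R (queueBody.run s) (c + 1) := by
  obtain ⟨⟨h0, h20, hR, hRR⟩, hG, hm8, h9, h8, -, Q, ⟨hq7, hqm⟩, hQn, hQ⟩ := h
  have hdeg : s.mem 6 c = (L ⟨c, hc⟩).length := (hG ⟨c, hc⟩).2
  have hmem : ∀ v : Fin n, (v : ℕ) < c + 1 ↔ (v : ℕ) < c ∨ v = ⟨c, hc⟩ := fun v => by
    rw [Nat.lt_succ_iff_lt_or_eq, Fin.ext_iff]
  by_cases hlt : (L ⟨c, hc⟩).length < 3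
  · have hnot : (⟨c, hc⟩ : Fin n) ∉ Q := fun h => lt_irrefl _ ((hQ _).1 h).1
    refine ⟨⟨?_, ?_, ?_, ?_⟩, ?_, ?_, ?_, ?_, hc, Q ++ [⟨c, hc⟩], ⟨?_, ?_⟩, ?_, ?_⟩
    case refine_5 => simpa [queueBody, Program.ite_run, Test.Holds, Instr.exec,
      Function.update_apply, h9, h8, hdeg, hlt, HoldsGraph] using hG
    case refine_10 =>
      have := hqm.push ⟨c, hc⟩
      simpa [queueBody, Program.ite_run, Test.Holds, Instr.exec,
        Function.update_apply, h9, h8, hdeg, hlt, hq7] using this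
    case refine_11 =>
      rw [List.nodup_append']
      exact ⟨hQn, by simp, by simpa using hnot⟩
    case refine_12 =>
      intro v
      rw [List.mem_append, List.mem_singleton, hQ, hmem]
      constructor
      · rintro (⟨h1, h2⟩ | rfl)
        · exact ⟨Or.inl h1, h2⟩
        · exact ⟨Or.inr rfl, by omega⟩
      · rintro ⟨h1 | h1, h2⟩
        · exact Or.inl ⟨h1, h2⟩
        · exact Or.inr h1
    all_goals simp [queueBody, Program.ite_run, Test.Holds, Instr.exec, *]
  · refine ⟨⟨?_, ?_, ?_, ?_⟩, ?_, ?_, ?_, ?_, hc, Q, ⟨?_, ?_⟩, hQn, ?_⟩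
    case refine_5 => simpa [queueBody, Program.ite_run, Test.Holds, Instr.exec,
      Function.update_apply, h9, h8, hdeg, hlt, HoldsGraph] using hG
    case refine_10 => simpa [queueBody, Program.ite_run, Test.Holds, Instr.exec,
        Function.update_apply, h9, h8, hdeg, hlt] using hqm
    case refine_11 =>
      intro v
      rw [hQ, hmem]
      constructor
      · rintro ⟨h1, h2⟩
        exact ⟨Or.inl h1, h2⟩
      · rintro ⟨h1 | rfl, h2⟩
        · exact ⟨h1, h2⟩
        · omega
    all_goals simp [queueBody, Program.ite_run, Test.Holds, Instr.exec, *]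

theorem queueLoop_reaches {n : ℕ} {E : List (Fin n × Fin n)} {R : ℕ → ℕ → ℝ} {s : State}
    (h : AdjacencyInv E R s E.length) :
    Reaches queueLoop s (12 * n + 4) fun s' => QueueInv (adjList E) R s' n := by
  obtain ⟨⟨h0, h20, hR, hRR⟩, -, -, -, h7, h8, hm8, -, hL⟩ := h
  rw [List.take_length] at hL
  have hinit : QueueInv (adjList E) R (execs [const 9 3] s) 0 := by
    refine ⟨⟨?_, ?_, ?_, ?_⟩, ?_, ?_, ?_, ?_, Nat.zero_le _, [], ⟨?_, ?_⟩, by simp, by simp⟩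
    case refine_5 => simpa [Instr.exec, Function.update_apply, HoldsGraph] using hL
    case refine_10 => intro i hi; simp at hi
    all_goals simp [Instr.exec, *]
  have h := Reaches.loop (c := lt 8 0) (p := queueBody)
    (fun c s => QueueInv (adjList E) R s c) (fun c => 12 * (n - c)) ?_ hinit
  · refine (reaches_block_cons (l := [const 9 3]) (reaches_singleton h)).mono
      (by simp; omega) ?_
    rintro s' ⟨c, hI, hc⟩
    have hc' : ¬ s'.reg 8 < s'.reg 0 := hc
    rw [hI.1.1, hI.2.2.2.2.1] at hc'
    have := hI.2.2.2.2.2.1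
    rwa [show c = n by omega] at hI
  · intro c s' hI hc
    have hc' : s'.reg 8 < s'.reg 0 := hc
    rw [hI.1.1, hI.2.2.2.2.1] at hc'
    refine ⟨_, Program.LoopFree.reaches ?_ ⟨c + 1, queueInv_step hI hc', ?_⟩⟩
    · simp [queueBody, Program.ofList, Program.LoopFree]
    · simp [queueBody, Program.ofList, Program.cost]
      omega

end RealRAM

/-! ## The elimination phase -/

section Remaining

variable {n : ℕ}

/-- The vertices that remain when all entries of `Q` before the `i`-th, except for the very first,
have been removed. -/
def remaining (Q : List (Fin n)) (i : ℕ) : Finset (Fin n) :=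
  Finset.univ.filter fun v => v ∉ (Q.take i).drop 1

@[simp] theorem mem_remaining {Q : List (Fin n)} {i : ℕ} {v : Fin n} :
    v ∈ remaining Q i ↔ v ∉ (Q.take i).drop 1 := by simp [remaining]

theorem remaining_one (Q : List (Fin n)) : remaining Q 1 = Finset.univ := by
  ext v
  cases Q <;> simp

theorem remaining_append {Q : List (Fin n)} (X : List (Fin n)) {i : ℕ} (hi : i ≤ Q.length) :
    remaining (Q ++ X) i = remaining Q i := by
  simp [remaining, List.take_append_of_le_length hi]

theorem remaining_succ {Q : List (Fin n)} {i : ℕ} {d : Fin n} (hi : 1 ≤ i) (hd : Q[i]? = some d) :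
    remaining Q (i + 1) = (remaining Q i).erase d := by
  obtain ⟨h, rfl⟩ := List.getElem?_eq_some_iff.1 hd
  ext v
  have : 1 ≤ (Q.take i).length := by rw [List.length_take]; omega
  rw [mem_remaining, Finset.mem_erase, mem_remaining, List.take_succ_eq_append_getElem h,
    List.drop_append_of_le_length this, List.mem_append, List.mem_singleton]
  tauto

theorem mem_remaining_of_getElem? {Q : List (Fin n)} (hQ : Q.Nodup) {i j : ℕ} {v : Fin n}
    (hv : Q[j]? = some v) : v ∈ remaining Q i ↔ j = 0 ∨ i ≤ j := by
  obtain ⟨h, rfl⟩ := List.getElem?_eq_some_iff.1 hv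
  rw [mem_remaining, List.mem_iff_getElem]
  simp only [List.length_drop, List.length_take, List.getElem_drop, List.getElem_take]
  constructor
  · intro hcon
    by_contra! hj
    refine hcon ⟨j - 1, by omega, ?_⟩
    congr 1
    omega
  · rintro hj ⟨k, hk, he⟩
    have := (hQ.getElem_inj_iff).1 he
    omega

theorem card_remaining {Q : List (Fin n)} (hQ : Q.Nodup) {i : ℕ} (hi : 1 ≤ i)
    (hl : i ≤ Q.length) : (remaining Q i).card + i = n + 1 := by
  induction i, hi using Nat.le_induction with
  | base => rw [remaining_one]; simp
  | succ i hi ih =>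
    have hd : Q[i]? = some Q[i] := List.getElem?_eq_getElem (by omega)
    have hmem := (mem_remaining_of_getElem? hQ (i := i) hd).2 (Or.inr le_rfl)
    rw [remaining_succ hi hd, Finset.card_erase_of_mem hmem]
    have := ih (by omega)
    have := Finset.card_pos.2 ⟨_, hmem⟩
    omega

end Remaining

/-- The last two entries of a list, where `pq` stands for two entries in front of it. -/
def lastTwo {n : ℕ} (l : List (Fin n)) (pq : ℕ × ℕ) : ℕ × ℕ :=
  l.foldl (fun (pq : ℕ × ℕ) (u : Fin n) => (pq.2, (u : ℕ))) pq

theorem lastTwo_append {n : ℕ} (l l' : List (Fin n)) (pq : ℕ × ℕ) :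
    lastTwo (l ++ l') pq = lastTwo l' (lastTwo l pq) := List.foldl_append ..

theorem HoldsList.getElem? {n : ℕ} {f : ℕ → ℕ} {Q : List (Fin n)} (h : HoldsList f Q) {i : ℕ}
    {v : Fin n} (hv : Q[i]? = some v) : f i = v := by
  obtain ⟨hi, rfl⟩ := List.getElem?_eq_some_iff.1 hv
  exact h i hi

namespace RealRAM

open Instr Test

/-- Process the entry of the adjacency list at the node in register `15`. -/
def scanBody : Program := Program.ofList
  [block [load 4 5 15, load 6 8 4],
   .ite (eq 6 20)
    (Program.ofList
      [block [copy 16 17, copy 17 4, load 6 6 4, pred 6, store 6 4 6],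
       .ite (eq 6 12) (block [store 7 7 4, succ 7]) (block [])])
    (block []),
   block [load 15 4 15]]

/-- Here `s₀` is the state before the scan, `c` the degrees at that time, `l` the scanned and `l'`
the unscanned part of the list. A vertex is queued at the moment its degree falls from three to two,
hence never twice. Registers `16` and `17` shift through the remaining neighbours met so far. -/
structure ScanInv {n : ℕ} (s₀ : State) (A : Finset (Fin n)) (c : Fin n → ℕ) (Q : List (Fin n))
    (s : State) (l l' : List (Fin n)) : Prop where
  reg_eq : ∀ r, r ≠ 4 → r ≠ 6 → r ≠ 7 → r ≠ 15 → r ≠ 16 → r ≠ 17 → s.reg r = s₀.reg r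
  mem_eq : ∀ m, m ≠ 6 → m ≠ 7 → s.mem m = s₀.mem m
  rmem_eq : s.rmem = s₀.rmem
  rreg_eq : s.rreg = s₀.rreg
  list : IsLinkedList (s.mem 5) (s.mem 4) (s.reg 3) (s.reg 15) l'
  queue : HoldsQueue s (Q ++ l.filter fun v => v ∈ A ∧ c v = 3)
  deg : ∀ v ∈ A, s.mem 6 v = c v - if v ∈ l then 1 else 0
  last : (s.reg 16, s.reg 17) = lastTwo (l.filter (· ∈ A)) (s₀.reg 16, s₀.reg 17)

theorem scanInv_step {n : ℕ} {s₀ : State} {A : Finset (Fin n)} {c : Fin n → ℕ} {Q : List (Fin n)}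
    {s : State} {l l' : List (Fin n)} {u : Fin n} (h0 : s₀.reg 20 = 0) (h2 : s₀.reg 12 = 2)
    (hA : ∀ v : Fin n, s₀.mem 8 v = 0 ↔ v ∈ A) (hu : u ∉ l) (h : ScanInv s₀ A c Q s l (u :: l')) :
    ScanInv s₀ A c Q (scanBody.run s) (l ++ [u]) l' := by
  obtain ⟨hreg, hmem, hrm, hrr, ⟨hpos, -, hdst, hlist⟩, ⟨hq7, hqm⟩, hdeg, hlast⟩ := h
  have h20 : s.reg 20 = 0 := by rw [hreg] <;> first | exact h0 | norm_num
  have h12 : s.reg 12 = 2 := by rw [hreg] <;> first | exact h2 | norm_num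
  have h8 : s.mem 8 u = 0 ↔ u ∈ A := by rw [hmem 8 (by norm_num) (by norm_num)]; exact hA u
  have hfil : ∀ (p : Fin n → Prop) [DecidablePred p], (l ++ [u]).filter (fun v => p v) =
      l.filter (fun v => p v) ++ if p u then [u] else [] := by
    intro p _
    rw [List.filter_append]
    by_cases hp : p u <;> simp [hp]
  by_cases huA : u ∈ A
  · have h8' := h8.2 huA
    have hd : s.mem 6 u = c u := by rw [hdeg u huA, if_neg hu, Nat.sub_zero]
    have hlast' : (s.reg 17, (u : ℕ)) =
        lastTwo ((l ++ [u]).filter (· ∈ A)) (s₀.reg 16, s₀.reg 17) := by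
      rw [hfil, if_pos huA, lastTwo_append, ← hlast]
      rfl
    have hdeg' : ∀ v ∈ A, Function.update (s.mem 6) u (c u - 1) v =
        c v - if v ∈ l ++ [u] then 1 else 0 := by
      intro v hv
      by_cases hvu : v = u
      · subst hvu; simp
      · rw [Function.update_of_ne (fun h => hvu (Fin.ext h)), hdeg v hv]
        simp [hvu]
    by_cases hc : c u = 3
    · have hq' := hqm.push u
      rw [← hq7] at hq'
      have hrun : scanBody.run s = execs [load 4 5 15, load 6 8 4, copy 16 17, copy 17 4, load 6 6 4,
          pred 6, store 6 4 6, store 7 7 4, succ 7, load 15 4 15] s := by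
        simp [scanBody, Program.ite_run, Test.Holds, Instr.exec, hdst, h8', h20, h12, hd, hc]
      rw [hrun]
      constructor
      case queue =>
        rw [hfil, if_pos ⟨huA, hc⟩, ← List.append_assoc]
        refine ⟨?_, ?_⟩
        · simp [Instr.exec, hq7, add_assoc]
        · simpa [Instr.exec, hdst] using hq'
      case deg => simpa [Instr.exec, hdst, hd] using hdeg'
      case last => rw [← hlast']; simp [Instr.exec, hdst]
      case list => simpa [Instr.exec] using hlist
      all_goals simp +contextual [Instr.exec, Function.update_of_ne, hrm, hrr, hreg, hmem]
    · have hrun : scanBody.run s = execs [load 4 5 15, load 6 8 4, copy 16 17, copy 17 4,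
          load 6 6 4, pred 6, store 6 4 6, load 15 4 15] s := by
        have : c u - 1 ≠ 2 := by omega
        simp [scanBody, Program.ite_run, Test.Holds, Instr.exec, hdst, h8', h20, h12, hd, this]
      rw [hrun]
      constructor
      case queue =>
        rw [hfil, if_neg fun h => hc h.2, List.append_nil]
        refine ⟨?_, ?_⟩
        · simpa [Instr.exec] using hq7
        · simpa [Instr.exec, hdst] using hqm
      case deg => simpa [Instr.exec, hdst, hd] using hdeg'
      case last => rw [← hlast']; simp [Instr.exec, hdst]
      case list => simpa [Instr.exec] using hlist
      all_goals simp +contextual [Instr.exec, Function.update_of_ne, hrm, hrr, hreg, hmem]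
  · have h8' : s.mem 8 u ≠ 0 := fun h => huA (h8.1 h)
    have hrun : scanBody.run s = execs [load 4 5 15, load 6 8 4, load 15 4 15] s := by
      simp [scanBody, Program.ite_run, Test.Holds, Instr.exec, hdst, h8', h20]
    rw [hrun]
    constructor
    case queue =>
      rw [hfil, if_neg fun h => huA h.1, List.append_nil]
      refine ⟨?_, ?_⟩
      · simpa [Instr.exec] using hq7
      · simpa [Instr.exec, hdst] using hqm
    case deg =>
      intro v hv
      have hvu : v ≠ u := fun h => huA (h ▸ hv)
      simpa [Instr.exec, hvu] using hdeg v hv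
    case last => rw [hfil, if_neg huA, List.append_nil, ← hlast]; simp [Instr.exec]
    case list => simpa [Instr.exec] using hlist
    all_goals simp +contextual [Instr.exec, Function.update_of_ne, hrm, hrr, hreg, hmem]

theorem scanLoop_reaches {n : ℕ} {s : State} {A : Finset (Fin n)} {c : Fin n → ℕ}
    {Q : List (Fin n)} {l : List (Fin n)} (h0 : s.reg 20 = 0) (h2 : s.reg 12 = 2)
    (hA : ∀ v : Fin n, s.mem 8 v = 0 ↔ v ∈ A) (hl : l.Nodup)
    (hlist : IsLinkedList (s.mem 5) (s.mem 4) (s.reg 3) (s.reg 15) l) (hQ : HoldsQueue s Q)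
    (hc : ∀ v ∈ A, s.mem 6 v = c v) :
    Reaches (.while (lt 20 15) scanBody) s (30 * l.length + 1) fun s' =>
      ScanInv s A c Q s' l [] := by
  have h := Reaches.loop (c := lt 20 15) (p := scanBody)
    (fun (p : List (Fin n) × List (Fin n)) s' => p.1 ++ p.2 = l ∧ ScanInv s A c Q s' p.1 p.2)
    (fun p => 30 * p.2.length) ?_ (a := ([], l)) (s := s) ?_
  · refine h.mono le_rfl ?_
    rintro s' ⟨⟨l₁, l₂⟩, ⟨hl', hI⟩, hcon⟩
    have h1 : s'.reg 20 = 0 := by rw [hI.reg_eq] <;> first | exact h0 | norm_num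
    have hl2 := hI.list
    cases l₂ with
    | nil => rw [List.append_nil] at hl'; exact hl' ▸ hI
    | cons u l₂ => exact absurd (show s'.reg 20 < s'.reg 15 by rw [h1]; exact hl2.1) hcon
  · rintro ⟨l₁, l₂⟩ s' ⟨hl', hI⟩ hcon
    have h1 : s'.reg 20 = 0 := by rw [hI.reg_eq] <;> first | exact h0 | norm_num
    have hcon' : s'.reg 20 < s'.reg 15 := hcon
    cases l₂ with
    | nil =>
      have : s'.reg 15 = 0 := hI.list
      omega
    | cons u l₂ =>
      have hu : u ∉ l₁ := by
        subst hl'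
        exact fun h => (List.nodup_append'.1 hl).2.2 h (by simp)
      refine ⟨_, Program.LoopFree.reaches ?_ ⟨(l₁ ++ [u], l₂), ⟨by simpa using hl',
        scanInv_step h0 h2 hA hu hI⟩, ?_⟩⟩
      · simp [scanBody, Program.ofList, Program.LoopFree]
      · simp [scanBody, Program.ofList, Program.cost]
        omega
  · refine ⟨rfl, ?_⟩
    constructor
    case queue => simpa using hQ
    case deg => simpa using hc
    case list => exact hlist
    all_goals simp [lastTwo]

end RealRAM

/-- The list `Q` starts with a vertex of degree at most two, and in the order of the list (from its
second entry on, before the `i`-th entry) vertices can be removed that have at most two remaining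
neighbours each; these are kept in the arrays `p` and `q`. -/
structure IsEliminationOrder {n : ℕ} (G : SimpleGraph (Fin n))
    (sep : Fin n → Fin n → Fin n → Fin n → Prop) (Q : List (Fin n)) (i : ℕ) (p q : ℕ → ℕ) :
    Prop where
  nodup : Q.Nodup
  saturated : ∀ j, 1 ≤ j → j ≤ i → SaturatedOn G sep (remaining Q j)
  neighbors : ∀ j d, 1 ≤ j → j < i → Q[j]? = some d → ∃ a b : Fin n, p d = a ∧ q d = b ∧
    ∀ u ∈ remaining Q (j + 1), G.Adj d u → u = a ∨ u = b
  first : ∀ r, Q[0]? = some r → (nbrs G Finset.univ r).card ≤ 2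

/-- Removing a vertex adds to the queue the neighbours of degree three. -/
theorem IsEliminationOrder.append {n : ℕ} {G : SimpleGraph (Fin n)}
    {sep : Fin n → Fin n → Fin n → Fin n → Prop} {Q X : List (Fin n)} {i : ℕ} {p q : ℕ → ℕ}
    (hG : IsOuterTriangulation G sep) (h : IsEliminationOrder G sep Q i p q) (hi : 1 ≤ i)
    {d a b : Fin n} (hd : Q[i]? = some d) (hX : (Q ++ X).Nodup) (hn : i + 1 < n)
    (h2 : (nbrs G (remaining Q i) d).card ≤ 2)
    (hab : ∀ u ∈ remaining Q (i + 1), G.Adj d u → u = a ∨ u = b) :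
    IsEliminationOrder G sep (Q ++ X) (i + 1) (Function.update p d a) (Function.update q d b) := by
  have hil : i < Q.length := (List.getElem?_eq_some_iff.1 hd).1
  have happ : ∀ j, j < Q.length → (Q ++ X)[j]? = Q[j]? := fun j hj =>
    List.getElem?_append_left hj
  have hdA : d ∈ remaining Q i := (mem_remaining_of_getElem? h.nodup hd).2 (Or.inr le_rfl)
  have hcard := card_remaining h.nodup hi hil.le
  refine ⟨hX, fun j hj1 hji => ?_, fun j d' hj1 hji hd' => ?_, fun r hr => ?_⟩
  · rw [remaining_append X (by omega)]
    rcases Nat.le_succ_iff.1 hji with hji | rfl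
    · exact h.saturated j hj1 hji
    · rw [remaining_succ hi hd]
      -- There are `n + 1 - i` vertices left, because the first queue entry is never deleted; by `i
      -- + 1 < n` these are at least three.
      convert SaturatedOn.erase hG (h.saturated i hi le_rfl) (by omega) hdA h2
  · rw [happ j (by omega)] at hd'
    rw [remaining_append X (by omega)]
    rcases Nat.lt_succ_iff_lt_or_eq.1 hji with hji | rfl
    · have hne : d' ≠ d := by
        rintro rfl
        have := (mem_remaining_of_getElem? h.nodup (i := i) hd').1 hdA
        omega
      rw [Function.update_of_ne (Fin.val_ne_of_ne hne),
        Function.update_of_ne (Fin.val_ne_of_ne hne)]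
      exact h.neighbors j d' hj1 hji hd'
    · rw [hd, Option.some_inj] at hd'
      subst hd'
      exact ⟨a, b, by simp, by simp, hab⟩
  · rw [happ 0 (by omega)] at hr
    exact h.first r hr

theorem exists_lastTwo {n : ℕ} {l : List (Fin n)} (hl : l.Nodup) (h : l.length = 2) (pq : ℕ × ℕ) :
    ∃ a b : Fin n, lastTwo l pq = ((a : ℕ), (b : ℕ)) ∧ ∀ u ∈ l, u = a ∨ u = b := by
  obtain ⟨a, b, rfl⟩ := List.length_eq_two.1 h
  exact ⟨a, b, rfl, by simp⟩

namespace RealRAM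

open Instr Test

/-- Remove the next vertex of the queue. -/
def eliminateBody : Program := Program.ofList
  [block [load 14 7 10, store 8 14 13, load 15 3 14], .while (lt 20 15) scanBody,
   block [store 9 14 16, store 10 14 17, succ 10, succ 11]]

def eliminateLoop : Program := Program.ofList
  [block [const 10 1, const 11 2, const 12 2, const 13 1], .while (lt 11 0) eliminateBody]

/-- Among the remaining vertices the queue holds exactly those with at most two remaining
neighbours. Register `11` runs one ahead of the position so that the loop stops as soon as at most
two vertices are left. -/
structure EliminationInv {n : ℕ} (G : SimpleGraph (Fin n))
    (sep : Fin n → Fin n → Fin n → Fin n → Prop) (L : Fin n → List (Fin n)) (R : ℕ → ℕ → ℝ)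
    (s : State) (i : ℕ) (Q : List (Fin n)) : Prop where
  preserved : Preserved n R s
  reg_ten : s.reg 10 = i
  reg_eleven : s.reg 11 = i + 1
  reg_twelve : s.reg 12 = 2
  reg_thirteen : s.reg 13 = 1
  lists : ∀ v : Fin n, IsLinkedList (s.mem 5) (s.mem 4) (s.reg 3) (s.mem 3 v) (L v)
  queue : HoldsQueue s Q
  one_le : 1 ≤ i
  le_length : i ≤ Q.length
  removed : ∀ v : Fin n, s.mem 8 v = 0 ↔ v ∈ remaining Q i
  deg : ∀ v ∈ remaining Q i, s.mem 6 v = (nbrs G (remaining Q i) v).card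
  mem_queue : ∀ v ∈ remaining Q i, v ∈ Q ↔ (nbrs G (remaining Q i) v).card ≤ 2
  order : IsEliminationOrder G sep Q i (s.mem 9) (s.mem 10)

/-- The queue contains a vertex to be removed as long as there are at least three vertices. -/
theorem EliminationInv.exists_next {n : ℕ} {G : SimpleGraph (Fin n)}
    {sep : Fin n → Fin n → Fin n → Fin n → Prop} {L : Fin n → List (Fin n)} {R : ℕ → ℕ → ℝ}
    {s : State} {i : ℕ} {Q : List (Fin n)} (hG : IsOuterTriangulation G sep)
    (h : EliminationInv G sep L R s i Q) (hn : i + 1 < n) :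
    ∃ d, Q[i]? = some d ∧ d ∈ remaining Q i ∧ (nbrs G (remaining Q i) d).card = 2 := by
  have hl := h.le_length
  have hi := h.one_le
  have hQ := h.order.nodup
  have hcard := card_remaining hQ hi hl
  have hsat := h.order.saturated i hi le_rfl
  have h0 : Q[0]? = some Q[0] := List.getElem?_eq_getElem (by omega)
  obtain ⟨k, hkA, hkr, hk⟩ := exists_card_nbrs_le_two hG hsat (by omega)
    ((mem_remaining_of_getElem? hQ (i := i) h0).2 (Or.inl rfl))
  obtain ⟨j, hj, hjk⟩ := List.mem_iff_getElem.1 ((h.mem_queue k hkA).2 hk)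
  have hj' : Q[j]? = some k := List.getElem?_eq_some_iff.2 ⟨hj, hjk⟩
  -- The vertex `k` is in the queue, still present, and not the protected first entry, so its
  -- position is at least `i`. Hence the queue has an entry at `i`.
  have hij : i ≤ j := by
    rcases (mem_remaining_of_getElem? hQ hj').1 hkA with rfl | h
    · exact absurd hjk.symm hkr
    · exact h
  have hd : Q[i]? = some Q[i] := List.getElem?_eq_getElem (by omega)
  have hdA := (mem_remaining_of_getElem? hQ (i := i) hd).2 (Or.inr le_rfl)
  refine ⟨_, hd, hdA, le_antisymm ?_ (two_le_card_nbrs hG hsat (by omega) hdA)⟩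
  exact (h.mem_queue _ hdA).1 (List.getElem_mem _)

theorem eliminationInv_step {n : ℕ} {G : SimpleGraph (Fin n)} {E : List (Fin n × Fin n)}
    {sep : Fin n → Fin n → Fin n → Fin n → Prop} {R : ℕ → ℕ → ℝ}
    {s : State} {i : ℕ} {Q : List (Fin n)} (hG : IsOuterTriangulation G sep)
    (hE : IsEdgeList G E) (h : EliminationInv G sep (adjList E) R s i Q) (hn : i + 1 < n) :
    ∃ d ∈ remaining Q i, Reaches eliminateBody s (30 * (adjList E d).length + 11) fun s' =>
      ∃ Q', remaining Q' (i + 1) = (remaining Q i).erase d ∧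
        EliminationInv G sep (adjList E) R s' (i + 1) Q' := by
  classical
  obtain ⟨d, hd, hdA, hd2⟩ := h.exists_next hG hn
  have hsucc := remaining_succ h.one_le hd
  set A := remaining Q i with hAdef
  set c : Fin n → ℕ := fun v => (nbrs G A v).card with hc
  set s₁ := execs [load 14 7 10, store 8 14 13, load 15 3 14] s with hs₁
  have hdm : s.mem 7 i = d := h.queue.2.getElem? hd
  obtain ⟨⟨h0, h20, hR, hRR⟩, h10, h11, h12, h13, hlists, ⟨hq7, hqm⟩, hi, hl, hrem, hdeg, hmq,
    hord⟩ := h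
  have hil : i < Q.length := (List.getElem?_eq_some_iff.1 hd).1
  refine ⟨d, hdA, (reaches_block_cons (T := 30 * (adjList E d).length + 1 + 6) ?_).mono
    (by simp; omega) fun _ h => h⟩
  have hscan := scanLoop_reaches (s := s₁) (A := A.erase d) (c := c) (Q := Q) (l := adjList E d)
    (by simp [hs₁, Instr.exec, h20]) (by simp [hs₁, Instr.exec, h12]) ?_ (hE.nodup_adjList d)
    (by simpa [hs₁, Instr.exec, h10, hdm] using hlists d)
    (by simpa [hs₁, Instr.exec, HoldsQueue] using ⟨hq7, hqm⟩)
    (fun v hv => by simpa [hs₁, Instr.exec] using hdeg v (Finset.mem_of_mem_erase hv))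
  · refine hscan.seq fun s₂ hI => (reaches_block_cons (reaches_nil _)).mono (by simp) ?_
    rintro _ rfl
    set X := (adjList E d).filter fun v => v ∈ A.erase d ∧ c v = 3 with hX
    have hmemX : ∀ v, v ∈ X ↔ G.Adj d v ∧ v ∈ A.erase d ∧ c v = 3 := by
      intro v
      rw [hX, List.mem_filter, hE.mem_adjList_iff, decide_eq_true_iff]
    have hQX : (Q ++ X).Nodup := by
      refine List.nodup_append'.2 ⟨hord.nodup, (hE.nodup_adjList d).filter _, fun v hv hv' => ?_⟩
      have h1 := (hmemX v).1 hv'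
      have h2 : (nbrs G A v).card ≤ 2 := (hmq v (Finset.mem_of_mem_erase h1.2.1)).1 hv
      have h3 : (nbrs G A v).card = 3 := h1.2.2
      omega
    have hrem' : remaining (Q ++ X) (i + 1) = A.erase d := by
      rw [remaining_append X (by omega), hsucc]
    have hce : ∀ v, (nbrs G (A.erase d) v).card = c v - if G.Adj v d then 1 else 0 := by
      intro v
      convert card_nbrs_erase hdA
    -- Exactly two neighbours of `d` remain, so the two registers end up with these, whatever they
    -- held before the scan.
    obtain ⟨a, b, hab, hab'⟩ := exists_lastTwo (l := (adjList E d).filter (· ∈ A.erase d))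
      ((hE.nodup_adjList d).filter _) (by
        rw [← hd2, ← List.toFinset_card_of_nodup ((hE.nodup_adjList d).filter _)]
        congr 1
        ext u
        simp only [List.mem_toFinset, List.mem_filter, hE.mem_adjList_iff, decide_eq_true_iff,
          mem_nbrs, Finset.mem_erase]
        exact ⟨fun h => ⟨h.2.2, h.1⟩, fun h => ⟨h.2, h.2.ne', h.1⟩⟩) (s₁.reg 16, s₁.reg 17)
    have hlast := hI.last.trans hab
    rw [Prod.mk.injEq] at hlast
    have hreg := hI.reg_eq
    have hmem := hI.mem_eq
    have hr14 : s₂.reg 14 = d := by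
      rw [hreg] <;> simp [hs₁, Instr.exec, h10, hdm]
    refine ⟨Q ++ X, hrem', ⟨⟨?_, ?_, ?_, ?_⟩, ?_, ?_, ?_, ?_, ?_, ⟨?_, ?_⟩, by omega, ?_, ?_, ?_, ?_,
      ?_⟩⟩
    case refine_9 =>
      intro v
      simpa [Instr.exec, hmem, hreg, hs₁] using hlists v
    case refine_10 => exact hI.queue.1
    case refine_11 => exact hI.queue.2
    case refine_12 => rw [List.length_append]; omega
    case refine_13 =>
      intro v
      rw [hrem', Finset.mem_erase, ← hrem v]
      by_cases hvd : v = d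
      · subst hvd; simp [Instr.exec, hmem, hs₁, h13, h10, hdm]
      · simp [Instr.exec, hmem, hs₁, h10, hdm, hvd, Function.update_of_ne (Fin.val_ne_of_ne hvd)]
    case refine_14 =>
      intro v hv
      rw [hrem'] at hv ⊢
      rw [hce]
      simpa [Instr.exec, hE.mem_adjList_iff, G.adj_comm] using hI.deg v hv
    case refine_15 =>
      intro v hv
      rw [hrem'] at hv ⊢
      have hvA := hmq v (Finset.mem_of_mem_erase hv)
      rw [List.mem_append, hmemX, hce, hvA, G.adj_comm d v]
      change c v ≤ 2 ∨ _ ↔ _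
      split_ifs with hadj
      · simp only [hadj, hv, true_and]; omega
      · simp only [hadj, false_and, or_false, Nat.sub_zero]
    case refine_16 =>
      have := hord.append hG hi hd hQX hn hd2.le (a := a) (b := b) fun u hu hadj => hab' u (by
        rw [List.mem_filter, hE.mem_adjList_iff, ← hsucc]; exact ⟨hadj, by simpa using hu⟩)
      simpa [Instr.exec, hmem, hs₁, hr14, hlast.1, hlast.2] using this
    all_goals simp [Instr.exec, hI.rmem_eq, hI.rreg_eq, *]
  · intro v
    rw [Finset.mem_erase, ← hrem v]
    by_cases hvd : v = d
    · subst hvd; simp [Instr.exec, hs₁, h13, h10, hdm]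
    · simp [Instr.exec, hs₁, h10, hdm, hvd, Function.update_of_ne (Fin.val_ne_of_ne hvd)]

theorem eliminateLoop_reaches {n : ℕ} {G : SimpleGraph (Fin n)} {E : List (Fin n × Fin n)}
    {sep : Fin n → Fin n → Fin n → Fin n → Prop} {R : ℕ → ℕ → ℝ} {s : State} (hn : 0 < n)
    (hG : IsOuterTriangulation G sep) (hE : IsEdgeList G E) (h : QueueInv (adjList E) R s n) :
    Reaches eliminateLoop s (60 * E.length + 12 * n + 7) fun s' => Preserved n R s' ∧
      ∃ Q i, n ≤ i + 1 ∧ Q.length = n ∧ HoldsList (s'.mem 7) Q ∧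
        IsEliminationOrder G sep Q i (s'.mem 9) (s'.mem 10) := by
  obtain ⟨⟨h0, h20, hR, hRR⟩, hgraph, hm8, -, -, -, Q, ⟨hq7, hqm⟩, hQn, hQ⟩ := h
  have hQ' : ∀ v, v ∈ Q ↔ (nbrs G Finset.univ v).card ≤ 2 := by
    intro v
    rw [hQ, hE.length_adjList]
    exact and_iff_right v.2
  have hpos : 0 < Q.length := by
    rw [List.length_pos_iff_exists_mem]
    by_cases h3 : 3 ≤ n
    · obtain ⟨k, -, -, hk⟩ := exists_card_nbrs_le_two hG hG.saturatedOn_univ (by simpa using h3)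
        (Finset.mem_univ (⟨0, hn⟩ : Fin n))
      exact ⟨k, (hQ' k).2 hk⟩
    · refine ⟨⟨0, hn⟩, (hQ' _).2 ((Finset.card_le_univ _).trans ?_)⟩
      simp
      omega
  have hinit : EliminationInv G sep (adjList E) R
      (execs [const 10 1, const 11 2, const 12 2, const 13 1] s) 1 Q := by
    refine ⟨⟨?_, ?_, ?_, ?_⟩, ?_, ?_, ?_, ?_, ?_, ⟨?_, ?_⟩, le_rfl, hpos, ?_, ?_, ?_,
      ⟨hQn, ?_, ?_, ?_⟩⟩
    case refine_9 => intro v; simpa [Instr.exec] using (hgraph v).1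
    case refine_11 => simpa [Instr.exec] using hqm
    case refine_13 =>
      intro v _
      rw [remaining_one, ← hE.length_adjList]
      simpa [Instr.exec] using (hgraph v).2
    case refine_14 => intro v _; rw [remaining_one]; exact hQ' v
    case refine_15 =>
      intro j h1 h2
      rw [show j = 1 by omega, remaining_one]
      exact hG.saturatedOn_univ
    case refine_16 => intro j d h1 h2; omega
    case refine_17 =>
      intro r hr
      exact (hQ' r).1 (List.mem_of_getElem? hr)
    all_goals simp [Instr.exec, remaining_one, *]
  have h := Reaches.loop (c := lt 11 0) (p := eliminateBody)
    (fun (p : ℕ × List (Fin n)) s => EliminationInv G sep (adjList E) R s p.1 p.2)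
    -- Every vertex still present holds credit for one scan of its own adjacency list; the vertex
    -- deleted in a round spends it.
    (fun p => ∑ v ∈ remaining p.2 p.1, (30 * (adjList E v).length + 12)) ?_ (a := (1, Q)) hinit
  · refine (reaches_block_cons (l := [const 10 1, const 11 2, const 12 2, const 13 1])
      (reaches_singleton h)).mono ?_ ?_
    · simp only [remaining_one, Finset.sum_add_distrib, ← Finset.mul_sum, sum_length_adjList,
        Finset.sum_const, Finset.card_univ, Fintype.card_fin, smul_eq_mul, List.length_cons,
        List.length_nil]
      omega
    · rintro s' ⟨⟨i, Q'⟩, hI, hc⟩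
      have hc' : ¬ s'.reg 11 < s'.reg 0 := hc
      rw [hI.preserved.1, hI.reg_eleven, not_lt] at hc'
      refine ⟨hI.preserved, Q', i, hc', ?_, hI.queue.2, hI.order⟩
      have hcard : (remaining Q' i).card + i = n + 1 :=
        card_remaining hI.order.nodup hI.one_le hI.le_length
      -- Deleted vertices came from the queue, and the at most two remaining ones trivially have at
      -- most two neighbours, so they are queued as well.
      have hall : ∀ v, v ∈ Q' := by
        intro v
        by_cases hv : v ∈ remaining Q' i
        · refine (hI.mem_queue v hv).2 ((Finset.card_le_card fun u hu => (mem_nbrs.1 hu).1).trans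
            (?_ : (remaining Q' i).card ≤ 2))
          simp only at hc'
          omega
        · rw [mem_remaining, not_not] at hv
          exact List.mem_of_mem_take (List.mem_of_mem_drop hv)
      have h1 : Q'.toFinset = Finset.univ := by ext v; simp [hall v]
      rw [← List.toFinset_card_of_nodup hI.order.nodup, h1]
      simp
  · rintro ⟨i, Q'⟩ s' hI hc
    have hc' : s'.reg 11 < s'.reg 0 := hc
    rw [hI.preserved.1, hI.reg_eleven] at hc'
    obtain ⟨d, hd, hr⟩ := eliminationInv_step hG hE hI hc'
    refine ⟨_, hr.mono le_rfl ?_⟩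
    rintro s'' ⟨Q'', he, hI'⟩
    refine ⟨(i + 1, Q''), hI', ?_⟩
    simp only
    rw [he, ← Finset.sum_erase_add _ _ hd]
    omega

end RealRAM

/-! ## The order of insertion -/

theorem List.Nodup.eq_of_getElem? {α : Type*} {Q : List α} (hQ : Q.Nodup) {i j : ℕ} {v : α}
    (hi : Q[i]? = some v) (hj : Q[j]? = some v) : i = j := by
  obtain ⟨h, rfl⟩ := List.getElem?_eq_some_iff.1 hi
  obtain ⟨h', he⟩ := List.getElem?_eq_some_iff.1 hj
  exact (hQ.getElem_inj_iff.1 he).symm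

theorem exists_getElem?_of_length {n : ℕ} {Q : List (Fin n)} (hQ : Q.Nodup) (hl : Q.length = n)
    (v : Fin n) : ∃ j < n, Q[j]? = some v := by
  have h1 : Q.toFinset = Finset.univ := by
    rw [← Finset.card_eq_iff_eq_univ, List.toFinset_card_of_nodup hQ, hl, Fintype.card_fin]
  obtain ⟨j, hj, h⟩ := List.mem_iff_getElem.1 (List.mem_toFinset.1 (h1 ▸ Finset.mem_univ v))
  exact ⟨j, hl ▸ hj, List.getElem?_eq_some_iff.2 ⟨hj, h⟩⟩

/-- The index is one more than the initial counter `n - 2` of the reverse pass. Truncated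
subtraction makes it cover `n = 1` too, where both ends of the list coincide. -/
theorem mem_remaining_last {n : ℕ} {Q : List (Fin n)} (hQ : Q.Nodup) (hl : Q.length = n)
    {r s : Fin n} (hr : Q[0]? = some r) (hs : Q[n - 1]? = some s) (v : Fin n) :
    v ∈ remaining Q (n - 2 + 1) ↔ v = s ∨ v = r := by
  obtain ⟨j, hj, hv⟩ := exists_getElem?_of_length hQ hl v
  rw [mem_remaining_of_getElem? hQ hv]
  constructor
  · rintro h
    rcases Nat.eq_zero_or_pos j with rfl | hj0
    · exact Or.inr (Option.some_inj.1 (hv.symm.trans hr))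
    · rw [show j = n - 1 by omega] at hv
      exact Or.inl (Option.some_inj.1 (hv.symm.trans hs))
  · rintro (rfl | rfl)
    · have := hQ.eq_of_getElem? hv hs
      omega
    · have := hQ.eq_of_getElem? hv hr
      omega

/-- The vertex `d` lies between `x` and the vertex of `A` that follows `x`, and these two are its
neighbours in `A`. -/
def IsSlot {V : Type*} (G : SimpleGraph V) (θ : V → ℝ) (A : Finset V) (d x : V) : Prop :=
  ∃ y, IsNext θ A x y ∧ θ x < θ d ∧ θ d < θ y ∧ ∀ v ∈ A, G.Adj d v ↔ v = x ∨ v = y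

/-- The graph arises from the first and the last entry of `Q`, which are the extreme vertices with
respect to `θ`, by inserting the other entries, last to first. -/
structure IsInsertionOrder {n : ℕ} (G : SimpleGraph (Fin n)) (θ : Fin n → ℝ) (Q : List (Fin n))
    (par : Fin n → Fin n) : Prop where
  nodup : Q.Nodup
  length_eq : Q.length = n
  injective : Function.Injective θ
  le_first : ∀ r, Q[0]? = some r → ∀ v, θ v ≤ θ r
  slot : ∀ j d, 1 ≤ j → j + 1 < n → Q[j]? = some d → IsSlot G θ (remaining Q (j + 1)) d (par d)
  last : ∀ r s, 2 ≤ n → Q[0]? = some r → Q[n - 1]? = some s →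
    par s = r ∧ θ s < θ r ∧ G.Adj s r

section Order

variable {n : ℕ} {G : SimpleGraph (Fin n)} {sep : Fin n → Fin n → Fin n → Fin n → Prop}
  {Q : List (Fin n)} {i : ℕ} {p q : ℕ → ℕ} {r s : Fin n}

/-- Inside the last two vertices no edge other than the one in question could separate them, so
saturation makes them adjacent. -/
theorem IsEliminationOrder.adj (h : IsEliminationOrder G sep Q i p q) (hn : n ≤ i + 1)
    (hl : Q.length = n) (h2 : 2 ≤ n) (hr : Q[0]? = some r) (hs : Q[n - 1]? = some s) :
    G.Adj s r := by
  have hsr : s ≠ r := by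
    rintro rfl
    have := h.nodup.eq_of_getElem? hs hr
    omega
  have hsat := h.saturated (n - 2 + 1) (by omega) (by omega)
  have hmem := mem_remaining_last h.nodup hl hr hs
  by_contra hcon
  refine hcon (hsat s ((hmem s).2 (Or.inl rfl)) r ((hmem r).2 (Or.inr rfl)) hsr ?_)
  intro a ha b hb hab
  exfalso
  rcases (hmem a).1 ha with rfl | rfl <;> rcases (hmem b).1 hb with rfl | rfl
  · exact G.irrefl hab
  · exact hcon hab
  · exact hcon hab.symm
  · exact G.irrefl hab

/-- The protected first vertex `r` has at most two neighbours in the whole graph, so `s`, being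
adjacent to it, is its cyclic neighbour and the circle can be cut between them. With fewer than
three vertices any cut at `s` works. -/
theorem IsEliminationOrder.exists_order (hG : IsOuterTriangulation G sep)
    (h : IsEliminationOrder G sep Q i p q) (hn : n ≤ i + 1)
    (hl : Q.length = n) (hr : Q[0]? = some r) (hs : Q[n - 1]? = some s) :
    ∃ θ : Fin n → ℝ, Function.Injective θ ∧ (∀ v, θ s ≤ θ v ∧ θ v ≤ θ r) ∧
      ∀ u v a b, sep u v a b ↔ Crosses θ u v a b := by
  by_cases h3 : 3 ≤ n
  · exact exists_order_between hG (by simpa using h3) (h.adj hn hl (by omega) hr hs).symm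
      (h.first r hr)
  · obtain ⟨θ, hi, hθ, hc⟩ := hG.cut s
    refine ⟨θ, hi, fun v => ⟨hθ v, ?_⟩, hc⟩
    obtain ⟨j, hj, hv⟩ := exists_getElem?_of_length h.nodup hl v
    rcases Nat.eq_zero_or_pos j with rfl | hj0
    · rw [Option.some_inj.1 (hv.symm.trans hr)]
    · rw [show j = n - 1 by omega] at hv
      rw [Option.some_inj.1 (hv.symm.trans hs)]
      exact hθ r

end Order

namespace RealRAM

open Instr Test

/-- Insert the vertex number `reg 18` of the queue into the cyclic list of array `11`. -/
def orientBody : Program := Program.ofList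
  [block [load 14 7 18, load 16 9 14, load 17 10 14, load 6 11 16],
   .ite (eq 6 17) (block [copy 4 16, copy 5 17]) (block [copy 4 17, copy 5 16]),
   block [store 12 14 4, store 11 14 5, store 11 4 14, pred 18]]

def orientLoop : Program := Program.ofList
  [block [copy 18 0, pred 18, load 4 7 20, load 5 7 18, store 11 4 4, store 11 5 4, store 12 5 4,
    pred 18], .while (lt 20 18) orientBody]

/-- Array `11` holds successors, with the last vertex pointing to itself, and array `12` the
vertices into whose slots the inserted ones go. That links never descend in the order is what makes
the comparison of a link with the other neighbour conclusive. -/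
structure OrientationInv {n : ℕ} (G : SimpleGraph (Fin n)) (R : ℕ → ℕ → ℝ) (θ : Fin n → ℝ)
    (Q : List (Fin n)) (r t : Fin n) (p q : ℕ → ℕ) (s : State) (j : ℕ) : Prop where
  preserved : Preserved n R s
  counter : s.reg 18 = j
  le : j ≤ n - 2
  queue : HoldsList (s.mem 7) Q
  left : s.mem 9 = p
  right : s.mem 10 = q
  next : ∀ u v, IsNext θ (remaining Q (j + 1)) u v → s.mem 11 u = v
  le_next : ∀ u ∈ remaining Q (j + 1), ∃ v : Fin n, s.mem 11 u = v ∧ θ u ≤ θ v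
  slot : ∀ k d, j < k → k + 1 < n → Q[k]? = some d →
    ∃ x : Fin n, s.mem 12 d = x ∧ IsSlot G θ (remaining Q (k + 1)) d x
  last : s.mem 12 t = r

theorem orientationInv_step {n : ℕ} {G : SimpleGraph (Fin n)}
    {sep : Fin n → Fin n → Fin n → Fin n → Prop} {R : ℕ → ℕ → ℝ} {θ : Fin n → ℝ}
    {Q : List (Fin n)} {i : ℕ} {p q : ℕ → ℕ} {r t : Fin n} {s : State} {j : ℕ}
    (hord : IsEliminationOrder G sep Q i p q) (hn : n ≤ i + 1) (hl : Q.length = n)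
    (hr : Q[0]? = some r) (ht : Q[n - 1]? = some t)
    (hθi : Function.Injective θ) (hθ : ∀ v, θ t ≤ θ v ∧ θ v ≤ θ r)
    (hsep : ∀ u v a b, sep u v a b ↔ Crosses θ u v a b)
    (h : OrientationInv G R θ Q r t p q s j) (hj : 0 < j) :
    OrientationInv G R θ Q r t p q (orientBody.run s) (j - 1) := by
  obtain ⟨⟨h0, h20, hR, hRR⟩, h18, hle, hqm, hp, hq, hnext, hlenext, hslot, hlast⟩ := h
  obtain ⟨k, rfl⟩ : ∃ k, j = k + 1 := ⟨j - 1, by omega⟩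
  obtain ⟨d, hd⟩ : ∃ d, Q[k + 1]? = some d := ⟨_, List.getElem?_eq_getElem (by omega)⟩
  set A := remaining Q (k + 1 + 1) with hAdef
  have hinA : ∀ {l v}, Q[l]? = some v → (v ∈ A ↔ l = 0 ∨ k + 1 + 1 ≤ l) :=
    fun hv => mem_remaining_of_getElem? hord.nodup hv
  have hdA : d ∉ A := by rw [hinA hd]; omega
  have hins : remaining Q (k + 1) = insert d A := by
    rw [hAdef, remaining_succ (by omega) hd, Finset.insert_erase]
    exact (mem_remaining_of_getElem? hord.nodup hd).2 (Or.inr le_rfl)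
  obtain ⟨a, b, ha, hb, hab⟩ := hord.neighbors (k + 1) d (by omega) (by omega) hd
  have hsat := hord.saturated (k + 1) (by omega) (by omega)
  rw [hins] at hsat
  obtain ⟨x, y, hxy, hx, hy, hadj, hcases⟩ := exists_isNext hθi hsep hdA
    ((hinA hr).2 (Or.inl rfl)) ((hinA ht).2 (Or.inr (by omega))) hθ (by convert hsat) hab
  have hdm : s.mem 7 (k + 1) = d := hqm.getElem? hd
  have hrun : orientBody.run s = { s with
      reg := (orientBody.run s).reg
      mem := Function.update (Function.update s.mem 12 (Function.update (s.mem 12) d x)) 11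
        (Function.update (Function.update (s.mem 11) d y) x d) } ∧
      ∀ l, l ≠ 4 → l ≠ 5 → l ≠ 6 → l ≠ 14 → l ≠ 16 → l ≠ 17 →
        (orientBody.run s).reg l = if l = 18 then k else s.reg l := by
    rcases hcases with ⟨rfl, rfl⟩ | ⟨rfl, rfl⟩
    · have h1 := hnext _ _ hxy
      constructor
      · simp [orientBody, Program.ite_run, Test.Holds, Instr.exec, h18, hdm, hp, hq, ha, hb, h1]
      · intro l l1 l2 l3 l4 l5 l6
        by_cases h18' : l = 18 <;>
        simp [orientBody, Program.ite_run, Test.Holds, Instr.exec, h18, hdm, hp, hq, ha, hb, h1,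
          l1, l2, l3, l4, l5, l6, h18']
    · obtain ⟨z, hz, hz'⟩ := hlenext _ hxy.2.1
      -- If the first stored neighbour is the later one, its link cannot lead back to the earlier
      -- one, so the test fails and the two are swapped.
      have h1 : s.mem 11 y ≠ x := by
        rw [hz]
        intro h
        rw [Fin.ext h] at hz'
        exact absurd hxy.2.2.1 (not_lt.2 hz')
      constructor
      · simp [orientBody, Program.ite_run, Test.Holds, Instr.exec, h18, hdm, hp, hq, ha, hb, h1]
      · intro l l1 l2 l3 l4 l5 l6
        by_cases h18' : l = 18 <;>
        simp [orientBody, Program.ite_run, Test.Holds, Instr.exec, h18, hdm, hp, hq, ha, hb, h1,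
          l1, l2, l3, l4, l5, l6, h18']
  obtain ⟨hrun, hreg⟩ := hrun
  have hxd : x ≠ d := by rintro rfl; exact hdA hxy.1
  have hne : ∀ {u v : Fin n}, u ≠ v → (u : ℕ) ≠ v := fun h => Fin.val_ne_of_ne h
  rw [hrun]
  simp only [Nat.add_sub_cancel]
  constructor
  case preserved => exact ⟨by simp [hreg, h0], by simp [hreg, h20], hR, hRR⟩
  case counter => simp [hreg]
  case le => omega
  case queue => simpa using hqm
  case left => simpa using hp
  case right => simpa using hq
  case next =>
    intro u v huv
    rw [hins] at huv
    simp only [Function.update_self]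
    rcases hxy.of_insert hθi hdA hx hy huv with ⟨rfl, rfl⟩ | ⟨rfl, rfl⟩ | ⟨hu, hv, hux, huv⟩
    · simp
    · rw [Function.update_of_ne (hne hxd.symm), Function.update_self]
    · have hud : u ≠ d := fun h => hdA (h ▸ hu)
      rw [Function.update_of_ne (hne hux), Function.update_of_ne (hne hud)]
      exact hnext u v huv
  case le_next =>
    intro u hu
    rw [hins, Finset.mem_insert] at hu
    simp only [Function.update_self]
    by_cases hux : u = x
    · subst hux; exact ⟨d, by simp, hx.le⟩
    · rw [Function.update_of_ne (hne hux)]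
      by_cases hud : u = d
      · subst hud; exact ⟨y, by simp, hy.le⟩
      · rw [Function.update_of_ne (hne hud)]
        exact hlenext u (hu.resolve_left hud)
  case slot =>
    intro l d' hl1 hl2 hd'
    simp only [ne_eq, Nat.reduceEqDiff, not_false_eq_true,
      Function.update_of_ne, Function.update_self]
    by_cases hlk : l = k + 1
    · subst hlk
      rw [hd, Option.some_inj] at hd'
      subst hd'
      exact ⟨x, by simp, y, hxy, hx, hy, hadj⟩
    · have hne' : d' ≠ d := by
        rintro rfl
        have := hord.nodup.eq_of_getElem? hd' hd
        omega
      rw [Function.update_of_ne (hne hne')]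
      exact hslot l d' (by omega) hl2 hd'
  case last =>
    have htd : t ≠ d := by rintro rfl; exact hdA ((hinA ht).2 (Or.inr (by omega)))
    simp [Function.update_of_ne (hne htd), hlast]

theorem orientLoop_reaches {n : ℕ} {G : SimpleGraph (Fin n)}
    {sep : Fin n → Fin n → Fin n → Fin n → Prop} {R : ℕ → ℕ → ℝ}
    {Q : List (Fin n)} {i : ℕ} {s : State} (hG : IsOuterTriangulation G sep) (hpos : 0 < n)
    (hpre : Preserved n R s) (hqm : HoldsList (s.mem 7) Q)
    (hord : IsEliminationOrder G sep Q i (s.mem 9) (s.mem 10)) (hn : n ≤ i + 1)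
    (hl : Q.length = n) :
    Reaches orientLoop s (20 * n + 11) fun s' => Preserved n R s' ∧ HoldsList (s'.mem 7) Q ∧
      ∃ θ par, IsInsertionOrder G θ Q par ∧
        ∀ j (d : Fin n), 1 ≤ j → Q[j]? = some d → s'.mem 12 d = par d := by
  obtain ⟨r, hr⟩ : ∃ d, Q[0]? = some d := ⟨_, List.getElem?_eq_getElem (by omega)⟩
  obtain ⟨t, ht⟩ : ∃ d, Q[n - 1]? = some d := ⟨_, List.getElem?_eq_getElem (by omega)⟩
  obtain ⟨θ, hθi, hθ, hsep⟩ := hord.exists_order hG hn hl hr ht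
  obtain ⟨h0, h20, hR, hRR⟩ := hpre
  have hrm := hqm.getElem? hr
  have htm := hqm.getElem? ht
  have hlast := mem_remaining_last hord.nodup hl hr ht
  have hinit : OrientationInv G R θ Q r t (s.mem 9) (s.mem 10) (execs [copy 18 0, pred 18,
      load 4 7 20, load 5 7 18, store 11 4 4, store 11 5 4, store 12 5 4, pred 18] s) (n - 2) := by
    have h11 : ∀ u, u = t ∨ u = r →
        Function.update (Function.update (s.mem 11) r (r : ℕ)) t (r : ℕ) (u : Fin n) = r := by
      rintro u (rfl | rfl)
      · simp
      · by_cases h : (u : ℕ) = t <;> simp [h]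
    constructor
    case preserved => exact ⟨by simp [Instr.exec, h0], by simp [Instr.exec, h20], hR, hRR⟩
    case queue => simpa [Instr.exec] using hqm
    case next =>
      intro u v huv
      have hu := (hlast u).1 huv.1
      have hv : v = r := by
        rcases (hlast v).1 huv.2.1 with rfl | rfl
        · exact absurd huv.2.2.1 (not_lt.2 (hθ u).1)
        · rfl
      simpa [Instr.exec, h20, h0, hrm, htm, hv] using h11 u hu
    case le_next =>
      intro u hu
      refine ⟨r, ?_, (hθ u).2⟩
      simpa [Instr.exec, h20, h0, hrm, htm] using h11 u ((hlast u).1 hu)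
    case slot => intro k d h1 h2; omega
    all_goals simp [Instr.exec, h20, h0, hrm, htm, Nat.sub_sub]
  have h := Reaches.loop (c := lt 20 18) (p := orientBody)
    (fun j s' => OrientationInv G R θ Q r t (s.mem 9) (s.mem 10) s' j) (fun j => 20 * j) ?_ hinit
  · refine (reaches_block_cons (l := [copy 18 0, pred 18, load 4 7 20, load 5 7 18, store 11 4 4,
      store 11 5 4, store 12 5 4, pred 18]) (reaches_singleton h)).mono (by simp; omega) ?_
    rintro s' ⟨j, hI, hc⟩
    have hc' : ¬ s'.reg 20 < s'.reg 18 := hc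
    rw [hI.counter, hI.preserved.2.1] at hc'
    obtain rfl : j = 0 := by omega
    have hpar : ∀ d, ∃ x : Fin n, ∀ j : ℕ, 1 ≤ j → Q[j]? = some d → s'.mem 12 d = x := by
      intro d
      obtain ⟨j, hj, hd⟩ := exists_getElem?_of_length hord.nodup hl d
      have huniq : ∀ j', Q[j']? = some d → j = j' := fun j' hd' =>
        hord.nodup.eq_of_getElem? hd hd'
      by_cases hj1 : 1 ≤ j
      · by_cases hj2 : j + 1 < n
        · obtain ⟨x, hx, -⟩ := hI.slot j d hj1 hj2 hd
          exact ⟨x, fun _ _ _ => hx⟩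
        · rw [show j = n - 1 by omega, ht, Option.some_inj] at hd
          exact ⟨r, fun _ _ _ => hd ▸ hI.last⟩
      · exact ⟨r, fun j' hj' hd' => absurd (huniq j' hd') (by omega)⟩
    choose par hpar using hpar
    refine ⟨hI.preserved, hI.queue, θ, par, ⟨hord.nodup, hl, hθi, ?_, ?_, ?_⟩,
      fun j d hj hd => hpar d j hj hd⟩
    · intro r' hr' v
      rw [hr, Option.some_inj] at hr'
      exact hr' ▸ (hθ v).2
    · intro j d hj hj2 hd
      obtain ⟨x, hx, hx'⟩ := hI.slot j d hj hj2 hd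
      rwa [show par d = x from Fin.ext ((hpar d j hj hd).symm.trans hx)]
    · intro r' t' h2 hr' ht'
      rw [hr, Option.some_inj] at hr'
      rw [ht, Option.some_inj] at ht'
      subst hr' ht'
      have hadj := hord.adj hn hl h2 hr ht
      exact ⟨Fin.ext ((hpar t (n - 1) (by omega) ht).symm.trans hI.last),
        lt_of_le_of_ne (hθ r).1 (hθi.ne hadj.ne), hadj⟩
  · intro j s' hI hc
    have hc' : s'.reg 20 < s'.reg 18 := hc
    rw [hI.counter, hI.preserved.2.1] at hc'
    refine ⟨_, Program.LoopFree.reaches ?_ ⟨j - 1, orientationInv_step hord hn hl hr ht hθi hθ hsep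
      hI hc', ?_⟩⟩
    · simp [orientBody, Program.ofList, Program.LoopFree]
    · simp [orientBody, Program.ofList, Program.cost]
      omega

end RealRAM

/-! ## Weights of the slots -/

/-- The total weight of the vertices that are still to be inserted next to a vertex, when the
vertices in `l` are. -/
noncomputable def slotWeight {V : Type*} [DecidableEq V] (w : V → ℝ) (par : V → V) (l : List V) :
    V → ℝ :=
  l.foldl (fun S d => Function.update S (par d) (S (par d) + (w d + S d))) fun _ => 0

section SlotWeight

variable {V : Type*} [DecidableEq V] {w : V → ℝ} {par : V → V} {l : List V}

/-- Read backwards this is a layout step: placing `d` takes `w d` for its cell and the slot weight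
of `d` for its notch from the slot of its parent. -/
theorem slotWeight_append (l : List V) (d : V) : slotWeight w par (l ++ [d]) =
    Function.update (slotWeight w par l) (par d)
      (slotWeight w par l (par d) + (w d + slotWeight w par l d)) := by
  simp [slotWeight]

theorem slotWeight_nonneg (hw : ∀ v, 0 < w v) (v : V) : 0 ≤ slotWeight w par l v := by
  induction l using List.reverseRecOn generalizing v with
  | nil => simp [slotWeight]
  | append_singleton l d ih =>
    rw [slotWeight_append, Function.update_apply]
    split_ifs
    · have := hw d; have := ih d; have := ih (par d); linarith
    · exact ih v

theorem slotWeight_eq_zero {v : V} (h : ∀ d ∈ l, par d ≠ v) : slotWeight w par l v = 0 := by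
  induction l using List.reverseRecOn with
  | nil => simp [slotWeight]
  | append_singleton l d ih =>
    rw [slotWeight_append, Function.update_of_ne (h d (by simp)).symm]
    exact ih fun d hd => h d (by simp [hd])

end SlotWeight

/-- The entries of `Q` before the `j`-th, without the very first. -/
def removed {n : ℕ} (Q : List (Fin n)) (j : ℕ) : List (Fin n) := (Q.take j).drop 1

theorem removed_succ {n : ℕ} {Q : List (Fin n)} {j : ℕ} {d : Fin n} (hj : 1 ≤ j)
    (hd : Q[j]? = some d) : removed Q (j + 1) = removed Q j ++ [d] := by
  obtain ⟨h, rfl⟩ := List.getElem?_eq_some_iff.1 hd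
  rw [removed, List.take_succ_eq_append_getElem h, List.drop_append_of_le_length
    (by rw [List.length_take]; omega), removed]

theorem exists_of_mem_removed {n : ℕ} {Q : List (Fin n)} {j : ℕ} {d : Fin n}
    (h : d ∈ removed Q j) : ∃ k, 1 ≤ k ∧ k < j ∧ Q[k]? = some d := by
  obtain ⟨k, hk, rfl⟩ := List.mem_iff_getElem.1 h
  simp only [removed, List.length_drop, List.length_take] at hk
  refine ⟨1 + k, by omega, by omega, ?_⟩
  rw [List.getElem?_eq_getElem (by omega)]
  simp [removed, add_comm]

/-! ## The layout step by step -/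

/-- The layout of the first entry of `Q` and those from the `j + 1`-th on. -/
def IsPartialLayout {n : ℕ} (G : SimpleGraph (Fin n)) (θ w : Fin n → ℝ) (Q : List (Fin n))
    (r : Fin n) (j : ℕ) (P : Fin n → Set (ℝ × ℝ)) (L B S : Fin n → ℝ) : Prop :=
  (j + 1 = n ∧ P r = cell 0 0 (w r) 0 ∧ L r = 0 ∧ B r = w r) ∨
    (j + 1 < n ∧ ∃ T, IsLayout G θ (remaining Q (j + 1)) P L B S T)

/-- The recursion for the slot weights provides the area needed for `d`. The second vertex to be
placed obeys the same formulas as all later ones, because its parent is `r` and the slot data of `r`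
describe the left end of its upper side. -/
theorem IsInsertionOrder.partialLayout_insert {n : ℕ} {G : SimpleGraph (Fin n)} {θ w : Fin n → ℝ}
    {Q : List (Fin n)} {par : Fin n → Fin n} {r d : Fin n} {j : ℕ} {P : Fin n → Set (ℝ × ℝ)}
    {L B S : Fin n → ℝ} (h : IsInsertionOrder G θ Q par) (hw : ∀ v, 0 < w v)
    (hr : Q[0]? = some r) (hd : Q[j + 1]? = some d)
    (hS : S = slotWeight w par (removed Q (j + 2)))
    (hP : IsPartialLayout G θ w Q r (j + 1) P L B S) :
    L (par d) < 1 ∧ par d ≠ d ∧ remaining Q (j + 1) = insert d (remaining Q (j + 2)) ∧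
    d ∉ remaining Q (j + 2) ∧ 0 ≤ S d ∧
    Function.update S (par d) (S (par d) - (w d + S d)) = slotWeight w par (removed Q (j + 1)) ∧
    IsPartialLayout G θ w Q r j
      (Function.update P d (cell (L (par d)) (B (par d)) (w d) (S d)))
      (Function.update L d (notchLeft (L (par d)) (w d) (S d)))
      (Function.update (Function.update B (par d) (cellTop (L (par d)) (B (par d)) (w d) (S d))) d
        (B (par d))) (Function.update S (par d) (S (par d) - (w d + S d))) := by
  have hjn : j + 1 < n := h.length_eq ▸ (List.getElem?_eq_some_iff.1 hd).1
  have hSd : 0 ≤ S d := hS ▸ slotWeight_nonneg hw d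
  have hdA : d ∉ remaining Q (j + 2) := by
    rw [mem_remaining_of_getElem? h.nodup hd]; omega
  have hins : remaining Q (j + 1) = insert d (remaining Q (j + 2)) := by
    rw [show j + 2 = j + 1 + 1 from rfl, remaining_succ (by omega) hd, Finset.insert_erase]
    exact (mem_remaining_of_getElem? h.nodup hd).2 (Or.inr le_rfl)
  rw [removed_succ (by omega) hd, slotWeight_append] at hS
  have hS' : par d ≠ d →
      Function.update S (par d) (S (par d) - (w d + S d)) = slotWeight w par (removed Q (j + 1)) := by
    intro hne
    rw [hS]
    simp [Function.update_of_ne hne.symm]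
  have hparr : ∀ k, 1 ≤ k → k + 1 < n → ∀ e, Q[k]? = some e → par e ≠ r := by
    rintro k hk1 hk2 e he rfl
    obtain ⟨y, hy, -⟩ := h.slot k e hk1 hk2 he
    exact absurd hy.2.2.1 (not_lt.2 (h.le_first _ hr y))
  rcases hP with ⟨hj, hPr, hLr, hBr⟩ | ⟨hj, T, hl⟩
  · obtain ⟨hpd, hθd, hadj⟩ := h.last r d (by omega) hr (by rwa [show n - 1 = j + 1 by omega])
    have hne : par d ≠ d := hpd ▸ hadj.ne'
    have hdr : d ≠ r := hpd ▸ hne.symm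
    refine ⟨by rw [hpd, hLr]; exact zero_lt_one, hne, hins, hdA, hSd, hS' hne, Or.inr ⟨by omega, ?_⟩⟩
    have hA : remaining Q (j + 1) = insert d {r} := by
      ext v
      rw [show j = n - 2 by omega, mem_remaining_last h.nodup h.length_eq hr (by rwa [show n - 1 = j + 1 by omega])]
      simp
    have hSr : slotWeight w par (removed Q (j + 1)) r = 0 := by
      refine slotWeight_eq_zero fun e he => ?_
      obtain ⟨k, hk1, hk2, hk⟩ := exists_of_mem_removed he
      exact hparr k hk1 (by omega) e hk
    rw [hA]
    refine ⟨_, isLayout_pair (hw r) (hw d) hθd hadj ?_ ?_ ?_ ?_ ?_ ?_⟩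
    · rw [Function.update_of_ne hdr.symm, hPr]
    · rw [Function.update_self, Function.update_of_ne hne.symm, hpd, hLr, hBr]
    · rw [Function.update_self, Function.update_of_ne hne.symm, hpd, hLr]
    · rw [Function.update_self, hpd, hBr]
    · rw [hS' hne, hSr]
    · rwa [Function.update_of_ne hne.symm]
  · obtain ⟨y, hy, hy1, hy2, hadj⟩ := h.slot (j + 1) d (by omega) hj hd
    have hne : par d ≠ d := by rintro he; rw [he] at hy1; exact lt_irrefl _ hy1
    have hle : w d + S d ≤ S (par d) := by
      rw [hS, Function.update_self, Function.update_of_ne hne.symm]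
      have := slotWeight_nonneg (par := par) (l := removed Q (j + 1)) hw (par d)
      linarith
    refine ⟨hl.left_lt _ hy.1 ?_, hne, hins, hdA, hSd, hS' hne, Or.inr ⟨by omega, T, ?_⟩⟩
    · have := hw d; linarith
    · rw [hins]
      exact hl.insert h.injective hdA hy hy1 hy2 hadj (hw d) hSd hle

/-! ## The corners in the memory -/

namespace RealRAM

open Instr Test

/-- At most six corners occupy the real arrays `1` to `12`, so later writes elsewhere do no harm.
The number of corners is part of the type, hence the generalisation over it in `key`. -/
theorem isPolygonOf_output_congr {s s' : State} {v : ℕ} {K : Set (ℝ × ℝ)}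
    (h2 : s'.mem 2 v = s.mem 2 v) (hr : ∀ m, 1 ≤ m → m < 13 → s'.rmem m v = s.rmem m v)
    (h : IsPolygonOf (output s v) K) : IsPolygonOf (output s' v) K := by
  have key : ∀ k (P : Polygon (ℝ × ℝ) k), s'.mem 2 v = k →
      (∀ j : Fin k, P j = (s'.rmem (2 * j + 1) v, s'.rmem (2 * j + 2) v)) → IsPolygonOf P K →
      IsPolygonOf (output s' v) K := by
    rintro k ⟨f⟩ rfl hP hK
    obtain rfl : f = _ := funext hP
    exact hK
  refine key _ _ h2 (fun j => ?_) h
  have hj := j.2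
  have := h.sides
  rw [hr _ (by omega) (by omega), hr _ (by omega) (by omega)]
  rfl

theorem isPolygonOf_output_hexagon {s : State} {v : ℕ} {l m b h t : ℝ} (hl : l < m) (hm : m < 1)
    (hb : b < h) (ht : h < t) (h2 : s.mem 2 v = 6)
    (hr : (fun j => s.rmem (j + 1) v) ∘ ((↑) : Fin 12 → ℕ) = ![l, b, m, b, m, h, 1, h, 1, t, l, t]) :
    IsPolygonOf (output s v) (lShape l m b h t) := by
  have key : ∀ k (P : Polygon (ℝ × ℝ) k), k = 6 →
      (∀ j : Fin k, P j = (s.rmem (2 * j + 1) v, s.rmem (2 * j + 2) v)) →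
      IsPolygonOf P (lShape l m b h t) := by
    rintro k P rfl hP
    refine isPolygonOf_hexagon hl hm hb ht P ?_ ?_ ?_ ?_ ?_ ?_ <;> rw [hP, Prod.mk.injEq]
    · exact ⟨congr_fun hr 0, congr_fun hr 1⟩
    · exact ⟨congr_fun hr 2, congr_fun hr 3⟩
    · exact ⟨congr_fun hr 4, congr_fun hr 5⟩
    · exact ⟨congr_fun hr 6, congr_fun hr 7⟩
    · exact ⟨congr_fun hr 8, congr_fun hr 9⟩
    · exact ⟨congr_fun hr 10, congr_fun hr 11⟩
  exact key _ _ h2 fun j => rfl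

theorem isPolygonOf_output_rectangle {s : State} {v : ℕ} {l b h t : ℝ} (hl : l < 1) (ht : b < t)
    (h2 : s.mem 2 v = 4)
    (hr : (fun j => s.rmem (j + 1) v) ∘ ((↑) : Fin 8 → ℕ) = ![l, b, 1, b, 1, t, l, t]) :
    IsPolygonOf (output s v) (lShape l 1 b h t) := by
  have key : ∀ k (P : Polygon (ℝ × ℝ) k), k = 4 →
      (∀ j : Fin k, P j = (s.rmem (2 * j + 1) v, s.rmem (2 * j + 2) v)) →
      IsPolygonOf P (lShape l 1 b h t) := by
    rintro k P rfl hP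
    refine isPolygonOf_rectangle hl ht P ?_ ?_ ?_ ?_ <;> rw [hP, Prod.mk.injEq]
    · exact ⟨congr_fun hr 0, congr_fun hr 1⟩
    · exact ⟨congr_fun hr 2, congr_fun hr 3⟩
    · exact ⟨congr_fun hr 4, congr_fun hr 5⟩
    · exact ⟨congr_fun hr 6, congr_fun hr 7⟩
  exact key _ _ h2 fun j => rfl

/-- The parts of the state on which the last two phases depend. -/
structure HoldsOrder {n : ℕ} (Q : List (Fin n)) (par : Fin n → Fin n) (w : Fin n → ℝ)
    (s : State) : Prop where
  size : s.reg 0 = n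
  zero : s.reg 20 = 0
  rzero : s.rreg 4 = 0
  queue : HoldsList (s.mem 7) Q
  parent : ∀ (j : ℕ) (d : Fin n), 1 ≤ j → Q[j]? = some d → s.mem 12 d = par d
  weight : ∀ v : Fin n, s.rmem 0 v = w v

/-- Add the weight of the slot of the next vertex to its parent. -/
def weightBody : Program := block
  [load 14 7 18, load 4 12 14, rload 0 0 14, rload 1 13 14, rload 2 13 4, radd 0 0 1, radd 2 2 0,
   rstore 13 4 2, succ 18]

def weightLoop : Program := Program.ofList
  [block [const 18 1], .while (lt 18 0) weightBody]

theorem update_comp_val {α : Type*} {n : ℕ} (f : ℕ → α) (d : Fin n) (a : α) :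
    (fun v : Fin n => Function.update f d a v) = Function.update (fun v : Fin n => f v) d a := by
  funext v
  by_cases h : v = d
  · subst h; simp
  · rw [Function.update_of_ne h, Function.update_of_ne (Fin.val_ne_of_ne h)]

theorem weightLoop_reaches {n : ℕ} {Q : List (Fin n)} {par : Fin n → Fin n} {w : Fin n → ℝ}
    {s : State} (hn : 0 < n) (hl : Q.length = n) (h : HoldsOrder Q par w s)
    (h13 : s.rmem 13 = fun _ => 0) :
    Reaches weightLoop s (12 * n + 4) fun s' => HoldsOrder Q par w s' ∧
      (fun v : Fin n => s'.rmem 13 v) = slotWeight w par (removed Q n) := by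
  have h := Reaches.loop (c := lt 18 0) (p := weightBody)
    (fun j s' => HoldsOrder Q par w s' ∧ s'.reg 18 = j ∧ 1 ≤ j ∧ j ≤ n ∧
      (fun v : Fin n => s'.rmem 13 v) = slotWeight w par (removed Q j))
    (fun j => 12 * (n - j)) ?_ (a := 1) (s := execs [const 18 1] s) ?_
  · refine (reaches_block_cons (l := [const 18 1]) (reaches_singleton h)).mono (by simp; omega) ?_
    rintro s' ⟨j, ⟨hI, h18, -, hj, hS⟩, hc⟩
    have hc' : ¬ s'.reg 18 < s'.reg 0 := hc
    rw [h18, hI.size] at hc'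
    obtain rfl : j = n := by omega
    exact ⟨hI, hS⟩
  · rintro j s' ⟨⟨h0, h20, hr4, hqm, hpar, hwm⟩, h18, hj1, hjn, hS⟩ hc
    have hc' : s'.reg 18 < s'.reg 0 := hc
    rw [h18, h0] at hc'
    obtain ⟨d, hd⟩ : ∃ d, Q[j]? = some d := ⟨_, List.getElem?_eq_getElem (by omega)⟩
    have hdm := hqm.getElem? hd
    have hpd := hpar j d hj1 hd
    have hSv : ∀ v : Fin n, s'.rmem 13 v = slotWeight w par (removed Q j) v := congr_fun hS
    refine ⟨_, (block_loopFree _).reaches ⟨j + 1, ⟨⟨?_, ?_, ?_, ?_, ?_, ?_⟩, ?_, ?_, ?_, ?_⟩, ?_⟩⟩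
    case refine_4 => simpa [Instr.exec] using hqm
    case refine_5 => simpa [Instr.exec] using hpar
    case refine_10 =>
      rw [removed_succ hj1 hd, slotWeight_append, ← hS]
      simp [Instr.exec, h18, hdm, hpd, hwm, update_comp_val]
    case refine_11 => simp; omega
    all_goals simp [Instr.exec, *]
  · refine ⟨⟨?_, ?_, ?_, ?_, ?_, ?_⟩, ?_, le_rfl, hn, ?_⟩
    case refine_4 => simpa [Instr.exec] using h.queue
    case refine_5 => simpa [Instr.exec] using h.parent
    case refine_8 =>
      have : removed Q 1 = [] := List.drop_eq_nil_iff.2 (by simp)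
      rw [this]
      funext v
      simp [Instr.exec, h13, slotWeight]
    all_goals simp [Instr.exec, h.size, h.zero, h.rzero, h.weight]

end RealRAM

/-! ### Placing the polygons -/

namespace RealRAM

open Instr Test

/-- The coordinates of the corners of the next polygon, from the slot of the parent. -/
def coordinates : List Instr :=
  [load 14 7 18, load 4 12 14, rload 0 0 14, rload 1 13 14, rload 6 14 4, rload 7 15 4,
   rload 2 13 4, rsub 8 3 6, rdiv 9 0 5, radd 9 1 9, radd 10 0 1, rdiv 11 10 8, radd 11 7 11,
   rdiv 12 9 8, radd 12 7 12, rmul 13 8 1, rdiv 13 13 9, rsub 13 3 13, rsub 2 2 10]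

/-- Update the slots. -/
def updateSlots : List Instr :=
  [rstore 13 4 2, rstore 15 4 11, rstore 14 14 13, rstore 15 14 7]

def drawHexagon : List Instr :=
  [const 6 6, store 2 14 6, rstore 1 14 6, rstore 2 14 7, rstore 3 14 13, rstore 4 14 7,
   rstore 5 14 13, rstore 6 14 12, rstore 7 14 3, rstore 8 14 12, rstore 9 14 3, rstore 10 14 11,
   rstore 11 14 6, rstore 12 14 11]

def drawRectangle : List Instr :=
  [const 6 4, store 2 14 6, rstore 1 14 6, rstore 2 14 7, rstore 3 14 3, rstore 4 14 7,
   rstore 5 14 3, rstore 6 14 11, rstore 7 14 6, rstore 8 14 11]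

/-- Place the vertex number `reg 18` of the queue. -/
def layoutBody : Program := Program.ofList
  [block (coordinates ++ updateSlots), .ite (rlt 4 1) (block drawHexagon) (block drawRectangle),
   block [pred 18]]

/-- Place the first vertex of the queue. -/
def initLayout : List Instr :=
  [load 4 7 20, rconst 3 1, rconst 5 2, rload 0 0 4, const 6 4, store 2 4 6, rstore 1 4 4,
   rstore 2 4 4, rstore 3 4 3, rstore 4 4 4, rstore 5 4 3, rstore 6 4 0, rstore 7 4 4, rstore 8 4 0,
   rstore 14 4 4, rstore 15 4 0, copy 18 0, pred 18]

def layoutLoop : Program := Program.ofList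
  [block initLayout, .while (lt 20 18) layoutBody]

structure LayoutInv {n : ℕ} (G : SimpleGraph (Fin n)) (θ w : Fin n → ℝ) (Q : List (Fin n))
    (par : Fin n → Fin n) (r : Fin n) (s : State) (j : ℕ) (P : Fin n → Set (ℝ × ℝ)) : Prop where
  order : HoldsOrder Q par w s
  counter : s.reg 18 = j
  lt : j < n
  one : s.rreg 3 = 1
  two : s.rreg 5 = 2
  slot : (fun v : Fin n => s.rmem 13 v) = slotWeight w par (removed Q (j + 1))
  layout : IsPartialLayout G θ w Q r j P (fun v => s.rmem 14 v) (fun v => s.rmem 15 v)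
    (fun v => s.rmem 13 v)
  drawn : ∀ v ∈ remaining Q (j + 1), IsPolygonOf (output s v) (P v) ∧
    MeasureTheory.volume (P v) = ENNReal.ofReal (w v)

theorem execs_append (l l' : List Instr) (s : State) :
    execs (l ++ l') s = execs l' (execs l s) := by
  induction l generalizing s with
  | nil => rfl
  | cons o l ih => exact ih _

theorem execs_coordinates {s : State} {j d x : ℕ} {W σ l b S : ℝ} (h18 : s.reg 18 = j)
    (hd : s.mem 7 j = d) (hx : s.mem 12 d = x) (h3 : s.rreg 3 = 1) (h5 : s.rreg 5 = 2)
    (hW : s.rmem 0 d = W) (hσ : s.rmem 13 d = σ) (hl : s.rmem 14 x = l) (hb : s.rmem 15 x = b)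
    (hS : s.rmem 13 x = S) :
    ∃ f g, execs coordinates s = { s with reg := f, rreg := g } ∧ f 14 = d ∧ f 4 = x ∧
      (∀ i, i ≠ 14 → i ≠ 4 → f i = s.reg i) ∧ g 3 = 1 ∧ g 5 = 2 ∧ g 4 = s.rreg 4 ∧ g 1 = σ ∧
      g 2 = S - (W + σ) ∧ g 6 = l ∧ g 7 = b ∧ g 11 = cellTop l b W σ ∧ g 12 = notchTop l b W σ ∧
      g 13 = notchLeft l W σ := by
  refine ⟨(execs coordinates s).reg, (execs coordinates s).rreg, ?_, ?_, ?_, ?_, ?_, ?_, ?_, ?_, ?_,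
    ?_, ?_, ?_, ?_, ?_⟩
  case refine_4 => intro i h1 h2; simp [coordinates, Instr.exec, h1, h2]
  all_goals simp [coordinates, Instr.exec, cellTop, notchTop, notchLeft, *]

theorem layoutBody_run {s : State} {j d x : ℕ} {W σ l b S : ℝ} (h18 : s.reg 18 = j)
    (hd : s.mem 7 j = d) (hx : s.mem 12 d = x) (h3 : s.rreg 3 = 1) (h5 : s.rreg 5 = 2)
    (h4 : s.rreg 4 = 0) (hW : s.rmem 0 d = W) (hσ : s.rmem 13 d = σ) (hl : s.rmem 14 x = l)
    (hb : s.rmem 15 x = b) (hS : s.rmem 13 x = S) (hl1 : l < 1) (hWpos : 0 < W) (hσ0 : 0 ≤ σ) :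
    let s' := layoutBody.run s
    (∀ i, i ≠ 14 → i ≠ 4 → i ≠ 6 → i ≠ 18 → s'.reg i = s.reg i) ∧ s'.reg 18 = j - 1 ∧
    s'.rreg 3 = 1 ∧ s'.rreg 5 = 2 ∧ s'.rreg 4 = 0 ∧
    (∀ m, m ≠ 2 → s'.mem m = s.mem m) ∧ (∀ v, v ≠ d → s'.mem 2 v = s.mem 2 v) ∧
    s'.rmem 0 = s.rmem 0 ∧
    s'.rmem 13 = Function.update (s.rmem 13) x (S - (W + σ)) ∧
    s'.rmem 14 = Function.update (s.rmem 14) d (notchLeft l W σ) ∧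
    s'.rmem 15 = Function.update (Function.update (s.rmem 15) x (cellTop l b W σ)) d b ∧
    (∀ v, v ≠ d → ∀ m, 1 ≤ m → m < 13 → s'.rmem m v = s.rmem m v) ∧
    IsPolygonOf (output s' d) (cell l b W σ) := by
  obtain ⟨f, g, hs, hf14, hf4, hf, g3, g5, g4, g1, g2, g6, g7, g11, g12, g13⟩ :=
    execs_coordinates h18 hd hx h3 h5 hW hσ hl hb hS
  rw [h4] at g4
  rcases hσ0.eq_or_lt with hσ0 | hσ0
  -- Without weight left for the slot of `d`, the notch degenerates to the right side and four
  -- corners are written.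
  · have hrun : layoutBody.run s = execs (updateSlots ++ drawRectangle ++ [pred 18])
        { s with reg := f, rreg := g } := by
      simp only [layoutBody, Program.ofList_cons_run, block_run, execs_append, hs, Program.ite_run,
        Program.ofList_nil_run]
      rw [if_neg]
      simp [updateSlots, Test.Holds, Instr.exec, g4, g1, ← hσ0]
    intro s'
    have hs' : s' = execs (updateSlots ++ drawRectangle ++ [pred 18])
        { s with reg := f, rreg := g } := hrun
    clear_value s'
    subst hs'
    refine ⟨?_, ?_, ?_, ?_, ?_, ?_, ?_, ?_, ?_, ?_, ?_, ?_, ?_⟩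
    case refine_1 =>
      intro i h1 h2 h3 h4
      simp [updateSlots, drawRectangle, Instr.exec, h1, h2, h3, h4, hf]
    case refine_6 => intro m hm; simp [updateSlots, drawRectangle, Instr.exec, hm]
    case refine_7 => intro v hv; simp [updateSlots, drawRectangle, Instr.exec, hv, hf14]
    case refine_12 =>
      intro v hv m h1 h2
      interval_cases m <;> simp [updateSlots, drawRectangle, Instr.exec, hv, hf14]
    case refine_13 =>
      rw [cell, ← hσ0, notchLeft_zero]
      refine isPolygonOf_output_rectangle hl1
        ((lt_notchTop hl1 hWpos le_rfl).trans (notchTop_lt hl1 hWpos)) ?_ ?_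
      · simp [updateSlots, drawRectangle, Instr.exec, hf14]
      · funext i
        fin_cases i <;> simp [updateSlots, drawRectangle, Instr.exec, hf14, g3, g6, g7, g11, hσ0]
    all_goals simp [updateSlots, drawRectangle, Instr.exec, *]
  · have hrun : layoutBody.run s = execs (updateSlots ++ drawHexagon ++ [pred 18])
        { s with reg := f, rreg := g } := by
      simp only [layoutBody, Program.ofList_cons_run, block_run, execs_append, hs, Program.ite_run,
        Program.ofList_nil_run]
      rw [if_pos]
      simp [updateSlots, Test.Holds, Instr.exec, g4, g1, hσ0]
    intro s'
    have hs' : s' = execs (updateSlots ++ drawHexagon ++ [pred 18])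
        { s with reg := f, rreg := g } := hrun
    clear_value s'
    subst hs'
    refine ⟨?_, ?_, ?_, ?_, ?_, ?_, ?_, ?_, ?_, ?_, ?_, ?_, ?_⟩
    case refine_1 =>
      intro i h1 h2 h3 h4
      simp [updateSlots, drawHexagon, Instr.exec, h1, h2, h3, h4, hf]
    case refine_6 => intro m hm; simp [updateSlots, drawHexagon, Instr.exec, hm]
    case refine_7 => intro v hv; simp [updateSlots, drawHexagon, Instr.exec, hv, hf14]
    case refine_12 =>
      intro v hv m h1 h2
      interval_cases m <;> simp [updateSlots, drawHexagon, Instr.exec, hv, hf14]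
    case refine_13 =>
      refine isPolygonOf_output_hexagon (lt_notchLeft hl1 hWpos hσ0.le)
        (notchLeft_lt hl1 hWpos hσ0) (lt_notchTop hl1 hWpos hσ0.le) (notchTop_lt hl1 hWpos) ?_ ?_
      · simp [updateSlots, drawHexagon, Instr.exec, hf14]
      · funext i
        fin_cases i <;>
          simp [updateSlots, drawHexagon, Instr.exec, hf14, g3, g6, g7, g11, g12, g13]
    all_goals simp [updateSlots, drawHexagon, Instr.exec, *]

theorem layoutInv_step {n : ℕ} {G : SimpleGraph (Fin n)} {θ w : Fin n → ℝ} {Q : List (Fin n)}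
    {par : Fin n → Fin n} {r : Fin n} {s : State} {j : ℕ} {P : Fin n → Set (ℝ × ℝ)}
    (hord : IsInsertionOrder G θ Q par) (hw : ∀ v, 0 < w v) (hr : Q[0]? = some r)
    (h : LayoutInv G θ w Q par r s (j + 1) P) :
    ∃ P', LayoutInv G θ w Q par r (layoutBody.run s) j P' := by
  obtain ⟨⟨h0, h20, h4, hqm, hpar, hwm⟩, h18, hlt, h3, h5, hS, hP, hdrawn⟩ := h
  obtain ⟨d, hd⟩ : ∃ d, Q[j + 1]? = some d :=
    ⟨_, List.getElem?_eq_getElem (by rw [hord.length_eq]; exact hlt)⟩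
  obtain ⟨hl1, hne, hins, hdA, hSd, hS', hP'⟩ := hord.partialLayout_insert hw hr hd hS hP
  obtain ⟨r1, r2, r3, r4, r5, r6, r7, r8, r9, r10, r11, r12, r13⟩ :=
    layoutBody_run h18 (hqm.getElem? hd) (hpar _ d (by omega) hd) h3 h5 h4 (hwm d) rfl rfl rfl rfl
      hl1 (hw d) hSd
  set s' := layoutBody.run s
  refine ⟨Function.update P d (cell (s.rmem 14 (par d)) (s.rmem 15 (par d)) (w d) (s.rmem 13 d)),
    ⟨?_, ?_, ?_, ?_, ?_, ?_⟩, ?_, by omega, r3, r4, ?_, ?_, ?_⟩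
  · rw [r1] <;> first | exact h0 | norm_num
  · rw [r1] <;> first | exact h20 | norm_num
  · exact r5
  · rw [r6 7 (by norm_num)]; exact hqm
  · rw [r6 12 (by norm_num)]; exact hpar
  · rw [r8]; exact hwm
  · exact r2
  · rw [r9, update_comp_val]; exact hS'
  · rw [r9, r10, r11]; simp only [update_comp_val]; exact hP'
  · intro v hv
    rw [hins, Finset.mem_insert] at hv
    by_cases hvd : v = d
    · subst hvd
      rw [Function.update_self]
      exact ⟨r13, volume_cell hl1 (hw v) hSd⟩
    · rw [Function.update_of_ne hvd]
      obtain ⟨hv1, hv2⟩ := hdrawn v (hv.resolve_left hvd)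
      have hvd' := Fin.val_ne_of_ne hvd
      exact ⟨isPolygonOf_output_congr (r7 v hvd') (r12 v hvd') hv1, hv2⟩

theorem layoutInv_init {n : ℕ} {G : SimpleGraph (Fin n)} {θ w : Fin n → ℝ} {Q : List (Fin n)}
    {par : Fin n → Fin n} {r : Fin n} {s : State} (hn : 0 < n)
    (hord : IsInsertionOrder G θ Q par) (hw : ∀ v, 0 < w v) (hr : Q[0]? = some r)
    (h : HoldsOrder Q par w s)
    (hS : (fun v : Fin n => s.rmem 13 v) = slotWeight w par (removed Q n)) :
    ∃ P, LayoutInv G θ w Q par r (execs initLayout s) (n - 1) P := by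
  obtain ⟨h0, h20, h4, hqm, hpar, hwm⟩ := h
  have hrm := hqm.getElem? hr
  -- Only the value at `r` matters; the other vertices are not yet placed.
  refine ⟨fun _ => cell 0 0 (w r) 0, ⟨?_, ?_, ?_, ?_, ?_, ?_⟩, ?_, ?_, ?_, ?_, ?_,
    Or.inl ⟨by omega, rfl, ?_, ?_⟩, ?_⟩
  case refine_4 => simpa [initLayout, Instr.exec] using hqm
  case refine_5 => simpa [initLayout, Instr.exec] using hpar
  case refine_8 => omega
  case refine_11 =>
    rw [Nat.sub_add_cancel hn]
    simpa [initLayout, Instr.exec] using hS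
  case refine_14 =>
    intro v hv
    have hvr : v = r := by
      obtain ⟨j, hj, hvj⟩ := exists_getElem?_of_length hord.nodup hord.length_eq v
      rw [mem_remaining_of_getElem? hord.nodup hvj] at hv
      rw [show j = 0 by omega] at hvj
      exact Option.some_inj.1 (hvj.symm.trans hr)
    subst hvr
    refine ⟨?_, volume_cell zero_lt_one (hw v) le_rfl⟩
    rw [cell, notchLeft_zero]
    refine isPolygonOf_output_rectangle zero_lt_one
      ((lt_notchTop zero_lt_one (hw v) le_rfl).trans (notchTop_lt zero_lt_one (hw v))) ?_ ?_
    · simp [initLayout, Instr.exec, hrm, h20]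
    · funext i
      fin_cases i <;> simp [initLayout, Instr.exec, hrm, h20, h4, hwm, cellTop]
  all_goals simp [initLayout, Instr.exec, *]

theorem layoutLoop_reaches {n : ℕ} {G : SimpleGraph (Fin n)} {θ w : Fin n → ℝ} {Q : List (Fin n)}
    {par : Fin n → Fin n} {s : State} (hn : 0 < n)
    (hord : IsInsertionOrder G θ Q par) (hw : ∀ v, 0 < w v) (h : HoldsOrder Q par w s)
    (hS : (fun v : Fin n => s.rmem 13 v) = slotWeight w par (removed Q n)) :
    Reaches layoutLoop s (60 * n + 21) fun s' =>
      IsCartogram G w (fun v : Fin n => output s' v) ∧ (∀ v : Fin n, s'.mem 2 v ≤ 6) ∧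
        ∃ p q : ℝ × ℝ, (⋃ v : Fin n, polygonRegion (output s' v)) = Set.Icc p q := by
  obtain ⟨r, hr⟩ : ∃ d, Q[0]? = some d :=
    ⟨_, List.getElem?_eq_getElem (by rw [hord.length_eq]; exact hn)⟩
  have hloop := Reaches.loop (c := lt 20 18) (p := layoutBody)
    (fun j s' => ∃ P, LayoutInv G θ w Q par r s' j P) (fun j => 60 * j) ?_
    (layoutInv_init hn hord hw hr h hS)
  · refine (reaches_block_cons (l := initLayout) (reaches_singleton hloop)).mono
      (by simp [initLayout]; omega) ?_
    rintro s' ⟨j, ⟨P, hI⟩, hc⟩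
    have hc' : ¬ s'.reg 20 < s'.reg 18 := hc
    rw [hI.counter, hI.order.zero] at hc'
    obtain rfl : j = 0 := by omega
    -- No vertex is left to be inserted, so all slots are empty and the polygons alone fill the
    -- rectangle.
    have hS0 : ∀ v : Fin n, s'.rmem 13 v = 0 := by
      intro v
      have h1 : removed Q (0 + 1) = [] := List.drop_eq_nil_iff.2 (by simp)
      have := congr_fun hI.slot v
      rw [h1] at this
      exact this
    have hdrawn := hI.drawn
    rw [zero_add, remaining_one] at hdrawn
    have hlay : ∃ T, IsLayout G θ Finset.univ P (fun v => s'.rmem 14 v) (fun v => s'.rmem 15 v)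
        (fun v => s'.rmem 13 v) T := by
      rcases hI.layout with ⟨h1, h2, -, -⟩ | ⟨-, T, hT⟩
      · refine ⟨w r, ?_⟩
        have : (Finset.univ : Finset (Fin n)) = {r} := by
          ext v
          simp only [Finset.mem_univ, Finset.mem_singleton, true_iff]
          exact Fin.ext (by omega)
        rw [this]
        exact isLayout_singleton h2 (hS0 r)
      · rw [zero_add, remaining_one] at hT
        exact ⟨T, hT⟩
    obtain ⟨T, hT⟩ := hlay
    exact hT.isCartogram hS0 (fun v => (hdrawn v (Finset.mem_univ v)).1)
      fun v => (hdrawn v (Finset.mem_univ v)).2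
  · rintro j s' ⟨P, hI⟩ hc
    have hc' : s'.reg 20 < s'.reg 18 := hc
    rw [hI.counter, hI.order.zero] at hc'
    obtain ⟨k, rfl⟩ : ∃ k, j = k + 1 := ⟨j - 1, by omega⟩
    refine ⟨_, Program.LoopFree.reaches ?_ ⟨k, layoutInv_step hord hw hr hI, ?_⟩⟩
    · simp [layoutBody, Program.ofList, Program.LoopFree]
    · simp [layoutBody, Program.ofList, Program.cost, coordinates, updateSlots, drawHexagon,
        drawRectangle]
      omega

/-! ### The complete program and its running time -/

/-- Compute a cartogram. -/
def cartogramProgram : Program := Program.ofList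
  [adjacencyLoop, queueLoop, eliminateLoop, orientLoop, weightLoop, layoutLoop]

theorem cartogramProgram_reaches {n : ℕ} {G : SimpleGraph (Fin n)} {w : Fin n → ℝ}
    {E : List (Fin n × Fin n)} {sep : Fin n → Fin n → Fin n → Fin n → Prop} (hn : 0 < n)
    (hG : IsOuterTriangulation G sep) (hw : ∀ v, 0 < w v) (hE : IsEdgeList G E) :
    Reaches cartogramProgram (input E w) (90 * E.length + 116 * n + 49) fun s =>
      IsCartogram G w (fun v : Fin n => output s v) ∧ (∀ v : Fin n, s.mem 2 v ≤ 6) ∧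
        ∃ p q : ℝ × ℝ, (⋃ v : Fin n, polygonRegion (output s v)) = Set.Icc p q := by
  refine ((adjacencyLoop_reaches E w).seq fun s₁ h₁ => (queueLoop_reaches h₁).seq fun s₂ h₂ =>
    (eliminateLoop_reaches hn hG hE h₂).seq (T₂ := 20 * n + 11 + (12 * n + 4 + (60 * n + 21 + 1)))
      ?_).mono (by omega) fun _ h => h
  rintro s₃ ⟨hpre, Q, i, hi, hl, hQ, hord⟩
  refine (orientLoop_reaches hG hn hpre hQ hord hi hl).seq ?_
  rintro s₄ ⟨⟨h0, h20, hR, hRR⟩, hQ, θ, par, hins, hpar⟩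
  have hold : HoldsOrder Q par w s₄ := by
    refine ⟨h0, h20, by simp [hRR], hQ, hpar, fun v => ?_⟩
    simp [hR, input]
  refine (weightLoop_reaches hn hl hold (by funext i; simp [hR, input])).seq ?_
  rintro s₅ ⟨hold, hS⟩
  exact reaches_singleton (layoutLoop_reaches hn hins hw hold hS)

end RealRAM

theorem IsOuterTriangulation.length_edgeList_le {n : ℕ} {G : SimpleGraph (Fin n)}
    {E : List (Fin n × Fin n)} {sep : Fin n → Fin n → Fin n → Fin n → Prop}
    (hG : IsOuterTriangulation G sep) (hE : RealRAM.IsEdgeList G E) : E.length ≤ 2 * n := by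
  have h1 := sum_card_nbrs_le hG Finset.univ hG.saturatedOn_univ
  have h2 := sum_length_adjList E
  simp only [hE.length_adjList] at h2
  rw [h2, Finset.card_univ, Fintype.card_fin] at h1
  omega

theorem mainTheorem8 :
    ∃ (A : RealRAM.Program) (C : ℕ),
      ∀ (n : ℕ) (G : SimpleGraph (Fin n)) (w : Fin n → ℝ) (E : List (Fin n × Fin n)),
        0 < n → IsMaximalOuterplanar G → (∀ v, 0 < w v) → RealRAM.IsEdgeList G E →
        ∃ (s : RealRAM.State) (t : ℕ),
          RealRAM.Runs A (RealRAM.input E w) s t ∧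
          t ≤ C * n ∧
          IsCartogram G w (fun v : Fin n => RealRAM.output s v) ∧
          (∀ v : Fin n, s.mem 2 v ≤ 6) ∧
          (∃ p q : ℝ × ℝ, (⋃ v : Fin n, polygonRegion (RealRAM.output s v)) = Set.Icc p q) := by
  -- With at most `2 n` edges the phases take at most `180 n + 116 n + 49` steps, which is below
  -- `400 n` for `n ≥ 1`.
  refine ⟨RealRAM.cartogramProgram, 400, fun n G w E hn hG hw hE => ?_⟩
  obtain ⟨sep, h1, h2, h3⟩ := hG.exists_separation
  have hT : IsOuterTriangulation G sep := ⟨h1, h2, h3⟩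
  obtain ⟨s, t, hrun, ht, hQ⟩ := RealRAM.cartogramProgram_reaches hn hT hw hE
  have := hT.length_edgeList_le hE
  exact ⟨s, t, hrun, by omega, hQ⟩
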